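/- Let $n\ge 1$, let $\Omega\subset\mathbf R^n$ be a bounded domain, $T>0$, $Q=\Omega\times(0,T)$, and let $\Gamma=(\partial\Omega\times[0,T))\cup(\Omega\times\{0\})$ be the parabolic boundary of $Q$. Consider $$u_t=\operatorname{div}\mathcal A(x,t,u,u_x)+\mathcal B(x,t,u,u_x),\qquad(1)$$ where $\mathcal A$ ($\mathbf R^n$-valued) and $\mathcal B$ (real-valued) are measurable functions on $Q\times\mathbf R\times\mathbf R^n$ such that, for almost all $(x,t)\in Q$ and all $u\in\mathbf R$, $p\in\mathbf R^n$, $$p\cdot\mathcal A(x,t,u,p)\ge a|p|^2-b^2u^2-f^2,\quad |\mathcal B(x,t,u,p)|\le c|p|+d|u|+g,\quad |\mathcal A(x,t,u,p)|\le \bar a|p|+e|u|+h .$$ Here $a,\bar a>0$ are constants and $b,\dots,h$ are non-negative measurable functions of $(x,t)$, each with finite norm $\|w\|=\|w\|_{p,q}=\{\int_0^T(\int_\Omega|w|^p\,dx)^{q/p}dt\}^{1/q}$ for exponents $p,q\in[1,\infty]$ of its own (essential suprema replacing integrals for infinite exponents), such that for some fixed $\theta\in(0,1)$ $$p\ge\tfrac{2}{1-\theta},\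 \ \tfrac{n}{2p}+\tfrac1q\le\tfrac{1-\theta}{2}\ \text{ for } b,c,e,f,h;\qquad p\ge\tfrac1{1-\theta},\ \ \tfrac n{2p}+\tfrac1q\le 1-\theta\ \text{ for } d,g .$$ A weak solution of (1) in $Q$ is a function $u$ locally of class $L^{2,\infty}$ in $Q$, with generalized spatial gradient $u_x$ locally of class $L^{2,2}$ in $Q$, such that $$\iint_Q\{-u\varphi_t+\varphi_x\cdot\mathcal A(x,t,u,u_x)\}\,dx\,dt=\iint_Q\varphi\,\mathcal B(x,t,u,u_x)\,dx\,dt$$ for all continuously differentiable $\varphi$ with compact support in $Q$. Weak subsolutions (respectively supersolutions), that is, weak solutions of (1) with $=$ replaced by $\le$ (respectively $\ge$), are defined by the same formula with $=$ replaced by $\le$ (respectively $\ge$) and $\varphi\ge0$. For $M\in\mathbf R$, $u\le M$ on $\Gamma$ (respectively $u\ge M$ on $\Gamma$) means that for every $\varepsilon>0$ there is a neighborhood of $\Gamma$ such that $u\le M+\varepsilon$ (respectively $u\ge M-\varepsilon$) almost everywhere in its intersection with $Q$. Put $$k=(\|b\|+\|d\|)\,|M|+(\|f\|+\|g\|).$$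 MAXIMUM PRINCIPLE. There is a constant $C>0$, depending only on $n$, $\theta$, a positive lower bound for $a$, and upper bounds for $\|b\|,\|c\|,\|d\|$, $T$ and $|\Omega|$, such that, for every $M\in\mathbf R$: (i) if $u$ is a weak solution or a weak subsolution of (1) in $Q$ and $u\le M$ on $\Gamma$, then $u\le M+Ck$ almost everywhere in $Q$; (ii) if $u$ is a weak solution or a weak supersolution of (1) in $Q$ and $u\ge M$ on $\Gamma$, then $u\ge M-Ck$ almost everywhere in $Q$. -/

import Mathlib

open MeasureTheory Set
open scoped ENNReal

namespace ParabolicMax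

/-- The space `ℝⁿ` with its Euclidean norm. -/
abbrev Space (n : ℕ) : Type := EuclideanSpace ℝ (Fin n)

/-- The space-time cylinder `Q = Ω × (0,T)`. -/
def cylinder {n : ℕ} (Ω : Set (Space n)) (T : ℝ) : Set (Space n × ℝ) :=
  Ω ×ˢ Ioo 0 T

/-- The parabolic boundary `Γ = (∂Ω × [0,T)) ∪ (Ω × {0})` of the cylinder. -/
def parabolicBoundary {n : ℕ} (Ω : Set (Space n)) (T : ℝ) : Set (Space n × ℝ) :=
  (frontier Ω ×ˢ Ico 0 T) ∪ (Ω ×ˢ {0})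

/-- The iterated norm `‖w‖_{p,q} = {∫₀ᵀ (∫_Ω |w|^p dx)^{q/p} dt}^{1/q}`, with values in `[0,∞]`;
essential suprema replace integrals for infinite exponents. -/
noncomputable def mixedNorm {n : ℕ} {F : Type*} [NormedAddCommGroup F]
    (Ω : Set (Space n)) (T : ℝ) (p q : ℝ≥0∞) (w : Space n × ℝ → F) : ℝ≥0∞ :=
  eLpNorm (fun t : ℝ => eLpNorm (fun x : Space n => w (x, t)) p (volume.restrict Ω)) q
    (volume.restrict (Ioo 0 T))

/-- Membership in `L^{p,q}(Q)`. -/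
def MemMixed {n : ℕ} {F : Type*} [NormedAddCommGroup F]
    (Ω : Set (Space n)) (T : ℝ) (p q : ℝ≥0∞) (w : Space n × ℝ → F) : Prop :=
  AEStronglyMeasurable w (volume.restrict (cylinder Ω T)) ∧ mixedNorm Ω T p q w < ∞

/-- Being locally of class `L^{p,q}` in `Q`: measurable on `Q`, and of class `L^{p,q}` on every
compact subset of `Q`. -/
def MemMixedLoc {n : ℕ} {F : Type*} [NormedAddCommGroup F]
    (Ω : Set (Space n)) (T : ℝ) (p q : ℝ≥0∞) (w : Space n × ℝ → F) : Prop :=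
  AEStronglyMeasurable w (volume.restrict (cylinder Ω T)) ∧
    ∀ K : Set (Space n × ℝ), IsCompact K → K ⊆ cylinder Ω T →
      mixedNorm Ω T p q (K.indicator w) < ∞

/-- Exponents for the coefficients `b, c, e, f, h`:
`p ≥ 2/(1-θ)` and `n/(2p) + 1/q ≤ (1-θ)/2`. Infinite exponents are allowed. -/
def FirstExponents (n : ℕ) (θ : ℝ) (p q : ℝ≥0∞) : Prop :=
  ENNReal.ofReal (2 / (1 - θ)) ≤ p ∧
    (n : ℝ≥0∞) / (2 * p) + 1 / q ≤ ENNReal.ofReal ((1 - θ) / 2)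

/-- Exponents for the coefficients `d, g`:
`p ≥ 1/(1-θ)` and `n/(2p) + 1/q ≤ 1-θ`. Infinite exponents are allowed. -/
def SecondExponents (n : ℕ) (θ : ℝ) (p q : ℝ≥0∞) : Prop :=
  ENNReal.ofReal (1 / (1 - θ)) ≤ p ∧
    (n : ℝ≥0∞) / (2 * p) + 1 / q ≤ ENNReal.ofReal (1 - θ)

/-- A coefficient function of `(x,t)` together with the exponents of the space `L^{p,q}(Q)` in
which it is measured. -/
structure Coeff (n : ℕ) where
  /-- the function -/
  fn : Space n × ℝ → ℝ
  /-- the exponent in space -/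
  p : ℝ≥0∞
  /-- the exponent in time -/
  q : ℝ≥0∞

/-- The norm of a coefficient in its own space `L^{p,q}(Q)`. -/
noncomputable def Coeff.norm {n : ℕ} (w : Coeff n) (Ω : Set (Space n)) (T : ℝ) : ℝ :=
  (mixedNorm Ω T w.p w.q w.fn).toReal

/-- The coefficient is a non-negative element of its own space `L^{p,q}(Q)`. -/
def Coeff.IsNonnegMem {n : ℕ} (w : Coeff n) (Ω : Set (Space n)) (T : ℝ) : Prop :=
  MemMixed Ω T w.p w.q w.fn ∧ ∀ᵐ z ∂(volume.restrict (cylinder Ω T)), 0 ≤ w.fn z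

/-- The constants `a, ā` and the coefficients `b, …, h` of the structure inequalities. -/
structure StructureData (n : ℕ) where
  a : ℝ
  abar : ℝ
  b : Coeff n
  c : Coeff n
  d : Coeff n
  e : Coeff n
  f : Coeff n
  g : Coeff n
  h : Coeff n

/-- Admissibility of the constants and coefficients, with parameter `θ`. -/
structure StructureData.Admissible {n : ℕ} (S : StructureData n)
    (Ω : Set (Space n)) (T θ : ℝ) : Prop where
  a_pos : 0 < S.a
  abar_pos : 0 < S.abar
  b_mem : S.b.IsNonnegMem Ω T
  c_mem : S.c.IsNonnegMem Ω T
  d_mem : S.d.IsNonnegMem Ω T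
  e_mem : S.e.IsNonnegMem Ω T
  f_mem : S.f.IsNonnegMem Ω T
  g_mem : S.g.IsNonnegMem Ω T
  h_mem : S.h.IsNonnegMem Ω T
  b_exp : FirstExponents n θ S.b.p S.b.q
  c_exp : FirstExponents n θ S.c.p S.c.q
  d_exp : SecondExponents n θ S.d.p S.d.q
  e_exp : FirstExponents n θ S.e.p S.e.q
  f_exp : FirstExponents n θ S.f.p S.f.q
  g_exp : SecondExponents n θ S.g.p S.g.q
  h_exp : FirstExponents n θ S.h.p S.h.q

/-- Measurability on `Q × ℝ × ℝⁿ` of a function of `((x,t), u, p)`, with respect to the product of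
the Lebesgue σ-algebra in `(x,t)` and the Borel σ-algebra in `(u,p)`. -/
def MeasurableNonlinearity {n : ℕ} {F : Type*} [MeasurableSpace F]
    (Ω : Set (Space n)) (T : ℝ) (Φ : Space n × ℝ → ℝ → Space n → F) : Prop :=
  Measurable
    (fun y : NullMeasurableSpace (Space n × ℝ) (volume.restrict (cylinder Ω T)) × ℝ × Space n =>
      Φ y.1 y.2.1 y.2.2)

/-- The structure inequalities for `𝒜` and `ℬ`. -/
def StructureInequalities {n : ℕ} (Ω : Set (Space n)) (T : ℝ) (S : StructureData n)
    (A : Space n × ℝ → ℝ → Space n → Space n) (B : Space n × ℝ → ℝ → Space n → ℝ) : Prop :=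
  ∀ᵐ z ∂(volume.restrict (cylinder Ω T)), ∀ (u : ℝ) (p : Space n),
    S.a * ‖p‖ ^ 2 - S.b.fn z ^ 2 * u ^ 2 - S.f.fn z ^ 2 ≤ inner ℝ p (A z u p) ∧
    |B z u p| ≤ S.c.fn z * ‖p‖ + S.d.fn z * |u| + S.g.fn z ∧
    ‖A z u p‖ ≤ S.abar * ‖p‖ + S.e.fn z * |u| + S.h.fn z

/-- Continuously differentiable functions with compact support in `Q`. -/
def IsTestFunction {n : ℕ} (Ω : Set (Space n)) (T : ℝ) (φ : Space n × ℝ → ℝ) : Prop :=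
  ContDiff ℝ 1 φ ∧ HasCompactSupport φ ∧ tsupport φ ⊆ cylinder Ω T

/-- The spatial gradient `φ_x`. -/
noncomputable def spaceGrad {n : ℕ} (φ : Space n × ℝ → ℝ) (z : Space n × ℝ) : Space n :=
  gradient (fun x : Space n => φ (x, z.2)) z.1

/-- The time derivative `φ_t`. -/
noncomputable def timeDeriv {n : ℕ} (φ : Space n × ℝ → ℝ) (z : Space n × ℝ) : ℝ :=
  deriv (fun t : ℝ => φ (z.1, t)) z.2

/-- `ux` is the generalized spatial gradient of `u` in `Q`. -/
def IsGenGrad {n : ℕ} (Ω : Set (Space n)) (T : ℝ) (u : Space n × ℝ → ℝ)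
    (ux : Space n × ℝ → Space n) : Prop :=
  ∀ φ : Space n × ℝ → ℝ, IsTestFunction Ω T φ →
    ∫ z in cylinder Ω T, u z • spaceGrad φ z = - ∫ z in cylinder Ω T, φ z • ux z

/-- The class of functions in which solutions are sought: `u` is locally of class `L^{2,∞}` and has
the generalized spatial gradient `ux`, locally of class `L^{2,2}`. -/
def InEnergyClass {n : ℕ} (Ω : Set (Space n)) (T : ℝ) (u : Space n × ℝ → ℝ)
    (ux : Space n × ℝ → Space n) : Prop :=
  MemMixedLoc Ω T 2 ∞ u ∧ MemMixedLoc Ω T 2 2 ux ∧ IsGenGrad Ω T u ux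

/-- `u` is a weak solution of `u_t = div 𝒜(x,t,u,u_x) + ℬ(x,t,u,u_x)` in `Q`. -/
def IsWeakSolution {n : ℕ} (Ω : Set (Space n)) (T : ℝ)
    (A : Space n × ℝ → ℝ → Space n → Space n) (B : Space n × ℝ → ℝ → Space n → ℝ)
    (u : Space n × ℝ → ℝ) : Prop :=
  ∃ ux : Space n × ℝ → Space n, InEnergyClass Ω T u ux ∧
    ∀ φ : Space n × ℝ → ℝ, IsTestFunction Ω T φ →
      ∫ z in cylinder Ω T, (-(u z * timeDeriv φ z) + inner ℝ (spaceGrad φ z) (A z (u z) (ux z)))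
        = ∫ z in cylinder Ω T, φ z * B z (u z) (ux z)

/-- `u` is a weak solution of `u_t ≤ div 𝒜(x,t,u,u_x) + ℬ(x,t,u,u_x)` in `Q`. -/
def IsWeakSubsolution {n : ℕ} (Ω : Set (Space n)) (T : ℝ)
    (A : Space n × ℝ → ℝ → Space n → Space n) (B : Space n × ℝ → ℝ → Space n → ℝ)
    (u : Space n × ℝ → ℝ) : Prop :=
  ∃ ux : Space n × ℝ → Space n, InEnergyClass Ω T u ux ∧
    ∀ φ : Space n × ℝ → ℝ, IsTestFunction Ω T φ → (∀ z, 0 ≤ φ z) →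
      ∫ z in cylinder Ω T, (-(u z * timeDeriv φ z) + inner ℝ (spaceGrad φ z) (A z (u z) (ux z)))
        ≤ ∫ z in cylinder Ω T, φ z * B z (u z) (ux z)

/-- `u` is a weak solution of `u_t ≥ div 𝒜(x,t,u,u_x) + ℬ(x,t,u,u_x)` in `Q`. -/
def IsWeakSupersolution {n : ℕ} (Ω : Set (Space n)) (T : ℝ)
    (A : Space n × ℝ → ℝ → Space n → Space n) (B : Space n × ℝ → ℝ → Space n → ℝ)
    (u : Space n × ℝ → ℝ) : Prop :=
  ∃ ux : Space n × ℝ → Space n, InEnergyClass Ω T u ux ∧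
    ∀ φ : Space n × ℝ → ℝ, IsTestFunction Ω T φ → (∀ z, 0 ≤ φ z) →
      ∫ z in cylinder Ω T, φ z * B z (u z) (ux z)
        ≤ ∫ z in cylinder Ω T,
            (-(u z * timeDeriv φ z) + inner ℝ (spaceGrad φ z) (A z (u z) (ux z)))

/-- `u ≤ M` on `Γ`: for every `ε > 0` there is a neighborhood of `Γ` in which `u ≤ M + ε`
(almost everywhere, at the points of `Q`). -/
def LeOnParabolicBoundary {n : ℕ} (Ω : Set (Space n)) (T : ℝ) (u : Space n × ℝ → ℝ)
    (M : ℝ) : Prop :=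
  ∀ ε : ℝ, 0 < ε → ∃ U : Set (Space n × ℝ), IsOpen U ∧ parabolicBoundary Ω T ⊆ U ∧
    ∀ᵐ z ∂(volume.restrict (U ∩ cylinder Ω T)), u z ≤ M + ε

/-- `u ≥ M` on `Γ`: for every `ε > 0` there is a neighborhood of `Γ` in which `u ≥ M - ε`
(almost everywhere, at the points of `Q`). -/
def GeOnParabolicBoundary {n : ℕ} (Ω : Set (Space n)) (T : ℝ) (u : Space n × ℝ → ℝ)
    (M : ℝ) : Prop :=
  ∀ ε : ℝ, 0 < ε → ∃ U : Set (Space n × ℝ), IsOpen U ∧ parabolicBoundary Ω T ⊆ U ∧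
    ∀ᵐ z ∂(volume.restrict (U ∩ cylinder Ω T)), M - ε ≤ u z

/-- The quantity `k = (‖b‖ + ‖d‖) |M| + (‖f‖ + ‖g‖)`. -/
noncomputable def StructureData.k {n : ℕ} (S : StructureData n) (Ω : Set (Space n))
    (T M : ℝ) : ℝ :=
  (S.b.norm Ω T + S.d.norm Ω T) * |M| + (S.f.norm Ω T + S.g.norm Ω T)

end ParabolicMax

/-! The proof is a De Giorgi iteration over the levels of the solution, preceded by a normalization
that makes the constant independent of `M`, `f` and `g`.

Normalization. Put `U = u - M`, so that `U ≤ 0` on the parabolic boundary, and fix a level `κ > 0`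
with `κ ≥ k`. Where `U > κ`, every inhomogeneous term can be multiplied by `U / κ ≥ 1`. Thus `f` is
replaced by `(f / κ) U`, `b |M|` by `(b |M| / κ) U`, and similarly for `g` and `d |M|`. By the
definition of `k` these rescaled coefficients have norm at most one. Above `κ` the equation is
therefore homogeneous, with one lower order coefficient `Θ`, a constant times a sum of seven squares
`β i ^ 2` of controlled norm (`isControlledSubsolution_sub_const`). It remains to show `U ≤ Λ κ`
with `Λ` depending only on the admitted data (`exists_level_bound`), and to let `κ` decrease to `k`.
The lower bound follows by reflection of `u`.

Energy. For `l ≥ κ` the natural test function is `(U - l)₊`. It vanishes near the parabolic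
boundary, but `U` has no time derivative and need not be bounded. The truncation is therefore
regularized and bounded, the equation is tested with a function mollified twice, and limits are
taken (`renormalized`, `energy_inequality`). For almost every `τ` this bounds the mass of `(U - l)₊
^ 2` at time `τ`, plus `a` times the integral of `‖ux‖ ^ 2` over `U > l` up to time `τ`, by four
times the integral of `Θ U ^ 2` over the same set.

Interpolation. Gagliardo–Nirenberg is used on time slices. Combined with Hölder's inequality in
space it gives, for a coefficient that is subcritical with margin `θ`, two estimates with one
integrable kernel in time (`IsSubcritical.exists_kernel`). The linear one has an arbitrarily small
factor in front of the gradient. The superlinear one, for the power `1 + θ / n`, gains a factor `E ^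
(θ / n)`, where `E` bounds the mass.

Conclusion. The linear estimate, absorption of the gradient and Gronwall's inequality give mass and
gradient of order `κ ^ 2` at the level `κ` (`levelBound_initial`). The superlinear estimate bounds
both at level `l + δ` by a multiple of the power `1 + θ / n` of their bound at level `l`
(`levelBound_step`). Iterating over levels that increase to a fixed multiple of `κ` makes the mass
zero there (`deGiorgi`). -/

namespace ParabolicMax

open scoped NNReal Topology Convolution
open Filter

/-! ### Gagliardo–Nirenberg inequalities, by dimension -/

section

open scoped NNReal

/-- Cauchy–Schwarz for lower integrals. -/
theorem lintegral_mul_sq_le {α : Type*} [MeasurableSpace α] {μ : Measure α} {f g : α → ℝ≥0∞}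
    (hf : AEMeasurable f μ) (hg : AEMeasurable g μ) :
    (∫⁻ x, f x * g x ∂μ) ^ 2 ≤ (∫⁻ x, f x ^ 2 ∂μ) * ∫⁻ x, g x ^ 2 ∂μ := by
  have h := ENNReal.lintegral_mul_le_Lp_mul_Lq μ Real.HolderConjugate.two_two hf hg
  simp only [Pi.mul_apply, ENNReal.rpow_two] at h
  calc _ ≤ _ := pow_le_pow_left' h 2
    _ = _ := by
      rw [mul_pow, ← ENNReal.rpow_natCast, ← ENNReal.rpow_natCast, ← ENNReal.rpow_mul,
        ← ENNReal.rpow_mul]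
      norm_num

theorem enorm_fderiv_pow_le {F : Type*} [NormedAddCommGroup F] [NormedSpace ℝ F] {w : F → ℝ}
    (hw : Differentiable ℝ w) (m : ℕ) (x : F) :
    ‖fderiv ℝ (fun x => w x ^ (m + 1)) x‖ₑ ≤ (m + 1) * (‖w x‖ₑ ^ m * ‖fderiv ℝ w x‖ₑ) := by
  rw [((hw x).hasFDerivAt.pow (m + 1)).fderiv, enorm_smul]
  simp only [nsmul_eq_mul, enorm_mul, enorm_pow, Nat.add_sub_cancel, mul_assoc]
  gcongr
  simp only [Nat.cast_add, Nat.cast_one]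
  have : ‖((m : ℝ) + 1)‖ₑ = ((m : ℝ≥0∞) + 1) := by
    rw [Real.enorm_of_nonneg (by positivity), ENNReal.ofReal_add (by positivity) (by positivity)]
    simp
  exact this.le

/-- The fundamental theorem of calculus on the line, transported by the linear isometry between `ℝ`
and `Space 1`. -/
theorem enorm_le_lintegral_fderiv_of_dim_one {v : Space 1 → ℝ} (hv : ContDiff ℝ 1 v)
    (hc : HasCompactSupport v) (x : Space 1) : ‖v x‖ₑ ≤ ∫⁻ y, ‖fderiv ℝ v y‖ₑ := by
  let e : ℝ ≃ₗᵢ[ℝ] Space 1 := (OrthonormalBasis.singleton (Fin 1) ℝ).repr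
  have hmp : MeasurePreserving e volume volume := e.measurePreserving
  obtain ⟨s, rfl⟩ := e.surjective x
  have h := HasCompactSupport.enorm_le_lintegral_Ici_deriv (f := v ∘ e)
    (hv.comp e.contDiff) (hc.comp_homeomorph e.toHomeomorph) s
  refine h.trans ?_
  rw [← hmp.lintegral_comp_emb e.toHomeomorph.measurableEmbedding]
  refine (lintegral_mono' Measure.restrict_le_self le_rfl).trans (lintegral_mono fun y => ?_)
  have h1 : HasDerivAt (v ∘ e) (fderiv ℝ v (e y) (e 1)) y := by
    have h2 := ((hv.differentiable one_ne_zero (e y)).hasFDerivAt).comp_hasDerivAt y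
      (e.toContinuousLinearEquiv.hasFDerivAt.hasDerivAt)
    simpa using h2
  rw [h1.deriv]
  refine ((fderiv ℝ v (e y)).le_opENorm _).trans ?_
  have : ‖e 1‖ₑ = 1 := by
    rw [← ofReal_norm, e.norm_map]; simp
  rw [this, mul_one]

/-- Gagliardo–Nirenberg in dimension one. -/
theorem gagliardoNirenberg_dim_one (m : ℕ) {w : Space 1 → ℝ} (hw : ContDiff ℝ 1 w)
    (hc : HasCompactSupport w) :
    ∫⁻ x, ‖w x‖ₑ ^ (2 * (m + 1)) ≤ 2 ^ m * (∫⁻ x, ‖w x‖ₑ ^ 2) ^ (((m : ℝ) + 2) / 2) *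
      (∫⁻ x, ‖fderiv ℝ w x‖ₑ ^ 2) ^ ((m : ℝ) / 2) := by
  set y := ∫⁻ x, ‖w x‖ₑ ^ 2
  set D := ∫⁻ x, ‖fderiv ℝ w x‖ₑ ^ 2
  -- The derivative of `w ^ 2` is `2 w w'`, so the one-dimensional bound and Cauchy–Schwarz control
  -- the supremum of `w ^ 2`. All but two of the factors `w` are then estimated by this supremum.
  have hsup : ∀ x, ‖w x‖ₑ ^ 2 ≤ 2 * (y ^ (1 / 2 : ℝ) * D ^ (1 / 2 : ℝ)) := by
    intro x
    have h := enorm_le_lintegral_fderiv_of_dim_one (v := fun x => w x ^ 2) (hw.pow 2)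
      (hc.comp_left (g := fun s : ℝ => s ^ 2) (by simp)) x
    rw [enorm_pow] at h
    refine h.trans ?_
    calc ∫⁻ y, ‖fderiv ℝ (fun x => w x ^ 2) y‖ₑ
        ≤ ∫⁻ y, 2 * (‖w y‖ₑ * ‖fderiv ℝ w y‖ₑ) := by
          refine lintegral_mono fun z => ?_
          have := enorm_fderiv_pow_le (hw.differentiable one_ne_zero) 1 z
          simp only [Nat.cast_one, pow_one] at this
          rwa [one_add_one_eq_two (R := ℝ≥0∞)] at this
      _ = 2 * ∫⁻ y, ‖w y‖ₑ * ‖fderiv ℝ w y‖ₑ := by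
          rw [lintegral_const_mul' _ _ (by simp)]
      _ ≤ _ := by
          gcongr
          have h := lintegral_mul_sq_le (μ := (volume : Measure (Space 1)))
            (f := fun x => ‖w x‖ₑ) (g := fun x => ‖fderiv ℝ w x‖ₑ)
            hw.continuous.enorm.aemeasurable
            (hw.continuous_fderiv one_ne_zero).enorm.aemeasurable
          rw [← ENNReal.mul_rpow_of_nonneg _ _ (by norm_num), one_div,
            ENNReal.le_rpow_inv_iff (by norm_num), ENNReal.rpow_two]
          exact h
  calc ∫⁻ x, ‖w x‖ₑ ^ (2 * (m + 1))
      = ∫⁻ x, (‖w x‖ₑ ^ 2) ^ m * ‖w x‖ₑ ^ 2 := by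
        congr with x; ring
    _ ≤ ∫⁻ x, (2 * (y ^ (1 / 2 : ℝ) * D ^ (1 / 2 : ℝ))) ^ m * ‖w x‖ₑ ^ 2 := by
        gcongr with x; exact hsup x
    _ = (2 * (y ^ (1 / 2 : ℝ) * D ^ (1 / 2 : ℝ))) ^ m * y := by
        rw [lintegral_const_mul _ (hw.continuous.enorm.measurable.pow_const 2)]
    _ = _ := by
        rw [mul_pow, mul_pow, ← ENNReal.rpow_natCast (y ^ _), ← ENNReal.rpow_natCast (D ^ _),
          ← ENNReal.rpow_mul, ← ENNReal.rpow_mul,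
          show ((m : ℝ) + 2) / 2 = 1 / 2 * m + 1 by ring,
          ENNReal.rpow_add_of_nonneg _ _ (by positivity) (by norm_num), ENNReal.rpow_one,
          show (m : ℝ) / 2 = 1 / 2 * m by ring]
        ring

/-- Gagliardo–Nirenberg in dimension two. -/
theorem gagliardoNirenberg_dim_two (m : ℕ) : ∃ C : ℝ≥0, ∀ w : Space 2 → ℝ, ContDiff ℝ 1 w →
    HasCompactSupport w →
    ∫⁻ x, ‖w x‖ₑ ^ (2 * (m + 1)) ≤ C * (∫⁻ x, ‖w x‖ₑ ^ 2) * (∫⁻ x, ‖fderiv ℝ w x‖ₑ ^ 2) ^ m := by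
  induction m with
  | zero => exact ⟨1, fun w _ _ => by simp⟩
  | succ m ih =>
    obtain ⟨C, hC⟩ := ih
    let C' := lintegralPowLePowLIntegralFDerivConst (volume : Measure (Space 2)) 2
    refine ⟨C' * (m + 2) ^ 2 * C, fun w hw hc => ?_⟩
    have hdim : Real.HolderConjugate (Module.finrank ℝ (Space 2)) 2 := by
      simpa using Real.HolderConjugate.two_two
    -- In the plane `W^{1,1}` embeds in `L²`. For the power `w ^ (m + 2)`, Cauchy–Schwarz on the
    -- right splits off one gradient factor and leaves the integral of `w ^ (2 * (m + 1))`, which is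
    -- the inductive hypothesis.
    have h := lintegral_pow_le_pow_lintegral_fderiv (volume : Measure (Space 2))
      (u := fun x => w x ^ (m + 2)) (hw.pow _)
      (hc.comp_left (g := fun s : ℝ => s ^ (m + 2)) (by simp)) hdim
    calc ∫⁻ x, ‖w x‖ₑ ^ (2 * (m + 1 + 1)) = ∫⁻ x, ‖w x ^ (m + 2)‖ₑ ^ (2 : ℝ) := by
          congr with x
          rw [enorm_pow, ENNReal.rpow_two, ← pow_mul]
          congr 1; ring
      _ ≤ C' * (∫⁻ x, ‖fderiv ℝ (fun x => w x ^ (m + 2)) x‖ₑ) ^ (2 : ℝ) := h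
      _ ≤ C' * (∫⁻ x, (m + 2) * (‖w x‖ₑ ^ (m + 1) * ‖fderiv ℝ w x‖ₑ)) ^ 2 := by
          rw [ENNReal.rpow_two]
          gcongr with x
          have := enorm_fderiv_pow_le (hw.differentiable one_ne_zero) (m + 1) x
          refine this.trans (le_of_eq ?_)
          push_cast; ring
      _ = C' * ((m + 2) * ∫⁻ x, (‖w x‖ₑ ^ (m + 1) * ‖fderiv ℝ w x‖ₑ)) ^ 2 := by
          rw [lintegral_const_mul' _ _ (by finiteness)]
      _ ≤ C' * ((m + 2) ^ 2 * ((∫⁻ x, (‖w x‖ₑ ^ (m + 1)) ^ 2) *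
            ∫⁻ x, ‖fderiv ℝ w x‖ₑ ^ 2)) := by
          rw [mul_pow]
          gcongr
          exact lintegral_mul_sq_le (hw.continuous.enorm.aemeasurable.pow_const _)
            (hw.continuous_fderiv one_ne_zero).enorm.aemeasurable
      _ ≤ C' * ((m + 2) ^ 2 * ((C * (∫⁻ x, ‖w x‖ₑ ^ 2) * (∫⁻ x, ‖fderiv ℝ w x‖ₑ ^ 2) ^ m) *
            ∫⁻ x, ‖fderiv ℝ w x‖ₑ ^ 2)) := by
          gcongr
          refine le_trans (le_of_eq ?_) (hC w hw hc)
          congr with x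
          rw [← pow_mul]; congr 1; ring
      _ = _ := by push_cast; ring

/-- Sobolev's inequality in dimension at least three. -/
theorem sobolev_of_three_le {n : ℕ} (hn : 3 ≤ n) : ∃ C : ℝ≥0, ∀ w : Space n → ℝ, ContDiff ℝ 1 w →
    HasCompactSupport w →
    ∫⁻ x, ‖w x‖ₑ ^ (2 * n / (n - 2) : ℝ) ≤
      C * (∫⁻ x, ‖fderiv ℝ w x‖ₑ ^ 2) ^ ((n : ℝ) / (n - 2)) := by
  have hn' : (3 : ℝ) ≤ n := by exact_mod_cast hn
  set r : ℝ := 2 * n / (n - 2) with hr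
  have hr0 : 0 < r := by rw [hr]; apply div_pos <;> linarith
  let C₀ := eLpNormLESNormFDerivOfEqInnerConst (volume : Measure (Space n)) 2
  refine ⟨C₀ ^ r, fun w hw hc => ?_⟩
  have h := eLpNorm_le_eLpNorm_fderiv_of_eq_inner (volume : Measure (Space n)) hw hc
    (p := 2) (p' := r.toNNReal) (by norm_num) (by simp; omega) (by
      rw [Real.coe_toNNReal _ hr0.le, hr]
      simp only [finrank_euclideanSpace, Fintype.card_fin, NNReal.coe_inv, NNReal.coe_ofNat]
      field_simp)
  have hr' : (r.toNNReal : ℝ≥0) ≠ 0 := by simpa using hr0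
  have h2 := ENNReal.rpow_le_rpow h hr0.le
  rw [ENNReal.mul_rpow_of_nonneg _ _ hr0.le] at h2
  have e1 := eLpNorm_nnreal_pow_eq_lintegral (μ := (volume : Measure (Space n))) (f := w) hr'
  rw [Real.coe_toNNReal _ hr0.le] at e1
  rw [e1] at h2
  refine h2.trans (le_of_eq ?_)
  rw [ENNReal.coe_rpow_of_nonneg _ hr0.le]
  congr 1
  have e2 := eLpNorm_nnreal_pow_eq_lintegral (μ := (volume : Measure (Space n)))
    (f := fderiv ℝ w) (p := 2) (by norm_num)
  simp only [NNReal.coe_ofNat, ENNReal.rpow_two] at e2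
  have e3 : r = 2 * ((n : ℝ) / (n - 2)) := by rw [hr]; ring
  rw [← e2, ← ENNReal.rpow_natCast, ← ENNReal.rpow_mul, e3]
  simp

/-- A Gagliardo–Nirenberg inequality with an exponent `R` large enough to interpolate all the
exponents that are subcritical with margin `θ`. -/
theorem exists_gagliardoNirenberg (n : ℕ) (hn : 1 ≤ n) (θ : ℝ) (hθ : 0 < θ) (hθ' : θ < 1) :
    ∃ R : ℝ, 2 < R ∧ (n : ℝ) * (R - 2) / 4 ≤ R / 2 ∧
      (∀ s : ℝ, 0 ≤ s → s ≤ (1 - θ) / 2 → n * s ≤ 1 - θ → 1 + θ / n ≤ R * (1 / 2 - s)) ∧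
      ∃ C : ℝ≥0, ∀ w : Space n → ℝ, ContDiff ℝ 1 w → HasCompactSupport w →
        ∫⁻ x, ‖w x‖ₑ ^ R ≤ C * (∫⁻ x, ‖w x‖ₑ ^ 2) ^ (R / 2 - n * (R - 2) / 4) *
          (∫⁻ x, ‖fderiv ℝ w x‖ₑ ^ 2) ^ ((n : ℝ) * (R - 2) / 4) := by
  have hn' : (1 : ℝ) ≤ n := by exact_mod_cast hn
  have hθn : θ / n ≤ 1 := by rw [div_le_one (by linarith)]; linarith
  obtain h3 | h2 := le_or_gt 3 n
  -- From dimension three on, `R` is the Sobolev exponent, for which the power of the `L²` integral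
  -- is zero. The bound `n * s ≤ 1 - θ` yields `R * (1 / 2 - s) ≥ 1 + 2 * θ / (n - 2)`, more than is
  -- asked.
  · have hn3 : (3 : ℝ) ≤ n := by exact_mod_cast h3
    have hn0 : (n : ℝ) - 2 ≠ 0 := by linarith
    have hnpos : 0 < (n : ℝ) - 2 := by linarith
    obtain ⟨C, hC⟩ := sobolev_of_three_le h3
    have e1 : (n : ℝ) * (2 * n / (n - 2) - 2) / 4 = n / (n - 2) := by field_simp; ring
    have e2 : 2 * (n : ℝ) / (n - 2) / 2 = n / (n - 2) := by field_simp
    refine ⟨2 * n / (n - 2), ?_, ?_, ?_, C, fun w hw hc => ?_⟩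
    · rw [lt_div_iff₀ hnpos]; linarith
    · rw [e1, e2]
    · intro s hs0 hs1 hs2
      have : 1 + θ / n ≤ (2 / (n - 2)) * (n / 2 - n * s) := by
        have h1 : (2 / (n - 2)) * (n / 2 - (1 - θ)) ≤ (2 / ((n : ℝ) - 2)) * (n / 2 - n * s) := by
          gcongr
        refine le_trans ?_ h1
        rw [div_mul_eq_mul_div, le_div_iff₀ hnpos]
        have : θ / n * (n - 2) ≤ θ := by
          rw [div_mul_eq_mul_div, div_le_iff₀ (by linarith)]; nlinarith
        nlinarith
      refine this.trans (le_of_eq ?_)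
      field_simp
    · rw [e1, e2, sub_self, ENNReal.rpow_zero, mul_one]
      exact hC w hw hc
  -- In dimensions one and two arbitrarily large even exponents are available. Here the bound `s ≤
  -- (1 - θ) / 2` is used: `1 / 2 - s ≥ θ / 2`, so `m ≥ 2 / θ` gives `R * (1 / 2 - s) ≥ (m + 1) * θ
  -- ≥ 2`, which is at least `1 + θ / n`.
  · obtain ⟨m, hm⟩ := exists_nat_ge (2 / θ)
    have hmθ : 2 ≤ m * θ := by rwa [div_le_iff₀ hθ] at hm
    have hm0 : (2 : ℝ) < m := by nlinarith
    have hcond : ∀ s : ℝ, 0 ≤ s → s ≤ (1 - θ) / 2 → n * s ≤ 1 - θ →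
        1 + θ / n ≤ (2 * ((m : ℝ) + 1)) * (1 / 2 - s) := by
      intro s _ hs _
      have : (2 * ((m : ℝ) + 1)) * (θ / 2) ≤ (2 * ((m : ℝ) + 1)) * (1 / 2 - s) := by
        gcongr; linarith
      nlinarith
    interval_cases n
    · refine ⟨2 * (m + 1), by linarith, by push_cast; linarith, hcond, 2 ^ m, fun w hw hc => ?_⟩
      have := gagliardoNirenberg_dim_one m hw hc
      convert this using 2
      · ext x; rw [← ENNReal.rpow_natCast]; push_cast; rfl
      · push_cast; congr 2; ring
      · congr 1; push_cast; ring
    · obtain ⟨C, hC⟩ := gagliardoNirenberg_dim_two m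
      refine ⟨2 * (m + 1), by linarith, by push_cast; linarith, hcond, C, fun w hw hc => ?_⟩
      have := hC w hw hc
      convert this using 2
      · ext x; rw [← ENNReal.rpow_natCast]; push_cast; rfl
      · congr 1
        rw [show (2 * ((m : ℝ) + 1)) / 2 - (2 : ℕ) * (2 * ((m : ℝ) + 1) - 2) / 4 = 1 by
          push_cast; ring, ENNReal.rpow_one]
      · rw [← ENNReal.rpow_natCast]; congr 1; push_cast; ring

end

/-! ### Mollification -/

section

section Mollify

variable {G F : Type*} [NormedAddCommGroup G] [NormedSpace ℝ G] [FiniteDimensional ℝ G]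
  [MeasurableSpace G] {μ : Measure G} [NormedAddCommGroup F] [NormedSpace ℝ F]

/-- Convolution with a normalized bump function. -/
noncomputable def mollify (φ : ContDiffBump (0 : G)) (μ : Measure G) (f : G → F) : G → F :=
  φ.normed μ ⋆[ContinuousLinearMap.lsmul ℝ ℝ, μ] f

theorem mollify_apply (φ : ContDiffBump (0 : G)) (f : G → F) (z : G) :
    mollify φ μ f z = ∫ t, φ.normed μ t • f (z - t) ∂μ := rfl

variable [BorelSpace G] [μ.IsAddHaarMeasure]

theorem mollify_apply_swap (φ : ContDiffBump (0 : G)) (f : G → F) (z : G) :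
    mollify φ μ f z = ∫ y, φ.normed μ (z - y) • f y ∂μ := by
  rw [mollify, convolution_eq_swap]; rfl

theorem integrable_mollify_integrand (φ : ContDiffBump (0 : G)) {f : G → F}
    (hf : LocallyIntegrable f μ) (z : G) :
    Integrable (fun t => φ.normed μ t • f (z - t)) μ :=
  φ.hasCompactSupport_normed.convolutionExists_left (ContinuousLinearMap.lsmul ℝ ℝ)
    φ.continuous_normed hf z

theorem contDiff_mollify [CompleteSpace F] (φ : ContDiffBump (0 : G)) {f : G → F}
    (hf : LocallyIntegrable f μ) : ContDiff ℝ 1 (mollify φ μ f) :=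
  φ.hasCompactSupport_normed.contDiff_convolution_left (n := 1) (ContinuousLinearMap.lsmul ℝ ℝ)
    φ.contDiff_normed hf

theorem support_mollify_subset (φ : ContDiffBump (0 : G)) (f : G → F) :
    Function.support (mollify φ μ f) ⊆ Metric.cthickening φ.rOut (tsupport f) := by
  refine (support_convolution_subset _).trans ?_
  rw [φ.support_normed_eq]
  rintro _ ⟨a, ha, b, hb, rfl⟩
  refine Metric.mem_cthickening_of_dist_le _ b _ _ (subset_tsupport _ hb) ?_
  simp only [dist_add_self_left]
  exact (mem_ball_zero_iff.1 ha).le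

theorem tsupport_mollify_subset (φ : ContDiffBump (0 : G)) (f : G → F) :
    tsupport (mollify φ μ f) ⊆ Metric.cthickening φ.rOut (tsupport f) :=
  closure_minimal (support_mollify_subset φ f) Metric.isClosed_cthickening

theorem hasCompactSupport_mollify (φ : ContDiffBump (0 : G)) {f : G → F}
    (hf : HasCompactSupport f) : HasCompactSupport (mollify φ μ f) :=
  HasCompactSupport.of_support_subset_isCompact
    (IsCompact.cthickening hf) (support_mollify_subset φ f)

theorem mollify_congr_ae (φ : ContDiffBump (0 : G)) {f g : G → F} (h : f =ᵐ[μ] g) :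
    mollify φ μ f = mollify φ μ g := by
  ext z
  rw [mollify_apply_swap, mollify_apply_swap]
  refine integral_congr_ae ?_
  filter_upwards [h] with y hy
  rw [hy]

/-- Mollification commutes with differentiation of test functions. -/
theorem fderiv_mollify [CompleteSpace F] (φ : ContDiffBump (0 : G)) {ψ : G → F}
    (hψ : ContDiff ℝ 1 ψ) (hc : HasCompactSupport ψ) (z : G) :
    fderiv ℝ (mollify φ μ ψ) z = mollify φ μ (fderiv ℝ ψ) z := by
  rw [mollify, (hc.hasFDerivAt_convolution_right (ContinuousLinearMap.lsmul ℝ ℝ)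
    (φ.continuous_normed (μ := μ)).locallyIntegrable hψ z).fderiv]
  rfl

/-- The derivative of a mollification, put on the mollifier. -/
theorem fderiv_mollify_apply [CompleteSpace F] (φ : ContDiffBump (0 : G)) {f : G → F}
    (hf : LocallyIntegrable f μ) (z v : G) :
    fderiv ℝ (mollify φ μ f) z v = ∫ y, (fderiv ℝ (φ.normed μ) (z - y) v) • f y ∂μ := by
  rw [mollify, (φ.hasCompactSupport_normed.hasFDerivAt_convolution_left
    (ContinuousLinearMap.lsmul ℝ ℝ) (φ.contDiff_normed (n := 1)) hf z).fderiv, convolution_eq_swap,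
    ContinuousLinearMap.integral_apply]
  · rfl
  · have := ((φ.hasCompactSupport_normed (μ := μ)).fderiv ℝ).convolutionExists_left
      ((ContinuousLinearMap.lsmul ℝ ℝ : ℝ →L[ℝ] F →L[ℝ] F).precompL G)
      ((φ.contDiff_normed (n := 1) (μ := μ)).continuous_fderiv one_ne_zero) hf z
    exact this.integrable_swap

/-- Translations are continuous in `L^p`. -/
theorem tendsto_eLpNorm_translate {E : Type*} [NormedAddCommGroup E] {p : ℝ≥0∞} (hp : 1 ≤ p)
    (hp' : p ≠ ∞) {f : G → E} (hf : MemLp f p μ) :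
    Tendsto (fun t : G => eLpNorm (fun z => f (z - t) - f z) p μ) (𝓝 0) (𝓝 0) := by
  have : Fact (1 ≤ p) := ⟨hp⟩
  have : Fact (p ≠ ∞) := ⟨hp'⟩
  have hc : Continuous fun t : G => DomAddAct.mk (-t) +ᵥ hf.toLp f :=
    (DomAddAct.continuous_mk.comp continuous_neg).vadd continuous_const
  have h0 := (hc.tendsto 0).edist (tendsto_const_nhds (x := hf.toLp f))
  simp only [neg_zero, DomAddAct.mk_zero, zero_vadd, edist_self] at h0
  refine h0.congr fun t => ?_
  rw [DomAddAct.mk_vadd_toLp, Lp.edist_toLp_toLp]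
  congr 1
  ext z
  simp [sub_eq_neg_add]

/-- Jensen's inequality for the probability measure whose density is the normed bump, in the form
that `L^q` norms of a probability measure increase with `q`. -/
theorem enorm_mollify_sub_rpow_le [CompleteSpace F] (φ : ContDiffBump (0 : G)) {f : G → F}
    (hf : LocallyIntegrable f μ) {q : ℝ} (hq : 1 ≤ q) (z : G) :
    ‖mollify φ μ f z - f z‖ₑ ^ q ≤
      ∫⁻ t, ENNReal.ofReal (φ.normed μ t) * ‖f (z - t) - f z‖ₑ ^ q ∂μ := by
  have hm : Measurable fun t => ENNReal.ofReal (φ.normed μ t) :=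
    φ.continuous_normed.measurable.ennreal_ofReal
  set ν := μ.withDensity fun t => ENNReal.ofReal (φ.normed μ t) with hν
  have hprob : IsProbabilityMeasure ν := ⟨by
    rw [hν, withDensity_apply _ MeasurableSet.univ, Measure.restrict_univ,
      ← ofReal_integral_eq_lintegral_ofReal φ.integrable_normed
        (ae_of_all _ φ.nonneg_normed), φ.integral_normed, ENNReal.ofReal_one]⟩
  have hI := integrable_mollify_integrand φ hf z
  have h1 : mollify φ μ f z - f z = ∫ t, φ.normed μ t • (f (z - t) - f z) ∂μ := by
    simp_rw [smul_sub]
    rw [integral_sub hI (φ.integrable_normed.smul_const _), integral_smul_const,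
      φ.integral_normed, one_smul, mollify_apply]
  have hfm : AEStronglyMeasurable (fun t => f (z - t) - f z) μ :=
    (hf.aestronglyMeasurable.comp_quasiMeasurePreserving
      (quasiMeasurePreserving_sub_left_of_right_invariant μ z)).sub aestronglyMeasurable_const
  have hfν : AEStronglyMeasurable (fun t => f (z - t) - f z) ν :=
    hfm.mono_ac (withDensity_absolutelyContinuous _ _)
  have h2 : ‖mollify φ μ f z - f z‖ₑ ≤ eLpNorm (fun t => f (z - t) - f z) 1 ν := by
    rw [h1, eLpNorm_one_eq_lintegral_enorm, hν,
      lintegral_withDensity_eq_lintegral_mul₀ hm.aemeasurable hfm.enorm]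
    refine (enorm_integral_le_lintegral_enorm _).trans (lintegral_mono fun t => ?_)
    simp only [enorm_smul, Pi.mul_apply]
    rw [Real.enorm_of_nonneg (φ.nonneg_normed t)]
  have h3 : ‖mollify φ μ f z - f z‖ₑ ≤ eLpNorm (fun t => f (z - t) - f z) (ENNReal.ofReal q) ν :=
    h2.trans (eLpNorm_le_eLpNorm_of_exponent_le (by simpa using hq) hfν)
  have hq0 : 0 < q := by linarith
  rw [eLpNorm_eq_lintegral_rpow_enorm_toReal (by simpa using hq0) (by simp),
    ENNReal.toReal_ofReal hq0.le, one_div, ENNReal.le_rpow_inv_iff hq0] at h3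
  refine h3.trans (le_of_eq ?_)
  rw [hν, lintegral_withDensity_eq_lintegral_mul₀ hm.aemeasurable (hfm.enorm.pow_const q)]
  rfl

/-- Mollifications converge in `L^p`. -/
theorem tendsto_eLpNorm_mollify [CompleteSpace F] {p : ℝ≥0∞} (hp : 1 ≤ p) (hp' : p ≠ ∞)
    {f : G → F} (hf : MemLp f p μ) {φ : ℕ → ContDiffBump (0 : G)}
    (hφ : Tendsto (fun k => (φ k).rOut) atTop (𝓝 0)) :
    Tendsto (fun k => eLpNorm (mollify (φ k) μ f - f) p μ) atTop (𝓝 0) := by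
  -- Mollification depends only on the almost everywhere class of `f`. A strongly measurable
  -- representative makes the integrand jointly measurable, as Tonelli's theorem requires below.
  wlog hsm : StronglyMeasurable f generalizing f
  · obtain ⟨g, hg, hfg⟩ := hf.1
    refine (this ((memLp_congr_ae hfg).1 hf) hg).congr fun k => ?_
    rw [mollify_congr_ae (φ k) hfg]
    exact eLpNorm_congr_ae (by filter_upwards [hfg] with z hz; simp [hz])
  have hloc : LocallyIntegrable f μ := hf.locallyIntegrable hp
  rw [ENNReal.tendsto_nhds_zero]
  intro ε hε
  have htr := (ENNReal.tendsto_nhds_zero.1 (tendsto_eLpNorm_translate hp hp' hf)) ε hε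
  obtain ⟨r, hr, hball⟩ := Metric.eventually_nhds_iff_ball.1 htr
  have hp0 : p ≠ 0 := (zero_lt_one.trans_le hp).ne'
  have hq : 1 ≤ p.toReal := by
    rw [← ENNReal.toReal_one]; exact ENNReal.toReal_mono hp' hp
  have hq0 : 0 < p.toReal := by linarith
  filter_upwards [(tendsto_order.1 hφ).2 r hr] with k hk
  rw [← ENNReal.rpow_le_rpow_iff hq0]
  have hpow : ∀ g : G → F, eLpNorm g p μ ^ p.toReal = ∫⁻ z, ‖g z‖ₑ ^ p.toReal ∂μ := by
    intro g
    rw [eLpNorm_eq_lintegral_rpow_enorm_toReal hp0 hp', ← ENNReal.rpow_mul,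
      one_div_mul_cancel hq0.ne', ENNReal.rpow_one]
  rw [hpow]
  have hmeas : Measurable (Function.uncurry fun (z t : G) =>
      ENNReal.ofReal ((φ k).normed μ t) * ‖f (z - t) - f z‖ₑ ^ p.toReal) := by
    refine Measurable.mul ?_ (Measurable.pow_const ?_ _)
    · exact ((φ k).continuous_normed.measurable.comp measurable_snd).ennreal_ofReal
    · exact ((hsm.comp_measurable (measurable_fst.sub measurable_snd)).sub
        (hsm.comp_measurable measurable_fst)).enorm
  calc ∫⁻ z, ‖(mollify (φ k) μ f - f) z‖ₑ ^ p.toReal ∂μ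
      ≤ ∫⁻ z, ∫⁻ t, ENNReal.ofReal ((φ k).normed μ t) * ‖f (z - t) - f z‖ₑ ^ p.toReal ∂μ ∂μ :=
        lintegral_mono fun z => enorm_mollify_sub_rpow_le (φ k) hloc hq z
    _ = ∫⁻ t, ∫⁻ z, ENNReal.ofReal ((φ k).normed μ t) * ‖f (z - t) - f z‖ₑ ^ p.toReal ∂μ ∂μ :=
        lintegral_lintegral_swap hmeas.aemeasurable
    _ ≤ ∫⁻ t, ENNReal.ofReal ((φ k).normed μ t) * ε ^ p.toReal ∂μ := by
        refine lintegral_mono fun t => ?_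
        rw [lintegral_const_mul' _ _ ENNReal.ofReal_ne_top]
        by_cases ht : t ∈ Metric.ball (0 : G) (φ k).rOut
        · gcongr
          rw [← hpow fun z => f (z - t) - f z]
          gcongr
          exact hball t (Metric.ball_subset_ball hk.le ht)
        · rw [← (φ k).support_normed_eq (μ := μ), Function.notMem_support] at ht
          simp [ht]
    _ = ε ^ p.toReal := by
        rw [lintegral_mul_const _ ((φ k).continuous_normed.measurable.ennreal_ofReal),
          ← ofReal_integral_eq_lintegral_ofReal (φ k).integrable_normed
            (ae_of_all _ (φ k).nonneg_normed), (φ k).integral_normed, ENNReal.ofReal_one, one_mul]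

/-- Mollification is symmetric with respect to the pairing given by a bilinear map. -/
theorem integral_mollify_left {F₁ F₂ : Type*} [NormedAddCommGroup F₁] [NormedSpace ℝ F₁]
    [CompleteSpace F₁] [NormedAddCommGroup F₂] [NormedSpace ℝ F₂] [CompleteSpace F₂]
    (L : F₁ →L[ℝ] F₂ →L[ℝ] ℝ) (φ : ContDiffBump (0 : G)) {g : G → F₁} {X : G → F₂}
    (hg : Continuous g) (hgc : HasCompactSupport g) (hX : Integrable X μ) :
    ∫ z, L (mollify φ μ g z) (X z) ∂μ = ∫ z, L (g z) (mollify φ μ X z) ∂μ := by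
  have hgl : LocallyIntegrable g μ := hg.locallyIntegrable
  have e1 : ∀ z, L (mollify φ μ g z) (X z) = ∫ y, L (φ.normed μ (z - y) • g y) (X z) ∂μ := by
    intro z
    rw [mollify_apply_swap]
    exact ((L.flip (X z)).integral_comp_comm
      (ConvolutionExistsAt.integrable_swap (L := ContinuousLinearMap.lsmul ℝ ℝ)
        (integrable_mollify_integrand φ hgl z))).symm
  have e2 : ∀ z, L (g z) (mollify φ μ X z) = ∫ y, L (g z) (φ.normed μ (z - y) • X y) ∂μ := by
    intro z
    rw [mollify_apply_swap]
    exact ((L (g z)).integral_comp_comm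
      (ConvolutionExistsAt.integrable_swap (L := ContinuousLinearMap.lsmul ℝ ℝ)
        (integrable_mollify_integrand φ hX.locallyIntegrable z))).symm
  simp_rw [e1, e2]
  -- After Fubini only the evenness of the normed bump remains. Integrability on the product holds
  -- because the kernel is bounded and `‖X‖ ‖g‖` is integrable there.
  rw [integral_integral_swap]
  · refine integral_congr_ae (ae_of_all _ fun z => integral_congr_ae (ae_of_all _ fun y => ?_))
    simp only [map_smul, smul_apply]
    rw [← φ.normed_neg (z - y), neg_sub]
  · obtain ⟨C, hC⟩ := (φ.hasCompactSupport_normed (μ := μ)).exists_bound_of_continuous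
      φ.continuous_normed
    have hC0 : 0 ≤ C := (norm_nonneg _).trans (hC 0)
    have hgi : Integrable g μ := hg.integrable_of_hasCompactSupport hgc
    have hprod : Integrable (fun q : G × G => ‖X q.1‖ * ‖g q.2‖) (μ.prod μ) :=
      hX.norm.mul_prod hgi.norm
    refine (hprod.const_mul (‖L‖ * C)).mono' ?_ (ae_of_all _ fun q => ?_)
    · have h1 : AEStronglyMeasurable (fun q : G × G => φ.normed μ (q.1 - q.2) • g q.2)
          (μ.prod μ) :=
        ((φ.continuous_normed.comp (continuous_fst.sub continuous_snd)).smul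
          (hg.comp continuous_snd)).aestronglyMeasurable
      exact L.aestronglyMeasurable_comp₂ h1 hX.1.comp_fst
    · simp only [Function.uncurry, map_smul, smul_apply, norm_smul]
      have h1 := L.le_opNorm₂ (g q.2) (X q.1)
      have h2 := hC (q.1 - q.2)
      calc _ ≤ C * (‖L‖ * ‖g q.2‖ * ‖X q.1‖) := by gcongr
        _ = _ := by ring

end Mollify

end

section

/-! ### Regularized truncations -/

/-- A continuous approximation of the indicator function of `(l, ∞)`, of bounded support. -/
noncomputable def ramp (l : ℝ) (N : ℕ) (s : ℝ) : ℝ :=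
  max 0 (min 1 (N * (s - l))) * max 0 (min 1 (N - s))

/-- The primitive of `ramp`, an approximation of `(s - l)₊`. -/
noncomputable def ramp₁ (l : ℝ) (N : ℕ) (s : ℝ) : ℝ := ∫ x in l..s, ramp l N x

/-- The second primitive of `ramp`, an approximation of `(s - l)₊² / 2`. -/
noncomputable def ramp₂ (l : ℝ) (N : ℕ) (s : ℝ) : ℝ := ∫ x in l..s, ramp₁ l N x

variable (l : ℝ) (N : ℕ)

theorem continuous_ramp : Continuous (ramp l N) := by
  unfold ramp; fun_prop

theorem ramp_nonneg (s : ℝ) : 0 ≤ ramp l N s := mul_nonneg (le_max_left _ _) (le_max_left _ _)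

theorem ramp_le_one (s : ℝ) : ramp l N s ≤ 1 :=
  mul_le_one₀ (max_le zero_le_one (min_le_left _ _)) (le_max_left _ _)
    (max_le zero_le_one (min_le_left _ _))

theorem ramp_of_le {s : ℝ} (hs : s ≤ l) : ramp l N s = 0 := by
  have : (N : ℝ) * (s - l) ≤ 0 := mul_nonpos_of_nonneg_of_nonpos (by positivity) (by linarith)
  rw [ramp, max_eq_left ((min_le_right _ _).trans this), zero_mul]

theorem ramp_of_ge {s : ℝ} (hs : N ≤ s) : ramp l N s = 0 := by
  rw [ramp, max_eq_left ((min_le_right _ _).trans (by linarith : (N : ℝ) - s ≤ 0)), mul_zero]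

theorem tendsto_ramp (s : ℝ) :
    Tendsto (fun N => ramp l N s) atTop (𝓝 (if l < s then 1 else 0)) := by
  split_ifs with h
  · refine tendsto_const_nhds.congr' ?_
    obtain ⟨m, hm⟩ := exists_nat_ge (1 / (s - l))
    obtain ⟨k, hk⟩ := exists_nat_ge (s + 1)
    filter_upwards [eventually_ge_atTop m, eventually_ge_atTop k] with N h1 h2
    have h1' : (m : ℝ) ≤ N := by exact_mod_cast h1
    have h2' : (k : ℝ) ≤ N := by exact_mod_cast h2
    have hs : 0 < s - l := by linarith
    have : 1 ≤ N * (s - l) := by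
      rw [div_le_iff₀ hs] at hm; nlinarith
    rw [ramp, min_eq_left this, min_eq_left (by linarith)]
    norm_num
  · simp [ramp_of_le l _ (not_lt.1 h)]

theorem hasDerivAt_ramp₁ (s : ℝ) : HasDerivAt (ramp₁ l N) (ramp l N s) s :=
  intervalIntegral.integral_hasDerivAt_right ((continuous_ramp l N).intervalIntegrable _ _)
    ((continuous_ramp l N).stronglyMeasurableAtFilter _ _) (continuous_ramp l N).continuousAt

theorem continuous_ramp₁ : Continuous (ramp₁ l N) :=
  continuous_iff_continuousAt.2 fun s => (hasDerivAt_ramp₁ l N s).continuousAt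

theorem contDiff_ramp₁ : ContDiff ℝ 1 (ramp₁ l N) := by
  rw [contDiff_one_iff_deriv]
  exact ⟨fun s => (hasDerivAt_ramp₁ l N s).differentiableAt, by
    simpa only [funext fun s => (hasDerivAt_ramp₁ l N s).deriv] using continuous_ramp l N⟩

theorem ramp₁_of_le {s : ℝ} (hs : s ≤ l) : ramp₁ l N s = 0 := by
  rw [ramp₁, intervalIntegral.integral_zero_ae]
  refine ae_of_all _ fun x hx => ramp_of_le l N ?_
  rw [uIoc_of_ge hs] at hx
  exact hx.2

theorem monotone_ramp₁ : Monotone (ramp₁ l N) :=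
  monotone_of_deriv_nonneg (fun s => (hasDerivAt_ramp₁ l N s).differentiableAt) fun s => by
    rw [(hasDerivAt_ramp₁ l N s).deriv]; exact ramp_nonneg l N s

theorem ramp₁_nonneg (s : ℝ) : 0 ≤ ramp₁ l N s := by
  obtain h | h := le_total s l
  · rw [ramp₁_of_le l N h]
  · rw [← ramp₁_of_le l N le_rfl]; exact monotone_ramp₁ l N h

theorem ramp₁_le (s : ℝ) : ramp₁ l N s ≤ max (s - l) 0 := by
  obtain h | h := le_total s l
  · rw [ramp₁_of_le l N h]; exact le_max_right _ _
  · refine le_trans ?_ (le_max_left _ _)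
    have := intervalIntegral.integral_mono_on (μ := volume) h
      ((continuous_ramp l N).intervalIntegrable _ _) (intervalIntegrable_const (c := (1 : ℝ)))
      fun x _ => ramp_le_one l N x
    simpa [ramp₁] using this

/-- This bound is the reason for cutting `ramp` off at `N`: it makes the truncated test functions
bounded, so that they may multiply a source that is merely locally integrable. -/
theorem ramp₁_le_const (s : ℝ) : ramp₁ l N s ≤ max (N - l) 0 := by
  obtain h | h := le_total s N
  · exact (monotone_ramp₁ l N h).trans (ramp₁_le l N N)
  · refine le_trans (le_of_eq ?_) (ramp₁_le l N N)
    have : ∫ x in (N : ℝ)..s, ramp l N x = 0 := by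
      refine intervalIntegral.integral_zero_ae (ae_of_all _ fun x hx => ramp_of_ge l N ?_)
      rw [uIoc_of_le h] at hx
      exact hx.1.le
    rw [ramp₁, ramp₁, ← intervalIntegral.integral_add_adjacent_intervals
      ((continuous_ramp l N).intervalIntegrable l N) ((continuous_ramp l N).intervalIntegrable N s),
      this, add_zero]

theorem tendsto_ramp₁ (s : ℝ) : Tendsto (fun N => ramp₁ l N s) atTop (𝓝 (max (s - l) 0)) := by
  obtain h | h := le_total s l
  · simp [ramp₁_of_le l _ h, max_eq_right (sub_nonpos.2 h)]
  · rw [max_eq_left (sub_nonneg.2 h)]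
    have := intervalIntegral.tendsto_integral_filter_of_dominated_convergence (μ := volume)
      (a := l) (b := s) (l := atTop) (F := fun N => ramp l N) (f := fun _ => (1 : ℝ)) (fun _ => 1)
      (Eventually.of_forall fun N => (continuous_ramp l N).aestronglyMeasurable)
      (Eventually.of_forall fun N => ae_of_all _ fun x _ => by
        rw [Real.norm_of_nonneg (ramp_nonneg l N x)]; exact ramp_le_one l N x)
      intervalIntegrable_const
      (ae_of_all _ fun x hx => by
        rw [uIoc_of_le h] at hx
        simpa [hx.1] using tendsto_ramp l x)
    simpa [ramp₁] using this

theorem hasDerivAt_ramp₂ (s : ℝ) : HasDerivAt (ramp₂ l N) (ramp₁ l N s) s :=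
  intervalIntegral.integral_hasDerivAt_right ((continuous_ramp₁ l N).intervalIntegrable _ _)
    ((continuous_ramp₁ l N).stronglyMeasurableAtFilter _ _) (continuous_ramp₁ l N).continuousAt

theorem continuous_ramp₂ : Continuous (ramp₂ l N) :=
  continuous_iff_continuousAt.2 fun s => (hasDerivAt_ramp₂ l N s).continuousAt

theorem ramp₂_of_le {s : ℝ} (hs : s ≤ l) : ramp₂ l N s = 0 := by
  rw [ramp₂, intervalIntegral.integral_zero_ae]
  refine ae_of_all _ fun x hx => ramp₁_of_le l N ?_
  rw [uIoc_of_ge hs] at hx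
  exact hx.2

theorem ramp₂_nonneg (s : ℝ) : 0 ≤ ramp₂ l N s := by
  obtain h | h := le_total s l
  · rw [ramp₂_of_le l N h]
  · exact intervalIntegral.integral_nonneg h fun x _ => ramp₁_nonneg l N x

theorem ramp₂_le (s : ℝ) : ramp₂ l N s ≤ max (s - l) 0 ^ 2 := by
  obtain h | h := le_total s l
  · rw [ramp₂_of_le l N h]; positivity
  · have := intervalIntegral.integral_mono_on (μ := volume) h
      ((continuous_ramp₁ l N).intervalIntegrable _ _)
      (intervalIntegrable_const (c := max (s - l) 0))
      fun x hx => (ramp₁_le l N x).trans (max_le_max_right _ (by linarith [hx.2]))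
    rw [ramp₂]
    refine this.trans (le_of_eq ?_)
    rw [intervalIntegral.integral_const, max_eq_left (sub_nonneg.2 h), smul_eq_mul, sq]

theorem tendsto_ramp₂ (s : ℝ) :
    Tendsto (fun N => ramp₂ l N s) atTop (𝓝 (max (s - l) 0 ^ 2 / 2)) := by
  obtain h | h := le_total s l
  · simp [ramp₂_of_le l _ h, max_eq_right (sub_nonpos.2 h)]
  · rw [max_eq_left (sub_nonneg.2 h)]
    have := intervalIntegral.tendsto_integral_filter_of_dominated_convergence (μ := volume)
      (a := l) (b := s) (l := atTop) (F := fun N => ramp₁ l N) (f := fun x => x - l)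
      (fun x => max (x - l) 0)
      (Eventually.of_forall fun N => (continuous_ramp₁ l N).aestronglyMeasurable)
      (Eventually.of_forall fun N => ae_of_all _ fun x _ => by
        rw [Real.norm_of_nonneg (ramp₁_nonneg l N x)]; exact ramp₁_le l N x)
      (Continuous.intervalIntegrable (by fun_prop) _ _)
      (ae_of_all _ fun x hx => by
        rw [uIoc_of_le h] at hx
        have := tendsto_ramp₁ l x
        rwa [max_eq_left (by linarith [hx.1])] at this)
    have e : ∫ x in l..s, (x - l) = (s - l) ^ 2 / 2 := by
      rw [intervalIntegral.integral_comp_sub_right (fun x => x), integral_id]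
      ring
    rwa [e] at this

variable {l N}

/-! ### Convergence in `L^p` of products -/

/-- The difference is `g k • (f k - f₀) + (g k - g₀) • f₀`. The uniform bound on `g k` handles the
first term, dominated convergence the second. -/
theorem tendsto_eLpNorm_smul {α F : Type*} [MeasurableSpace α] {μ : Measure α}
    [NormedAddCommGroup F] [NormedSpace ℝ F] {p : ℝ≥0∞} (hp : 1 ≤ p) (hp' : p ≠ ∞)
    {g : ℕ → α → ℝ} {g₀ : α → ℝ} {f : ℕ → α → F} {f₀ : α → F} {C : ℝ}
    (hg : ∀ k, AEStronglyMeasurable (g k) μ) (hgC : ∀ k x, ‖g k x‖ ≤ C)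
    (hgt : ∀ᵐ x ∂μ, Tendsto (fun k => g k x) atTop (𝓝 (g₀ x)))
    (hf : ∀ k, AEStronglyMeasurable (f k) μ) (hf₀ : MemLp f₀ p μ)
    (hft : Tendsto (fun k => eLpNorm (f k - f₀) p μ) atTop (𝓝 0)) :
    Tendsto (fun k => eLpNorm (fun x => g k x • f k x - g₀ x • f₀ x) p μ) atTop (𝓝 0) := by
  have hg₀ : AEStronglyMeasurable g₀ μ := aestronglyMeasurable_of_tendsto_ae atTop hg hgt
  have hp0 : p ≠ 0 := (zero_lt_one.trans_le hp).ne'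
  have hq0 : 0 < p.toReal := ENNReal.toReal_pos hp0 hp'
  have h1 : Tendsto (fun k => eLpNorm (fun x => (g k x - g₀ x) • f₀ x) p μ) atTop (𝓝 0) := by
    simp_rw [eLpNorm_eq_lintegral_rpow_enorm_toReal hp0 hp']
    have hI := (lintegral_rpow_enorm_lt_top_of_eLpNorm_lt_top hp0 hp' hf₀.2).ne
    have := tendsto_lintegral_of_dominated_convergence' (μ := μ)
      (F := fun k x => ‖(g k x - g₀ x) • f₀ x‖ₑ ^ p.toReal) (f := fun _ => 0)
      (fun x => ENNReal.ofReal (2 * C) ^ p.toReal * ‖f₀ x‖ₑ ^ p.toReal)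
      (fun k => (((hg k).sub hg₀).smul hf₀.1).enorm.pow_const _)
      (fun k => by
        filter_upwards [hgt] with x hx
        rw [enorm_smul, ENNReal.mul_rpow_of_nonneg _ _ hq0.le]
        gcongr
        rw [← ofReal_norm]
        refine ENNReal.ofReal_le_ofReal ((norm_sub_le _ _).trans ?_)
        have := le_of_tendsto hx.norm (Eventually.of_forall fun k => hgC k x)
        linarith [hgC k x])
      (by rw [lintegral_const_mul' _ _ (by finiteness)]; finiteness)
      (by
        filter_upwards [hgt] with x hx
        have h2 : Tendsto (fun k => (g k x - g₀ x) • f₀ x) atTop (𝓝 0) := by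
          simpa using (hx.sub_const (g₀ x)).smul_const (f₀ x)
        have h3 := (h2.enorm).ennrpow_const p.toReal
        simpa [hq0] using h3)
    rw [lintegral_zero] at this
    have h4 := this.ennrpow_const (1 / p.toReal)
    simpa [hq0] using h4
  have h2 : Tendsto (fun k => ENNReal.ofReal C * eLpNorm (f k - f₀) p μ) atTop (𝓝 0) := by
    simpa using ENNReal.Tendsto.const_mul hft (Or.inr ENNReal.ofReal_ne_top)
  have h3 := h2.add h1
  rw [add_zero] at h3
  refine tendsto_of_tendsto_of_tendsto_of_le_of_le tendsto_const_nhds h3 (fun _ => zero_le)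
    fun k => ?_
  have e : (fun x => g k x • f k x - g₀ x • f₀ x) =
      (fun x => g k x • (f k - f₀) x) + fun x => (g k x - g₀ x) • f₀ x := by
    ext x; simp [smul_sub, sub_smul]
  rw [e]
  refine (eLpNorm_add_le ((hg k).smul ((hf k).sub hf₀.1)) (((hg k).sub hg₀).smul hf₀.1) hp).trans ?_
  refine add_le_add ?_ le_rfl
  refine eLpNorm_le_mul_eLpNorm_of_ae_le_mul (ae_of_all _ fun x => ?_) p
  simp only [Pi.smul_apply', norm_smul]
  gcongr
  exact hgC k x

end

section

/-! ### Spatial gradients of smooth functions -/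

section Grad

variable {n : ℕ} {φ : Space n × ℝ → ℝ}

theorem hasFDerivAt_slice (hφ : Differentiable ℝ φ) (z : Space n × ℝ) :
    HasFDerivAt (fun x : Space n => φ (x, z.2))
      ((fderiv ℝ φ z).comp (ContinuousLinearMap.inl ℝ (Space n) ℝ)) z.1 :=
  (hφ z).hasFDerivAt.comp z.1 (hasFDerivAt_prodMk_left z.1 z.2)

theorem spaceGrad_eq (hφ : Differentiable ℝ φ) (z : Space n × ℝ) :
    spaceGrad φ z = (InnerProductSpace.toDual ℝ (Space n)).symm
      ((fderiv ℝ φ z).comp (ContinuousLinearMap.inl ℝ (Space n) ℝ)) := by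
  rw [spaceGrad, gradient, (hasFDerivAt_slice hφ z).fderiv]

theorem inner_spaceGrad (hφ : Differentiable ℝ φ) (z : Space n × ℝ) (v : Space n) :
    inner ℝ (spaceGrad φ z) v = fderiv ℝ φ z (v, 0) := by
  rw [spaceGrad_eq hφ, InnerProductSpace.toDual_symm_apply]
  simp

theorem norm_spaceGrad (z : Space n × ℝ) :
    ‖spaceGrad φ z‖ = ‖fderiv ℝ (fun x : Space n => φ (x, z.2)) z.1‖ :=
  LinearIsometryEquiv.norm_map _ _

theorem timeDeriv_eq (hφ : Differentiable ℝ φ) (z : Space n × ℝ) :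
    timeDeriv φ z = fderiv ℝ φ z (0, 1) := by
  have h := (hφ z).hasFDerivAt.comp_hasDerivAt z.2
    ((hasFDerivAt_prodMk_right (𝕜 := ℝ) z.1 z.2).hasDerivAt)
  rw [timeDeriv]
  simpa [Function.comp_def] using h.deriv

theorem continuous_spaceGrad (hφ : ContDiff ℝ 1 φ) : Continuous (spaceGrad φ) := by
  rw [funext fun z => spaceGrad_eq (hφ.differentiable one_ne_zero) z]
  exact (LinearIsometryEquiv.continuous _).comp
    ((hφ.continuous_fderiv one_ne_zero).clm_comp continuous_const)

theorem support_spaceGrad_subset (hφ : ContDiff ℝ 1 φ) :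
    Function.support (spaceGrad φ) ⊆ tsupport φ := by
  intro z hz
  by_contra h
  apply hz
  rw [spaceGrad_eq (hφ.differentiable one_ne_zero), fderiv_of_notMem_tsupport ℝ h]
  simp

theorem hasCompactSupport_spaceGrad (hφ : ContDiff ℝ 1 φ) (hc : HasCompactSupport φ) :
    HasCompactSupport (spaceGrad φ) :=
  HasCompactSupport.of_support_subset_isCompact hc (support_spaceGrad_subset hφ)

theorem spaceGrad_comp {H : ℝ → ℝ} (hH : Differentiable ℝ H) (hφ : Differentiable ℝ φ)
    (z : Space n × ℝ) : spaceGrad (H ∘ φ) z = deriv H (φ z) • spaceGrad φ z := by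
  rw [spaceGrad_eq (hH.comp hφ), spaceGrad_eq hφ,
    ((hH (φ z)).hasDerivAt.comp_hasFDerivAt z (hφ z).hasFDerivAt).fderiv]
  simp [ContinuousLinearMap.smul_comp]

theorem spaceGrad_mul {ψ : Space n × ℝ → ℝ} (hφ : Differentiable ℝ φ) (hψ : Differentiable ℝ ψ)
    (z : Space n × ℝ) :
    spaceGrad (fun z => φ z * ψ z) z = φ z • spaceGrad ψ z + ψ z • spaceGrad φ z := by
  have h : HasFDerivAt (fun z => φ z * ψ z) (φ z • fderiv ℝ ψ z + ψ z • fderiv ℝ φ z) z :=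
    (hφ z).hasFDerivAt.mul (hψ z).hasFDerivAt
  rw [spaceGrad_eq (φ := fun z => φ z * ψ z) (hφ.mul hψ), spaceGrad_eq hφ, spaceGrad_eq hψ,
    h.fderiv]
  simp [ContinuousLinearMap.smul_comp, ContinuousLinearMap.add_comp]

end Grad

/-! ### Limits of test functions -/

/-- `W` is a limit in `L²` of continuously differentiable functions of compact support whose
spatial gradients converge to `P` in `L²`. -/
structure IsSobolevLimit {n : ℕ} (W : Space n × ℝ → ℝ) (P : Space n × ℝ → Space n) : Prop where
  memLp : MemLp W 2 volume
  memLp_grad : MemLp P 2 volume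
  approx : ∀ ε : ℝ≥0∞, 0 < ε → ∃ φ : Space n × ℝ → ℝ, ContDiff ℝ 1 φ ∧ HasCompactSupport φ ∧
    eLpNorm (φ - W) 2 volume ≤ ε ∧ eLpNorm (spaceGrad φ - P) 2 volume ≤ ε

variable {n : ℕ} {W : Space n × ℝ → ℝ} {P : Space n × ℝ → Space n}

theorem IsSobolevLimit.of_tendsto {V : ℕ → Space n × ℝ → ℝ} {G : ℕ → Space n × ℝ → Space n}
    (h : ∀ k, IsSobolevLimit (V k) (G k)) (hW : MemLp W 2 volume) (hP : MemLp P 2 volume)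
    (h1 : Tendsto (fun k => eLpNorm (V k - W) 2 volume) atTop (𝓝 0))
    (h2 : Tendsto (fun k => eLpNorm (G k - P) 2 volume) atTop (𝓝 0)) :
    IsSobolevLimit W P := by
  refine ⟨hW, hP, fun ε hε => ?_⟩
  have hε2 : 0 < ε / 2 := ENNReal.half_pos hε.ne'
  obtain ⟨k, hk1, hk2⟩ := ((ENNReal.tendsto_nhds_zero.1 h1 _ hε2).and
    (ENNReal.tendsto_nhds_zero.1 h2 _ hε2)).exists
  obtain ⟨φ, hφ, hc, ha, hb⟩ := (h k).approx _ hε2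
  refine ⟨φ, hφ, hc, ?_, ?_⟩
  · rw [← sub_add_sub_cancel φ (V k) W, ← ENNReal.add_halves ε]
    exact (eLpNorm_add_le (hφ.continuous.aestronglyMeasurable.sub (h k).memLp.1)
      ((h k).memLp.1.sub hW.1) (by norm_num)).trans (add_le_add ha hk1)
  · rw [← sub_add_sub_cancel (spaceGrad φ) (G k) P, ← ENNReal.add_halves ε]
    exact (eLpNorm_add_le ((continuous_spaceGrad hφ).aestronglyMeasurable.sub (h k).memLp_grad.1)
      ((h k).memLp_grad.1.sub hP.1) (by norm_num)).trans (add_le_add hb hk2)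

theorem IsSobolevLimit.of_contDiff {φ : Space n × ℝ → ℝ} (hφ : ContDiff ℝ 1 φ)
    (hc : HasCompactSupport φ) : IsSobolevLimit φ (spaceGrad φ) :=
  ⟨hφ.continuous.memLp_of_hasCompactSupport hc,
    (continuous_spaceGrad hφ).memLp_of_hasCompactSupport (hasCompactSupport_spaceGrad hφ hc),
    fun ε _ => ⟨φ, hφ, hc, by simp, by simp⟩⟩

theorem lintegral_enorm_sq_eq {α F : Type*} [MeasurableSpace α] {μ : Measure α}
    [NormedAddCommGroup F] (f : α → F) : ∫⁻ x, ‖f x‖ₑ ^ 2 ∂μ = eLpNorm f 2 μ ^ 2 := by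
  have := eLpNorm_nnreal_pow_eq_lintegral (μ := μ) (f := f) (p := 2) (by norm_num)
  simp only [NNReal.coe_ofNat, ENNReal.rpow_two] at this
  exact this.symm

/-- A sequence of test functions converging fast. -/
theorem IsSobolevLimit.exists_seq (h : IsSobolevLimit W P) :
    ∃ φ : ℕ → Space n × ℝ → ℝ, (∀ k, ContDiff ℝ 1 (φ k)) ∧ (∀ k, HasCompactSupport (φ k)) ∧
      ∑' k, ∫⁻ z, ‖(φ k - W) z‖ₑ ^ 2 ≠ ∞ ∧ ∑' k, ∫⁻ z, ‖(spaceGrad (φ k) - P) z‖ₑ ^ 2 ≠ ∞ := by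
  obtain ⟨ε, hε, hsum⟩ := ENNReal.exists_pos_sum_of_countable (one_ne_zero (α := ℝ≥0∞)) ℕ
  have hmin : ∀ k, 0 < min 1 (ε k) := fun k => lt_min zero_lt_one (hε k)
  choose φ h1 h2 h3 h4 using fun k : ℕ => h.approx (min 1 (ε k) : ℝ≥0) (by exact_mod_cast hmin k)
  have key : ∀ k, ((min 1 (ε k) : ℝ≥0) : ℝ≥0∞) ^ 2 ≤ ε k := by
    intro k
    have : (min 1 (ε k)) ^ 2 ≤ ε k := by
      rw [sq]
      calc _ ≤ 1 * ε k := by gcongr <;> simp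
        _ = _ := one_mul _
    exact_mod_cast this
  refine ⟨φ, h1, h2, ?_, ?_⟩
  · refine (lt_of_le_of_lt (ENNReal.tsum_le_tsum fun k => ?_) (hsum.trans ENNReal.one_lt_top)).ne
    rw [lintegral_enorm_sq_eq]
    exact (pow_le_pow_left' (h3 k) 2).trans (key k)
  · refine (lt_of_le_of_lt (ENNReal.tsum_le_tsum fun k => ?_) (hsum.trans ENNReal.one_lt_top)).ne
    rw [lintegral_enorm_sq_eq]
    exact (pow_le_pow_left' (h4 k) 2).trans (key k)

/-- The sum of the `f k` has finite integral, hence is finite almost everywhere, and the terms of a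
convergent series tend to zero. No subsequence has to be extracted. -/
theorem ae_tendsto_zero_of_tsum_lintegral {α : Type*} [MeasurableSpace α] {μ : Measure α}
    {f : ℕ → α → ℝ≥0∞} (hf : ∀ k, AEMeasurable (f k) μ) (h : ∑' k, ∫⁻ x, f k x ∂μ ≠ ∞) :
    ∀ᵐ x ∂μ, Tendsto (fun k => f k x) atTop (𝓝 0) := by
  rw [← lintegral_tsum hf] at h
  filter_upwards [ae_lt_top' (AEMeasurable.tsum hf) h] with x hx
  exact ENNReal.tendsto_atTop_zero_of_tsum_ne_top hx.ne

theorem tendsto_of_enorm_sq {F : Type*} [NormedAddCommGroup F] {a : ℕ → F} {b : F}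
    (h : Tendsto (fun k => ‖a k - b‖ₑ ^ 2) atTop (𝓝 0)) : Tendsto a atTop (𝓝 b) := by
  rw [tendsto_iff_edist_tendsto_0]
  have := h.ennrpow_const (1 / 2)
  simp only [one_div, ENNReal.zero_rpow_of_pos (by norm_num : (0 : ℝ) < 2⁻¹)] at this
  refine this.congr fun k => ?_
  rw [edist_eq_enorm_sub, ← ENNReal.rpow_natCast, ← ENNReal.rpow_mul]
  simp

/-- Summability of the squared errors gives, for one and the same sequence, convergence at almost
every point and, by Tonelli, convergence in `L²` of functions and gradients on almost every time
slice. -/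
theorem IsSobolevLimit.exists_seq_ae (h : IsSobolevLimit W P) :
    ∃ φ : ℕ → Space n × ℝ → ℝ, (∀ k, ContDiff ℝ 1 (φ k)) ∧ (∀ k, HasCompactSupport (φ k)) ∧
      (∀ᵐ z, Tendsto (fun k => φ k z) atTop (𝓝 (W z))) ∧
      Tendsto (fun k => eLpNorm (φ k - W) 2 volume) atTop (𝓝 0) ∧
      Tendsto (fun k => eLpNorm (spaceGrad (φ k) - P) 2 volume) atTop (𝓝 0) ∧
      (∀ᵐ t : ℝ, Tendsto (fun k => ∫⁻ x : Space n, ‖(φ k - W) (x, t)‖ₑ ^ 2) atTop (𝓝 0)) ∧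
      ∀ᵐ t : ℝ, Tendsto (fun k => ∫⁻ x : Space n, ‖(spaceGrad (φ k) - P) (x, t)‖ₑ ^ 2)
        atTop (𝓝 0) := by
  obtain ⟨φ, h1, h2, h3, h4⟩ := h.exists_seq
  have m1 : ∀ k, AEMeasurable (fun z => ‖(φ k - W) z‖ₑ ^ 2) volume := fun k =>
    ((h1 k).continuous.aestronglyMeasurable.sub h.memLp.1).enorm.pow_const _
  have m2 : ∀ k, AEMeasurable (fun z => ‖(spaceGrad (φ k) - P) z‖ₑ ^ 2) volume := fun k =>
    ((continuous_spaceGrad (h1 k)).aestronglyMeasurable.sub h.memLp_grad.1).enorm.pow_const _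
  have sq0 : ∀ a : ℕ → ℝ≥0∞, Tendsto (fun k => a k ^ 2) atTop (𝓝 0) → Tendsto a atTop (𝓝 0) := by
    intro a ha
    have := ha.ennrpow_const (1 / 2)
    simp only [one_div, ENNReal.zero_rpow_of_pos (by norm_num : (0 : ℝ) < 2⁻¹)] at this
    refine this.congr fun k => ?_
    rw [← ENNReal.rpow_natCast, ← ENNReal.rpow_mul]
    simp
  refine ⟨φ, h1, h2, ?_, ?_, ?_, ?_, ?_⟩
  · filter_upwards [ae_tendsto_zero_of_tsum_lintegral m1 h3] with z hz
    exact tendsto_of_enorm_sq hz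
  · refine sq0 _ ?_
    simpa only [lintegral_enorm_sq_eq] using ENNReal.tendsto_atTop_zero_of_tsum_ne_top h3
  · refine sq0 _ ?_
    simpa only [lintegral_enorm_sq_eq] using ENNReal.tendsto_atTop_zero_of_tsum_ne_top h4
  · refine ae_tendsto_zero_of_tsum_lintegral (fun k => (m1 k).lintegral_prod_left') ?_
    convert h3 using 3 with k
    rw [Measure.volume_eq_prod, lintegral_prod_symm _ (m1 k)]
  · refine ae_tendsto_zero_of_tsum_lintegral (fun k => (m2 k).lintegral_prod_left') ?_
    convert h4 using 3 with k
    rw [Measure.volume_eq_prod, lintegral_prod_symm _ (m2 k)]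

/-- The class is stable under composition with continuously differentiable functions that vanish
at the origin and have bounded derivative. -/
theorem IsSobolevLimit.comp (h : IsSobolevLimit W P) {H : ℝ → ℝ} (hH : ContDiff ℝ 1 H)
    (h0 : H 0 = 0) {C : ℝ≥0} (hC : ∀ s, ‖deriv H s‖ ≤ C) :
    IsSobolevLimit (H ∘ W) (fun z => deriv H (W z) • P z) := by
  obtain ⟨φ, h1, h2, h3, h4, h5, -, -⟩ := h.exists_seq_ae
  have hd : Differentiable ℝ H := hH.differentiable one_ne_zero
  have hdc : Continuous (deriv H) := hH.continuous_deriv le_rfl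
  have hlip : LipschitzWith C H := lipschitzWith_of_nnnorm_deriv_le hd fun s => hC s
  refine IsSobolevLimit.of_tendsto (V := fun k => H ∘ φ k) (G := fun k => spaceGrad (H ∘ φ k))
    (fun k => .of_contDiff (hH.comp (h1 k)) ((h2 k).comp_left h0))
    (hlip.comp_memLp h0 h.memLp) ?_ ?_ ?_
  · refine MemLp.of_le_mul (c := C) h.memLp_grad
      ((hdc.comp_aestronglyMeasurable h.memLp.1).smul h.memLp_grad.1) (ae_of_all _ fun z => ?_)
    rw [norm_smul]; gcongr; exact hC _
  · have : Tendsto (fun k => (C : ℝ≥0∞) * eLpNorm (φ k - W) 2 volume) atTop (𝓝 0) := by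
      simpa using ENNReal.Tendsto.const_mul h4 (Or.inr ENNReal.coe_ne_top)
    refine tendsto_of_tendsto_of_tendsto_of_le_of_le tendsto_const_nhds this
      (fun _ => zero_le) fun k => ?_
    refine eLpNorm_le_nnreal_smul_eLpNorm_of_ae_le_mul (ae_of_all _ fun z => ?_) 2
    have := hlip.dist_le_mul (φ k z) (W z)
    rw [Real.dist_eq, Real.dist_eq] at this
    exact_mod_cast this
  · have := tendsto_eLpNorm_smul (μ := volume) (p := 2) (by norm_num) (by norm_num)
      (g := fun k z => deriv H (φ k z)) (g₀ := fun z => deriv H (W z))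
      (f := fun k => spaceGrad (φ k)) (f₀ := P) (C := C)
      (fun k => (hdc.comp (h1 k).continuous).aestronglyMeasurable) (fun k z => hC _)
      (h3.mono fun z hz => (hdc.tendsto _).comp hz)
      (fun k => (continuous_spaceGrad (h1 k)).aestronglyMeasurable) h.memLp_grad h5
    refine this.congr fun k => ?_
    congr 1
    ext1 z
    simp only [Pi.sub_apply]
    rw [spaceGrad_comp hd ((h1 k).differentiable one_ne_zero)]

/-- The class is stable under truncation from below at positive levels. -/
theorem IsSobolevLimit.truncate (h : IsSobolevLimit W P) {l : ℝ} (hl : 0 < l) :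
    IsSobolevLimit (fun z => max (W z - l) 0) ({z | l < W z}.indicator P) := by
  have hind : {z | l < W z}.indicator P = fun z => (if l < W z then (1 : ℝ) else 0) • P z := by
    ext1 z
    by_cases hz : l < W z <;> simp [hz]
  -- The positivity of `l` makes `ramp₁ l N` vanish at the origin, as composition with compactly
  -- supported functions requires.
  have hk : ∀ N : ℕ, IsSobolevLimit (ramp₁ l N ∘ W) (fun z => ramp l N (W z) • P z) := by
    intro N
    have := h.comp (contDiff_ramp₁ l N) (ramp₁_of_le l N hl.le) (C := 1) fun s => by
      rw [(hasDerivAt_ramp₁ l N s).deriv, Real.norm_of_nonneg (ramp_nonneg l N s)]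
      exact ramp_le_one l N s
    simpa only [fun s => (hasDerivAt_ramp₁ l N s).deriv] using this
  have hgrad : Tendsto (fun N : ℕ => eLpNorm (fun z => ramp l N (W z) • P z -
      (if l < W z then (1 : ℝ) else 0) • P z) 2 volume) atTop (𝓝 0) :=
    tendsto_eLpNorm_smul (μ := volume) (p := 2) (by norm_num) (by norm_num)
      (f := fun _ => P) (C := 1)
      (fun N => (continuous_ramp l N).comp_aestronglyMeasurable h.memLp.1)
      (fun N z => by rw [Real.norm_of_nonneg (ramp_nonneg l N _)]; exact ramp_le_one l N _)
      (ae_of_all _ fun z => tendsto_ramp l (W z)) (fun _ => h.memLp_grad.1) h.memLp_grad (by simp)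
  have hlp : LipschitzWith 1 fun s : ℝ => max (s - l) 0 :=
    LipschitzWith.max_const (LipschitzWith.of_dist_le_mul fun a b => by simp) 0
  have hWm : MemLp (fun z => max (W z - l) 0) 2 volume :=
    hlp.comp_memLp (by simp [hl.le]) h.memLp
  have hmeas := fun N : ℕ => (continuous_ramp₁ l N).comp_aestronglyMeasurable h.memLp.1
  refine IsSobolevLimit.of_tendsto hk hWm ?_ ?_ ?_
  · rw [hind]
    obtain ⟨N, hN⟩ := (ENNReal.tendsto_nhds_zero.1 hgrad 1 zero_lt_one).exists
    have hm : AEStronglyMeasurable (fun z => (if l < W z then (1 : ℝ) else 0) • P z) volume :=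
      aestronglyMeasurable_of_tendsto_ae atTop (f := fun N z => ramp l N (W z) • P z)
        (fun N => (hk N).memLp_grad.1) (ae_of_all _ fun z => (tendsto_ramp l (W z)).smul_const _)
    refine h.memLp_grad.of_le hm (ae_of_all _ fun z => ?_)
    split_ifs <;> simp
  -- The truncation is written as the quotient `ramp₁ / (W - l)₊`, which lies between zero and one,
  -- times the fixed square integrable function `(W - l)₊`. Where the denominator vanishes so does
  -- the quotient, by the convention for division by zero.
  · have := tendsto_eLpNorm_smul (μ := volume) (p := 2) (by norm_num) (by norm_num)
      (f := fun _ z => max (W z - l) 0) (f₀ := fun z => max (W z - l) 0)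
      (g := fun N z => ramp₁ l N (W z) / max (W z - l) 0)
      (g₀ := fun z => if l < W z then 1 else 0) (C := 1)
      (fun N => ((hmeas N).aemeasurable.div hWm.1.aemeasurable).aestronglyMeasurable)
      (fun N z => by
        rw [Real.norm_of_nonneg (div_nonneg (ramp₁_nonneg l N _) (le_max_right _ _))]
        exact div_le_one_of_le₀ (ramp₁_le l N _) (le_max_right _ _))
      (ae_of_all _ fun z => by
        split_ifs with hz
        · have hp : 0 < max (W z - l) 0 := lt_max_of_lt_left (by linarith)
          have := (tendsto_ramp₁ l (W z)).div_const (max (W z - l) 0)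
          rwa [div_self hp.ne'] at this
        · simp [ramp₁_of_le l _ (not_lt.1 hz)])
      (fun _ => hWm.1) hWm (by simp)
    refine this.congr fun N => ?_
    congr 1
    ext1 z
    simp only [Pi.sub_apply, Function.comp_apply, smul_eq_mul]
    by_cases hz : l < W z
    · have hp : 0 < max (W z - l) 0 := lt_max_of_lt_left (by linarith)
      rw [div_mul_cancel₀ _ hp.ne', if_pos hz, one_mul]
    · simp [ramp₁_of_le l N (not_lt.1 hz), max_eq_right (sub_nonpos.2 (not_lt.1 hz))]
  · rw [hind]
    exact hgrad

/-- Slices of limits of test functions inherit multiplicative inequalities. -/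
theorem IsSobolevLimit.ae_slice (h : IsSobolevLimit W P) {R α β : ℝ} (hα : 0 ≤ α)
    (hβ : 0 ≤ β) {C : ℝ≥0} (hC : ∀ w : Space n → ℝ, ContDiff ℝ 1 w → HasCompactSupport w →
        ∫⁻ x, ‖w x‖ₑ ^ R ≤ C * (∫⁻ x, ‖w x‖ₑ ^ 2) ^ α * (∫⁻ x, ‖fderiv ℝ w x‖ₑ ^ 2) ^ β) :
    ∀ᵐ t : ℝ, ∫⁻ x : Space n, ‖W (x, t)‖ₑ ^ R ≤
      C * (∫⁻ x : Space n, ‖W (x, t)‖ₑ ^ 2) ^ α * (∫⁻ x : Space n, ‖P (x, t)‖ₑ ^ 2) ^ β := by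
  obtain ⟨φ, h1, h2, h3, -, -, h6, h7⟩ := h.exists_seq_ae
  have hae : ∀ {p : Space n × ℝ → Prop}, (∀ᵐ z, p z) → ∀ᵐ t : ℝ, ∀ᵐ x : Space n, p (x, t) := by
    intro p hp
    have : ∀ᵐ z : ℝ × Space n, p z.swap := (Measure.measurePreserving_swap (μ := volume)
      (ν := volume)).quasiMeasurePreserving.ae hp
    exact Measure.ae_ae_of_ae_prod this
  have hfin : ∀ {F : Type} [NormedAddCommGroup F] {f : Space n × ℝ → F}, MemLp f 2 volume →
      ∀ᵐ t : ℝ, AEStronglyMeasurable (fun x => f (x, t)) volume ∧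
        ∫⁻ x : Space n, ‖f (x, t)‖ₑ ^ 2 < ∞ := by
    intro F _ f hf
    have hm : AEStronglyMeasurable (fun z : ℝ × Space n => f z.swap) (volume.prod volume) :=
      hf.1.comp_quasiMeasurePreserving Measure.measurePreserving_swap.quasiMeasurePreserving
    have hI : ∫⁻ t : ℝ, ∫⁻ x : Space n, ‖f (x, t)‖ₑ ^ 2 ≠ ∞ := by
      rw [← lintegral_prod_symm (fun z => ‖f z‖ₑ ^ 2) (hf.1.enorm.pow_const 2),
        ← Measure.volume_eq_prod, lintegral_enorm_sq_eq]
      exact ENNReal.pow_ne_top hf.2.ne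
    filter_upwards [hm.prodMk_left, ae_lt_top'
      ((hf.1.enorm.pow_const 2).lintegral_prod_left' (μ := volume) (ν := volume)) hI] with t a b
    exact ⟨a, b⟩
  have conv : ∀ {F : Type} [NormedAddCommGroup F] {f : ℕ → Space n → F} {g : Space n → F},
      (∀ k, AEStronglyMeasurable (f k) volume) → AEStronglyMeasurable g volume →
      ∫⁻ x, ‖g x‖ₑ ^ 2 < ∞ → Tendsto (fun k => ∫⁻ x, ‖(f k x - g x)‖ₑ ^ 2) atTop (𝓝 0) →
      Tendsto (fun k => ∫⁻ x, ‖f k x‖ₑ ^ 2) atTop (𝓝 (∫⁻ x, ‖g x‖ₑ ^ 2)) := by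
    intro F _ f g hf hg hgf hfg
    have h0 : Tendsto (fun k => eLpNorm (f k - g) 2 volume) atTop (𝓝 0) := by
      have := hfg.ennrpow_const (1 / 2)
      simp only [one_div, ENNReal.zero_rpow_of_pos (by norm_num : (0 : ℝ) < 2⁻¹)] at this
      refine this.congr fun k => ?_
      have e := lintegral_enorm_sq_eq (μ := volume) (f k - g)
      simp only [Pi.sub_apply] at e
      rw [e, ← ENNReal.rpow_natCast, ← ENNReal.rpow_mul]
      simp
    have hgm : MemLp g 2 volume := ⟨hg, by
      rw [lintegral_enorm_sq_eq] at hgf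
      exact lt_of_not_ge fun h => by simp [top_le_iff.1 h] at hgf⟩
    simp_rw [lintegral_enorm_sq_eq]
    refine ENNReal.Tendsto.pow ?_
    refine tendsto_of_tendsto_of_tendsto_of_le_of_le
      (g := fun k => eLpNorm g 2 volume - eLpNorm (f k - g) 2 volume)
      (h := fun k => eLpNorm g 2 volume + eLpNorm (f k - g) 2 volume) ?_ ?_ ?_ ?_
    · simpa using ENNReal.Tendsto.sub (tendsto_const_nhds (x := eLpNorm g 2 volume)) h0
        (Or.inl hgm.2.ne)
    · simpa using tendsto_const_nhds.add h0
    · intro k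
      rw [tsub_le_iff_right]
      calc eLpNorm g 2 volume = eLpNorm (f k - (f k - g)) 2 volume := by congr 1; simp
        _ ≤ _ := eLpNorm_sub_le (hf k) ((hf k).sub hg) (by norm_num)
    · intro k
      calc eLpNorm (f k) 2 volume = eLpNorm (g + (f k - g)) 2 volume := by congr 1; simp
        _ ≤ _ := eLpNorm_add_le hg ((hf k).sub hg) (by norm_num)
  have hslice : ∀ (k : ℕ) (t : ℝ), ContDiff ℝ 1 fun x : Space n => φ k (x, t) := fun k t =>
    (h1 k).comp (contDiff_id.prodMk contDiff_const)
  filter_upwards [hae h3, hfin h.memLp, hfin h.memLp_grad, h6, h7] with t ha hb hc hd he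
  have hy : Tendsto (fun k => ∫⁻ x : Space n, ‖φ k (x, t)‖ₑ ^ 2) atTop
      (𝓝 (∫⁻ x : Space n, ‖W (x, t)‖ₑ ^ 2)) :=
    conv (fun k => (hslice k t).continuous.aestronglyMeasurable) hb.1 hb.2 hd
  have hD : Tendsto (fun k => ∫⁻ x : Space n, ‖spaceGrad (φ k) (x, t)‖ₑ ^ 2) atTop
      (𝓝 (∫⁻ x : Space n, ‖P (x, t)‖ₑ ^ 2)) :=
    conv (fun k => ((continuous_spaceGrad (h1 k)).comp
      (continuous_id.prodMk continuous_const)).aestronglyMeasurable) hc.1 hc.2 he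
  have hlim : Tendsto (fun k => C * (∫⁻ x : Space n, ‖φ k (x, t)‖ₑ ^ 2) ^ α *
      (∫⁻ x : Space n, ‖spaceGrad (φ k) (x, t)‖ₑ ^ 2) ^ β) atTop
      (𝓝 (C * (∫⁻ x : Space n, ‖W (x, t)‖ₑ ^ 2) ^ α *
        (∫⁻ x : Space n, ‖P (x, t)‖ₑ ^ 2) ^ β)) := by
    have f1 : (∫⁻ x : Space n, ‖W (x, t)‖ₑ ^ 2) ^ α ≠ ∞ := ENNReal.rpow_ne_top_of_nonneg hα hb.2.ne
    have f2 : (∫⁻ x : Space n, ‖P (x, t)‖ₑ ^ 2) ^ β ≠ ∞ := ENNReal.rpow_ne_top_of_nonneg hβ hc.2.ne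
    refine ENNReal.Tendsto.mul
      (ENNReal.Tendsto.const_mul (hy.ennrpow_const α) (Or.inr ENNReal.coe_ne_top))
      (Or.inr f2) (hD.ennrpow_const β) (Or.inr (ENNReal.mul_ne_top ENNReal.coe_ne_top f1))
  have hle : ∀ k, ∫⁻ x : Space n, ‖φ k (x, t)‖ₑ ^ R ≤
      C * (∫⁻ x : Space n, ‖φ k (x, t)‖ₑ ^ 2) ^ α *
      (∫⁻ x : Space n, ‖spaceGrad (φ k) (x, t)‖ₑ ^ 2) ^ β := by
    intro k
    have hcs : HasCompactSupport fun x : Space n => φ k (x, t) :=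
      (h2 k).comp_isClosedEmbedding ⟨isEmbedding_prodMkLeft t, by
        have : range (fun x : Space n => (x, t)) = {z | z.2 = t} := by
          ext ⟨x, s⟩; simp [eq_comm]
        rw [this]
        exact isClosed_eq continuous_snd continuous_const⟩
    convert hC _ (hslice k t) hcs using 6 with x
    rw [← ofReal_norm, ← ofReal_norm, norm_spaceGrad]
  -- Nothing but pointwise convergence is known for the power `R`, so Fatou's lemma is used on the
  -- left; the right side converges because the slices converge in `L²`.
  calc ∫⁻ x : Space n, ‖W (x, t)‖ₑ ^ R
      = ∫⁻ x : Space n, liminf (fun k => ‖φ k (x, t)‖ₑ ^ R) atTop := by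
        refine lintegral_congr_ae ?_
        filter_upwards [ha] with x hx
        exact ((hx.enorm).ennrpow_const R).liminf_eq.symm
    _ ≤ liminf (fun k => ∫⁻ x : Space n, ‖φ k (x, t)‖ₑ ^ R) atTop :=
        lintegral_liminf_le fun k => (hslice k t).continuous.enorm.measurable.pow_const _
    _ ≤ liminf (fun k => C * (∫⁻ x : Space n, ‖φ k (x, t)‖ₑ ^ 2) ^ α *
          (∫⁻ x : Space n, ‖spaceGrad (φ k) (x, t)‖ₑ ^ 2) ^ β) atTop :=
        liminf_le_liminf (Eventually.of_forall hle)
    _ = _ := hlim.liminf_eq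

end

section

/-! ### Slices of the cylinder -/

theorem restrict_cylinder {n : ℕ} (Ω : Set (Space n)) (T : ℝ) :
    (volume.restrict (cylinder Ω T) : Measure (Space n × ℝ)) =
      (volume.restrict Ω).prod (volume.restrict (Ioo 0 T)) := by
  rw [Measure.prod_restrict, ← Measure.volume_eq_prod]; rfl

theorem ae_slice_of_ae_prod {α β : Type*} [MeasurableSpace α] [MeasurableSpace β] {μ : Measure α}
    {ν : Measure β} [SFinite μ] [SFinite ν] {p : α × β → Prop} (hp : ∀ᵐ z ∂μ.prod ν, p z) :
    ∀ᵐ t ∂ν, ∀ᵐ x ∂μ, p (x, t) := by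
  have : ∀ᵐ z ∂ν.prod μ, p z.swap :=
    (Measure.measurePreserving_swap (μ := ν) (ν := μ)).quasiMeasurePreserving.ae hp
  exact Measure.ae_ae_of_ae_prod this

theorem aestronglyMeasurable_slice {α β F : Type*} [MeasurableSpace α] [MeasurableSpace β]
    [TopologicalSpace F] {μ : Measure α} {ν : Measure β} [SFinite μ] [SFinite ν] {f : α × β → F}
    (hf : AEStronglyMeasurable f (μ.prod ν)) :
    ∀ᵐ t ∂ν, AEStronglyMeasurable (fun x => f (x, t)) μ :=
  (hf.comp_quasiMeasurePreserving
    Measure.measurePreserving_swap.quasiMeasurePreserving).prodMk_left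

/-- The essential supremum exceeds `a` exactly when the superlevel set of the slice has positive
measure, and that measure is a measurable function of `t`. -/
theorem measurable_essSup_slice {α β : Type*} [MeasurableSpace α] [MeasurableSpace β]
    {μ : Measure α} [SFinite μ] {f : α × β → ℝ≥0∞} (hf : Measurable f) :
    Measurable fun t => essSup (fun x => f (x, t)) μ := by
  refine measurable_of_Ioi fun a => ?_
  have : (fun t => essSup (fun x => f (x, t)) μ) ⁻¹' Ioi a =
      {t | μ ((fun x => (x, t)) ⁻¹' {z | a < f z}) ≠ 0} := by
    ext t
    simp only [mem_preimage, mem_Ioi, mem_ofPred_eq]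
    rw [← not_le, not_iff_not]
    constructor
    · intro h
      rw [← nonpos_iff_eq_zero, ← meas_essSup_lt (f := fun x => f (x, t)) (μ := μ)]
      exact measure_mono fun x hx => lt_of_le_of_lt h hx
    · intro h
      refine essSup_le_of_ae_le a ?_
      rw [EventuallyLE, ae_iff]
      convert h using 2
      ext x; simp
  rw [this]
  exact measurable_measure_prodMk_right (measurableSet_lt measurable_const hf)
    (measurableSet_singleton 0).compl

theorem aemeasurable_eLpNorm_slice {α β : Type*} [MeasurableSpace α] [MeasurableSpace β]
    {μ : Measure α} {ν : Measure β} [SFinite μ] [SFinite ν] {f : α × β → ℝ}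
    (hf : AEStronglyMeasurable f (μ.prod ν)) (p : ℝ≥0∞) :
    AEMeasurable (fun t => eLpNorm (fun x => f (x, t)) p μ) ν := by
  obtain ⟨g, hg, hfg⟩ := hf
  refine ⟨fun t => eLpNorm (fun x => g (x, t)) p μ, ?_, ?_⟩
  · by_cases hp0 : p = 0
    · simp [hp0]
    by_cases hp : p = ∞
    · simp only [hp, eLpNorm_exponent_top, eLpNormEssSup]
      exact measurable_essSup_slice (f := fun z => ‖g z‖ₑ) hg.enorm
    · simp only [eLpNorm_eq_lintegral_rpow_enorm_toReal hp0 hp]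
      exact (Measurable.lintegral_prod_left' (hg.enorm.pow_const _)).pow_const _
  · filter_upwards [ae_slice_of_ae_prod hfg] with t ht
    exact eLpNorm_congr_ae ht

/-! ### Interpolation on slices -/

/-- Hölder's inequality for the factorization of `h ^ r` into powers of `h ^ 2` and `h ^ R` whose
exponents add up to one. -/
theorem lintegral_rpow_interpolate {α : Type*} [MeasurableSpace α] {μ : Measure α}
    {h : α → ℝ≥0∞} (hh : AEMeasurable h μ) {R r : ℝ} (hR : 2 < R) (hr : 2 ≤ r) (hrR : r ≤ R) :
    ∫⁻ x, h x ^ r ∂μ ≤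
      (∫⁻ x, h x ^ 2 ∂μ) ^ ((R - r) / (R - 2)) * (∫⁻ x, h x ^ R ∂μ) ^ ((r - 2) / (R - 2)) := by
  have h0 : 0 < R - 2 := by linarith
  have := ENNReal.lintegral_mul_norm_pow_le (μ := μ) (hh.pow_const (2 : ℝ)) (hh.pow_const R)
    (p := (R - r) / (R - 2)) (q := (r - 2) / (R - 2)) (div_nonneg (by linarith) h0.le)
    (div_nonneg (by linarith) h0.le) (by field_simp; ring)
  simp only [ENNReal.rpow_two] at this
  refine le_trans (lintegral_mono fun x => le_of_eq ?_) this
  rw [← ENNReal.rpow_two, ← ENNReal.rpow_mul, ← ENNReal.rpow_mul, ← ENNReal.rpow_add_of_nonneg]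
  · congr 1; field_simp; ring
  · exact mul_nonneg (by norm_num) (div_nonneg (by linarith) h0.le)
  · exact mul_nonneg (by linarith) (div_nonneg (by linarith) h0.le)

/-- Interpolation of a Gagliardo–Nirenberg inequality. -/
theorem lintegral_rpow_le_of_gagliardoNirenberg {α : Type*} [MeasurableSpace α] {μ : Measure α}
    {m R s χ : ℝ} {C : ℝ≥0} (hm : 0 ≤ m) (hR : 2 < R) (hB : m * (R - 2) / 4 ≤ R / 2) (hC : 1 ≤ C)
    (hs : 0 ≤ s) (hs' : s < 1 / 2) (hχ : 1 ≤ χ) (hχ' : χ ≤ 2) (hχR : χ ≤ R * (1 / 2 - s))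
    {h : α → ℝ≥0∞} (hh : AEMeasurable h μ) {D : ℝ≥0∞}
    (hGN : ∫⁻ x, h x ^ R ∂μ ≤
      C * (∫⁻ x, h x ^ 2 ∂μ) ^ (R / 2 - m * (R - 2) / 4) * D ^ (m * (R - 2) / 4)) :
    (∫⁻ x, h x ^ (χ / (1 / 2 - s)) ∂μ) ^ (1 - 2 * s) ≤
      (C : ℝ≥0∞) ^ (4 / (R - 2)) * (∫⁻ x, h x ^ 2 ∂μ) ^ (χ - (m * s + m * (χ - 1) / 2)) *
        D ^ (m * s + m * (χ - 1) / 2) := by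
  have h0 : 0 < R - 2 := by linarith
  have hs2 : 0 < 1 / 2 - s := by linarith
  set y := ∫⁻ x, h x ^ 2 ∂μ
  set r := χ / (1 / 2 - s) with hr
  have hr2 : 2 ≤ r := by rw [hr, le_div_iff₀ hs2]; linarith
  have hrR : r ≤ R := by rw [hr, div_le_iff₀ hs2]; exact hχR
  have hrs : r * (1 - 2 * s) = 2 * χ := by
    have : 1 - 2 * s ≠ 0 := by linarith
    rw [hr]; field_simp
  -- `γ` is the power to which the inequality `hGN` is raised. Since `γ * (R - 2) = 2 * χ - 2 + 4 *
  -- s ≤ 4`, the power of `C` is bounded independently of `s` and `χ`. The exponent of `D` is then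
  -- computed from `γ`, and that of the mass is its complement to `χ`.
  set γ := (r - 2) / (R - 2) * (1 - 2 * s) with hγ
  have hγ0 : 0 ≤ γ := mul_nonneg (div_nonneg (by linarith) h0.le) (by linarith)
  have hγe : γ * (R - 2) = 2 * χ - 2 + 4 * s := by
    rw [hγ]; field_simp; linarith
  have hγ4 : γ ≤ 4 / (R - 2) := by rw [le_div_iff₀ h0, hγe]; linarith
  have hδ0 : 0 ≤ (R - r) / (R - 2) * (1 - 2 * s) :=
    mul_nonneg (div_nonneg (by linarith) h0.le) (by linarith)
  have hμ : m * (R - 2) / 4 * γ = m * s + m * (χ - 1) / 2 := by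
    have : m * (R - 2) / 4 * γ = m / 4 * (γ * (R - 2)) := by ring
    rw [this, hγe]; ring
  have hy : (R - r) / (R - 2) * (1 - 2 * s) + (R / 2 - m * (R - 2) / 4) * γ =
      χ - (m * s + m * (χ - 1) / 2) := by
    rw [sub_mul, hμ]
    have e : (R - r) / (R - 2) * (1 - 2 * s) = (1 - 2 * s) - γ := by
      rw [hγ]; field_simp; ring
    rw [e]; linarith
  have hB0 : 0 ≤ m * (R - 2) / 4 := by positivity
  calc (∫⁻ x, h x ^ r ∂μ) ^ (1 - 2 * s)
      ≤ (y ^ ((R - r) / (R - 2)) * (∫⁻ x, h x ^ R ∂μ) ^ ((r - 2) / (R - 2))) ^ (1 - 2 * s) := by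
        gcongr
        · linarith
        · exact lintegral_rpow_interpolate hh hR hr2 hrR
    _ = y ^ ((R - r) / (R - 2) * (1 - 2 * s)) * (∫⁻ x, h x ^ R ∂μ) ^ γ := by
        rw [ENNReal.mul_rpow_of_nonneg _ _ (by linarith), ← ENNReal.rpow_mul, ← ENNReal.rpow_mul]
    _ ≤ y ^ ((R - r) / (R - 2) * (1 - 2 * s)) *
          (C * y ^ (R / 2 - m * (R - 2) / 4) * D ^ (m * (R - 2) / 4)) ^ γ := by
        gcongr
    _ = (C : ℝ≥0∞) ^ γ * (y ^ ((R - r) / (R - 2) * (1 - 2 * s)) *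
          y ^ ((R / 2 - m * (R - 2) / 4) * γ)) * D ^ (m * (R - 2) / 4 * γ) := by
        rw [ENNReal.mul_rpow_of_nonneg _ _ hγ0, ENNReal.mul_rpow_of_nonneg _ _ hγ0,
          ← ENNReal.rpow_mul, ← ENNReal.rpow_mul]
        ring
    _ = (C : ℝ≥0∞) ^ γ * y ^ (χ - (m * s + m * (χ - 1) / 2)) * D ^ (m * s + m * (χ - 1) / 2) := by
        rw [← ENNReal.rpow_add_of_nonneg _ _ hδ0 (mul_nonneg (by linarith) hγ0), hy, hμ]
    _ ≤ _ := by
        gcongr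
        exact_mod_cast hC

/-- The weighted arithmetic-geometric mean inequality, in a crude form. -/
theorem rpow_mul_rpow_le_add (x z : ℝ≥0∞) {μ : ℝ} (h0 : 0 ≤ μ) (h1 : μ ≤ 1) :
    x ^ (1 - μ) * z ^ μ ≤ x + z := by
  calc x ^ (1 - μ) * z ^ μ ≤ (x + z) ^ (1 - μ) * (x + z) ^ μ := by
        gcongr
        · exact le_self_add
        · exact le_add_self
    _ = x + z := by
        rw [← ENNReal.rpow_add_of_nonneg _ _ (by linarith) h0]; simp

/-! ### Subcritical coefficients -/

/-- A function `β` on the cylinder acts subcritically if multiplication by `β` is controlled on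
almost every slice by a power of a function of time that is integrable to a subcritical power. -/
structure IsSubcritical (n : ℕ) (θ : ℝ) (Ω : Set (Space n)) (T : ℝ) (κ : ℝ≥0∞)
    (β : Space n × ℝ → ℝ) : Prop where
  meas : AEStronglyMeasurable β (volume.restrict (cylinder Ω T))
  bound : ∃ s : ℝ, 0 ≤ s ∧ s ≤ (1 - θ) / 2 ∧ n * s ≤ 1 - θ ∧ ∃ N : ℝ → ℝ≥0∞,
    AEMeasurable N (volume.restrict (Ioo 0 T)) ∧ (∀ t, 1 ≤ N t) ∧
    ∫⁻ t in Ioo 0 T, N t ^ (2 / (1 - (n * s + θ / 2))) ≤ κ ∧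
    ∀ᵐ t ∂(volume.restrict (Ioo 0 T)), ∀ h : Space n → ℝ≥0∞,
      AEMeasurable h (volume.restrict Ω) →
      ∫⁻ x in Ω, ‖β (x, t)‖ₑ ^ 2 * h x ^ 2 ≤
        N t ^ 2 * (∫⁻ x in Ω, h x ^ (1 / (1 / 2 - s))) ^ (1 - 2 * s)

/-- The bound in `IsSubcritical` for a coefficient of norm at most `N` on `(0,T)`. -/
noncomputable def subcriticalBound (θ T N : ℝ) : ℝ≥0∞ :=
  2 ^ (4 / θ) * ((1 + ENNReal.ofReal T) * (1 + (1 + ENNReal.ofReal N) ^ (4 / θ)))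

theorem subcriticalBound_ne_top {θ T N : ℝ} (hθ : 0 < θ) : subcriticalBound θ T N ≠ ∞ := by
  unfold subcriticalBound
  have : 0 ≤ 4 / θ := by positivity
  finiteness

/-- Hölder's inequality on a time interval of finite length lowers the exponent from `q` to `e`. The
bounds `1 ≤ e ≤ 4 / θ` remove `e`, and with it the exponents of the coefficient, from the final
constant. -/
theorem lintegral_one_add_rpow_le {T T₀ N₀ e θ : ℝ} (hT₀ : T ≤ T₀) {q : ℝ≥0∞}
    {M : ℝ → ℝ≥0∞} (hM : AEMeasurable M (volume.restrict (Ioo 0 T))) (he : 1 ≤ e)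
    (heθ : e ≤ 4 / θ) (heq : ENNReal.ofReal e ≤ q)
    (hN : eLpNorm M q (volume.restrict (Ioo 0 T)) ≤ ENNReal.ofReal N₀) :
    ∫⁻ t in Ioo 0 T, (1 + M t) ^ e ≤ subcriticalBound θ T₀ N₀ := by
  have he0 : 0 < e := by linarith
  have hvol : (volume.restrict (Ioo 0 T)) univ = ENNReal.ofReal T := by simp
  have h1 := eLpNorm_le_eLpNorm_mul_rpow_measure_univ (μ := volume.restrict (Ioo 0 T)) (f := M)
    heq hM.aestronglyMeasurable
  rw [hvol, ENNReal.toReal_ofReal he0.le,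
    eLpNorm_eq_lintegral_rpow_enorm_toReal (by simpa using he0) (by simp),
    ENNReal.toReal_ofReal he0.le] at h1
  have h2 := ENNReal.rpow_le_rpow h1 he0.le
  rw [← ENNReal.rpow_mul, one_div_mul_cancel he0.ne', ENNReal.rpow_one,
    ENNReal.mul_rpow_of_nonneg _ _ he0.le, ← ENNReal.rpow_mul] at h2
  simp only [enorm_eq_self] at h2
  have h3 : ∫⁻ t in Ioo 0 T, M t ^ e ≤
      (1 + ENNReal.ofReal N₀) ^ (4 / θ) * (1 + ENNReal.ofReal T₀) := by
    refine h2.trans ?_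
    gcongr
    · calc eLpNorm M q (volume.restrict (Ioo 0 T)) ^ e ≤ (1 + ENNReal.ofReal N₀) ^ e := by
            gcongr; exact hN.trans le_add_self
        _ ≤ _ := ENNReal.rpow_le_rpow_of_exponent_le le_self_add heθ
    · have hexp : (1 / e - 1 / q.toReal) * e ≤ 1 := by
        have : 0 ≤ 1 / q.toReal * e := by positivity
        rw [sub_mul, one_div_mul_cancel he0.ne']; linarith
      have hexp0 : 0 ≤ (1 / e - 1 / q.toReal) * e := by
        refine mul_nonneg (sub_nonneg.2 ?_) he0.le
        by_cases hq : q = ∞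
        · simp [hq, he0.le]
        · exact one_div_le_one_div_of_le he0 (by
            rwa [ENNReal.ofReal_le_iff_le_toReal hq] at heq)
      calc ENNReal.ofReal T ^ ((1 / e - 1 / q.toReal) * e)
          ≤ (1 + ENNReal.ofReal T₀) ^ ((1 / e - 1 / q.toReal) * e) := by
            gcongr; exact (ENNReal.ofReal_le_ofReal hT₀).trans le_add_self
        _ ≤ (1 + ENNReal.ofReal T₀) ^ (1 : ℝ) :=
            ENNReal.rpow_le_rpow_of_exponent_le le_self_add hexp
        _ = _ := ENNReal.rpow_one _
  calc ∫⁻ t in Ioo 0 T, (1 + M t) ^ e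
      ≤ ∫⁻ t in Ioo 0 T, 2 ^ e * (1 + M t ^ e) := by
        refine lintegral_mono fun t => ?_
        have : 1 + M t ≤ 2 * max 1 (M t) := by
          rw [two_mul]; exact add_le_add (le_max_left _ _) (le_max_right _ _)
        calc (1 + M t) ^ e ≤ (2 * max 1 (M t)) ^ e := by gcongr
          _ = 2 ^ e * max 1 (M t) ^ e := ENNReal.mul_rpow_of_nonneg _ _ he0.le
          _ ≤ _ := by
            gcongr
            obtain h | h := le_total 1 (M t)
            · rw [max_eq_right h]; exact le_add_self
            · rw [max_eq_left h, ENNReal.one_rpow]; exact le_self_add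
    _ = 2 ^ e * (ENNReal.ofReal T + ∫⁻ t in Ioo 0 T, M t ^ e) := by
        rw [lintegral_const_mul' _ _ (by finiteness), lintegral_add_left measurable_const]
        simp
    _ ≤ 2 ^ (4 / θ) * ((1 + ENNReal.ofReal T₀) +
          (1 + ENNReal.ofReal N₀) ^ (4 / θ) * (1 + ENNReal.ofReal T₀)) := by
        gcongr
        · norm_num
        · exact (ENNReal.ofReal_le_ofReal hT₀).trans le_add_self
    _ = _ := by rw [subcriticalBound]; ring

/-- Here `s = 1 / p`, equal to zero when `p = ∞`. The slice inequality is Hölder's with exponents `p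
/ 2` and `1 / (1 - 2 * s)`, and `N` is one plus the spatial norm of the slice. The added one lets
powers of `N` be compared later. -/
theorem isSubcritical_of_firstExponents {n : ℕ} {θ : ℝ} (hθ : 0 < θ) (hθ' : θ < 1)
    {Ω : Set (Space n)} {T T₀ N₀ : ℝ} (hT₀ : T ≤ T₀) {p q : ℝ≥0∞}
    (hpq : FirstExponents n θ p q) {β : Space n × ℝ → ℝ} (hβ : MemMixed Ω T p q β)
    (hN : mixedNorm Ω T p q β ≤ ENNReal.ofReal N₀) :
    IsSubcritical n θ Ω T (subcriticalBound θ T₀ N₀) β := by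
  obtain ⟨hp, hpq⟩ := hpq
  have hβm := hβ.1
  rw [restrict_cylinder] at hβm
  set s : ℝ := p.toReal⁻¹ with hs
  have h1θ : 0 < 1 - θ := by linarith
  have hp2 : 2 < p := lt_of_lt_of_le (by
    rw [← ENNReal.ofReal_ofNat, ENNReal.ofReal_lt_ofReal_iff (by positivity), lt_div_iff₀ h1θ]
    linarith) hp
  have hp0 : p ≠ 0 := (zero_lt_two.trans hp2).ne'
  have hs0 : 0 ≤ s := by positivity
  have hs1 : s ≤ (1 - θ) / 2 := by
    by_cases hpt : p = ∞
    · simp [hs, hpt]; linarith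
    · have : 2 / (1 - θ) ≤ p.toReal := (ENNReal.ofReal_le_iff_le_toReal hpt).1 hp
      rw [hs, ← inv_div]
      exact inv_anti₀ (by positivity) this
  have hreal : n * s / 2 + 1 / q.toReal ≤ (1 - θ) / 2 := by
    have h1 := ENNReal.toReal_mono ENNReal.ofReal_ne_top hpq
    have hne := ne_top_of_le_ne_top ENNReal.ofReal_ne_top hpq
    rw [ENNReal.toReal_add (ne_top_of_le_ne_top hne le_self_add)
      (ne_top_of_le_ne_top hne le_add_self), ENNReal.toReal_ofReal (by linarith),
      ENNReal.toReal_div, ENNReal.toReal_div, ENNReal.toReal_mul] at h1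
    simp only [ENNReal.toReal_natCast, ENNReal.toReal_ofNat, ENNReal.toReal_one] at h1
    refine le_trans (le_of_eq ?_) h1
    rw [hs]; congr 1; rw [div_mul_eq_div_div, div_eq_mul_inv, div_eq_mul_inv, div_eq_mul_inv]; ring
  have hq0 : q ≠ 0 := by
    rintro rfl
    simp at hpq
  have hns : n * s ≤ 1 - θ := by
    have : 0 ≤ 1 / q.toReal := by positivity
    linarith
  have hden : 0 < 1 - (n * s + θ / 2) := by linarith
  set e : ℝ := 2 / (1 - (n * s + θ / 2)) with he
  have he1 : 1 ≤ e := by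
    have : 0 ≤ n * s := by positivity
    rw [he, le_div_iff₀ hden]; linarith
  have heθ : e ≤ 4 / θ := by
    rw [he, div_le_div_iff₀ hden hθ]; nlinarith
  -- The hypothesis amounts to `1 / q ≤ (1 - θ - n * s) / 2`, whereas `1 / e = (1 - θ / 2 - n * s) /
  -- 2`. Only half of the margin `θ` is used, and `n * s + θ / 2` is the gradient exponent of the
  -- superlinear estimate.
  have heq : ENNReal.ofReal e ≤ q := by
    by_cases hqt : q = ∞
    · simp [hqt]
    · rw [ENNReal.ofReal_le_iff_le_toReal hqt]
      have hq : 0 < q.toReal := ENNReal.toReal_pos hq0 hqt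
      rw [he, div_le_iff₀ hden]
      have h2 : 1 ≤ q.toReal * ((1 - θ) / 2 - n * s / 2) := by
        rw [mul_comm, ← div_le_iff₀ hq]; linarith
      nlinarith
  refine ⟨hβ.1, s, hs0, hs1, hns,
    fun t => 1 + eLpNorm (fun x => β (x, t)) p (volume.restrict Ω),
    (aemeasurable_eLpNorm_slice hβm p).const_add 1, fun t => le_self_add,
    lintegral_one_add_rpow_le hT₀ (aemeasurable_eLpNorm_slice hβm p) he1 heθ heq hN, ?_⟩
  filter_upwards [aestronglyMeasurable_slice hβm] with t ht h hh
  refine le_trans ?_ (mul_le_mul_left (pow_le_pow_left'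
    (le_add_self (a := eLpNorm (fun x => β (x, t)) p (volume.restrict Ω)) (b := 1)) 2) _)
  by_cases hpt : p = ∞
  · have hs' : s = 0 := by simp [hs, hpt]
    rw [hs', hpt]
    simp only [sub_zero, one_div_one_div, mul_zero, ENNReal.rpow_one, ENNReal.rpow_two]
    rw [eLpNorm_exponent_top,
      ← lintegral_const_mul'' _ (hh.pow_const 2)]
    refine lintegral_mono_ae ?_
    filter_upwards [ENNReal.ae_le_essSup (μ := volume.restrict Ω) fun x => ‖β (x, t)‖ₑ] with x hx
    gcongr
    exact hx
  · have hpr : 2 < p.toReal := by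
      have := (ENNReal.toReal_lt_toReal (by simp) hpt).2 hp2
      simpa using this
    have hs2 : s < 1 / 2 := by linarith
    have hconj : Real.HolderConjugate (p.toReal / 2) (1 / (1 - 2 * s)) := by
      rw [Real.holderConjugate_iff]
      refine ⟨by linarith, ?_⟩
      rw [one_div, inv_inv, hs]; field_simp; ring
    have := ENNReal.lintegral_mul_le_Lp_mul_Lq (volume.restrict Ω) hconj
      (ht.enorm.pow_const 2) (hh.pow_const 2)
    simp only [Pi.mul_apply] at this
    refine this.trans (le_of_eq ?_)
    rw [eLpNorm_eq_lintegral_rpow_enorm_toReal hp0 hpt, one_div_one_div]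
    congr 1
    · rw [← ENNReal.rpow_natCast, ← ENNReal.rpow_mul]
      congr 1
      · congr with x
        rw [← ENNReal.rpow_natCast, ← ENNReal.rpow_mul]; congr 1; push_cast; ring
      · push_cast; field_simp
    · congr with x
      rw [← ENNReal.rpow_natCast, ← ENNReal.rpow_mul]
      congr 1
      push_cast
      have : 1 - 2 * s ≠ 0 := by linarith
      have : 1 / 2 - s ≠ 0 := by linarith
      field_simp

end

/-! ### Slice estimates with an integrable kernel in time -/

section

/-- Constants `R, C` for which a Gagliardo–Nirenberg inequality holds. -/
structure IsGagliardoNirenberg (n : ℕ) (θ R : ℝ) (C : ℝ≥0) : Prop where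
  two_lt : 2 < R
  le_half : (n : ℝ) * (R - 2) / 4 ≤ R / 2
  interp : ∀ s : ℝ, 0 ≤ s → s ≤ (1 - θ) / 2 → n * s ≤ 1 - θ → 1 + θ / n ≤ R * (1 / 2 - s)
  one_le : 1 ≤ C
  ineq : ∀ w : Space n → ℝ, ContDiff ℝ 1 w → HasCompactSupport w →
    ∫⁻ x, ‖w x‖ₑ ^ R ≤ C * (∫⁻ x, ‖w x‖ₑ ^ 2) ^ (R / 2 - n * (R - 2) / 4) *
      (∫⁻ x, ‖fderiv ℝ w x‖ₑ ^ 2) ^ ((n : ℝ) * (R - 2) / 4)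

theorem exists_isGagliardoNirenberg (n : ℕ) (hn : 1 ≤ n) (θ : ℝ) (hθ : 0 < θ) (hθ' : θ < 1) :
    ∃ R C, IsGagliardoNirenberg n θ R C := by
  obtain ⟨R, h1, h2, h3, C, hC⟩ := exists_gagliardoNirenberg n hn θ hθ hθ'
  refine ⟨R, max 1 C, h1, h2, h3, le_max_left _ _, fun w hw hc => (hC w hw hc).trans ?_⟩
  gcongr
  exact le_max_right _ _

/-- The Gagliardo–Nirenberg inequality for a slice `h`, with `D` in place of the integral of the
squared gradient. -/
def SliceGN (n : ℕ) (R : ℝ) (C : ℝ≥0) (Ω : Set (Space n)) (h : Space n → ℝ≥0∞) (D : ℝ≥0∞) : Prop :=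
  ∫⁻ x in Ω, h x ^ R ≤ C * (∫⁻ x in Ω, h x ^ 2) ^ (R / 2 - n * (R - 2) / 4) *
    D ^ ((n : ℝ) * (R - 2) / 4)

/-- The constant of the interpolated inequalities. -/
noncomputable def interpConst (R : ℝ) (C : ℝ≥0) : ℝ≥0 := C ^ (4 / (R - 2))

/-- The constant of the inequality in which the gradient term is absorbed. -/
noncomputable def absorbConst (θ R : ℝ) (C ε : ℝ≥0) : ℝ≥0 := (interpConst R C / ε) ^ (1 / θ)

/-- The kernel is `N ^ e` with `e = 2 / (1 - (n * s + θ / 2))`. As `N ≥ 1`, it satisfies `N ^ 2 ≤ (N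
^ e) ^ (1 - ν)` for each gradient exponent `ν` that occurs: `0` for the integral of `β ^ 2`, `n * s`
for the linear estimate, `n * s + θ / 2` for the superlinear one. Weighted arithmetic-geometric
means then separate the kernel term from the gradient. The linear estimate serves for absorption and
Gronwall's inequality, the superlinear one for the iteration. -/
theorem IsSubcritical.exists_kernel {n : ℕ} (hn : 1 ≤ n) {θ R : ℝ} {C : ℝ≥0} (hθ : 0 < θ)
    (hθ' : θ < 1) (gn : IsGagliardoNirenberg n θ R C) {Ω : Set (Space n)} {T : ℝ} {κ : ℝ≥0∞}
    {β : Space n × ℝ → ℝ} (hβ : IsSubcritical n θ Ω T κ β) :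
    ∃ K : ℝ → ℝ≥0∞, AEMeasurable K (volume.restrict (Ioo 0 T)) ∧ ∫⁻ t in Ioo 0 T, K t ≤ κ ∧
      ∀ᵐ t ∂(volume.restrict (Ioo 0 T)),
        (∫⁻ x in Ω, ‖β (x, t)‖ₑ ^ 2 ≤ K t * (1 + volume Ω)) ∧
        ∀ h : Space n → ℝ≥0∞, AEMeasurable h (volume.restrict Ω) → ∀ D, SliceGN n R C Ω h D →
          (∀ ε : ℝ≥0, 0 < ε → ε ≤ 1 → ∫⁻ x in Ω, ‖β (x, t)‖ₑ ^ 2 * h x ^ 2 ≤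
            ε * D + absorbConst θ R C ε * K t * ∫⁻ x in Ω, h x ^ 2) ∧
          (∀ E, ∫⁻ x in Ω, h x ^ 2 ≤ E →
            ∫⁻ x in Ω, ‖β (x, t)‖ₑ ^ 2 * (h x ^ (1 + θ / n)) ^ 2 ≤
              interpConst R C * E ^ (θ / n) * (K t * E + D)) := by
  obtain ⟨s, hs0, hs1, hns, N, hNm, hN1, hNκ, hN⟩ := hβ.bound
  have hn' : (1 : ℝ) ≤ n := by exact_mod_cast hn
  have hns0 : 0 ≤ n * s := by positivity
  have hθn : θ / n ≤ 1 := by rw [div_le_one (by linarith)]; linarith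
  have hθn0 : 0 < θ / n := by positivity
  have hden : 0 < 1 - (n * s + θ / 2) := by linarith
  set e : ℝ := 2 / (1 - (n * s + θ / 2)) with he
  have he2 : 2 ≤ e := by rw [he, le_div_iff₀ hden]; linarith
  have hC'1 : 1 ≤ interpConst R C :=
    NNReal.one_le_rpow gn.one_le (div_nonneg (by norm_num) (by linarith [gn.two_lt]))
  have hC'coe : ((interpConst R C : ℝ≥0) : ℝ≥0∞) = (C : ℝ≥0∞) ^ (4 / (R - 2)) :=
    (ENNReal.coe_rpow_of_ne_zero (zero_lt_one.trans_le gn.one_le).ne' _)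
  refine ⟨fun t => N t ^ e, hNm.pow_const e, hNκ, ?_⟩
  filter_upwards [hN] with t ht
  have hNe : ∀ {ν : ℝ}, 0 < 1 - ν → 2 ≤ e * (1 - ν) → N t ^ 2 ≤ (N t ^ e) ^ (1 - ν) := by
    intro ν _ h
    rw [← ENNReal.rpow_mul, ← ENNReal.rpow_two]
    exact ENNReal.rpow_le_rpow_of_exponent_le (hN1 t) h
  refine ⟨?_, fun h hh D hGN => ⟨fun ε hε hε1 => ?_, fun E hE => ?_⟩⟩
  · have := ht (fun _ => 1) aemeasurable_const
    simp only [one_pow, mul_one, ENNReal.one_rpow, lintegral_const, one_mul,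
      Measure.restrict_apply_univ] at this
    refine this.trans ?_
    gcongr
    · have := hNe (ν := 0) (by norm_num) (by linarith)
      simpa using this
    · calc volume Ω ^ (1 - 2 * s) ≤ (1 + volume Ω) ^ (1 - 2 * s) := by
            gcongr
            · linarith
            · exact le_add_self
        _ ≤ (1 + volume Ω) ^ (1 : ℝ) :=
            ENNReal.rpow_le_rpow_of_exponent_le le_self_add (by linarith)
        _ = _ := ENNReal.rpow_one _
  · set y := ∫⁻ x in Ω, h x ^ 2
    have h1 := lintegral_rpow_le_of_gagliardoNirenberg (m := n) (χ := 1) (by linarith) gn.two_lt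
      gn.le_half gn.one_le hs0 (by linarith) le_rfl (by norm_num)
      (by linarith [gn.interp s hs0 hs1 hns]) hh hGN
    rw [← hC'coe] at h1
    simp only [sub_self, mul_zero, zero_div, add_zero] at h1
    have hν : 0 < 1 - n * s := by linarith
    set A := absorbConst θ R C ε with hA
    -- The exponent `1 / θ` in `absorbConst` compensates `1 - n * s ≥ θ`. Since `interpConst R C / ε
    -- ≥ 1` and `ε ≤ 1`, powers depending on `s` can be exchanged for ones that do not.
    have hAε : (interpConst R C : ℝ≥0∞) ≤ (A : ℝ≥0∞) ^ (1 - n * s) * (ε : ℝ≥0∞) ^ (n * s) := by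
      have hr : 1 ≤ interpConst R C / ε := by
        rw [one_le_div₀ hε]; exact hε1.trans hC'1
      have h2 : interpConst R C / ε ≤ A ^ (1 - n * s) := by
        rw [hA, absorbConst, ← NNReal.rpow_mul]
        refine (NNReal.rpow_one _).symm.le.trans (NNReal.rpow_le_rpow_of_exponent_le hr ?_)
        rw [one_div_mul_eq_div, le_div_iff₀ hθ]; linarith
      have h3 : ε ≤ ε ^ (n * s) := by
        calc ε = ε ^ (1 : ℝ) := (NNReal.rpow_one _).symm
          _ ≤ _ := NNReal.rpow_le_rpow_of_exponent_ge hε hε1 (by linarith)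
      have h4 : interpConst R C ≤ A ^ (1 - n * s) * ε ^ (n * s) := by
        calc interpConst R C = interpConst R C / ε * ε := (div_mul_cancel₀ _ hε.ne').symm
          _ ≤ _ := mul_le_mul' h2 h3
      rw [← ENNReal.coe_rpow_of_nonneg _ hν.le, ← ENNReal.coe_rpow_of_nonneg _ hns0]
      exact_mod_cast h4
    calc ∫⁻ x in Ω, ‖β (x, t)‖ₑ ^ 2 * h x ^ 2
        ≤ N t ^ 2 * (interpConst R C * y ^ (1 - n * s) * D ^ (n * s)) :=
          (ht h hh).trans (by gcongr)
      _ ≤ (N t ^ e) ^ (1 - n * s) * (((A : ℝ≥0∞) ^ (1 - n * s) * (ε : ℝ≥0∞) ^ (n * s)) *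
            y ^ (1 - n * s) * D ^ (n * s)) := by
          gcongr
          exact hNe hν (by
            rw [he, div_mul_eq_mul_div, le_div_iff₀ hden]; nlinarith)
      _ = (A * N t ^ e * y) ^ (1 - n * s) * (ε * D) ^ (n * s) := by
          rw [ENNReal.mul_rpow_of_nonneg _ _ hν.le, ENNReal.mul_rpow_of_nonneg _ _ hν.le,
            ENNReal.mul_rpow_of_nonneg _ _ hns0]
          ring
      _ ≤ A * N t ^ e * y + ε * D := rpow_mul_rpow_le_add _ _ hns0 (by linarith)
      _ = _ := add_comm _ _
  · set y := ∫⁻ x in Ω, h x ^ 2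
    have hν : n * s + n * (1 + θ / n - 1) / 2 = n * s + θ / 2 := by field_simp; ring
    have h1 := lintegral_rpow_le_of_gagliardoNirenberg (m := n) (χ := 1 + θ / n) (by linarith)
      gn.two_lt gn.le_half gn.one_le hs0 (by linarith) (by linarith) (by linarith)
      (gn.interp s hs0 hs1 hns) hh hGN
    rw [← hC'coe, hν] at h1
    have h2 := ht (fun x => h x ^ (1 + θ / n)) (hh.pow_const _)
    -- The surplus `θ / n` in the power of the mass is what produces the gain `E ^ (θ / n)`; the
    -- exponents that remain add up to one.
    have hχ : 1 + θ / n - (n * s + θ / 2) = θ / n + (1 - (n * s + θ / 2)) := by ring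
    calc ∫⁻ x in Ω, ‖β (x, t)‖ₑ ^ 2 * (h x ^ (1 + θ / n)) ^ 2
        ≤ N t ^ 2 * (interpConst R C * y ^ (1 + θ / n - (n * s + θ / 2)) *
            D ^ (n * s + θ / 2)) := by
          refine h2.trans ?_
          gcongr
          refine le_trans (le_of_eq ?_) h1
          congr with x
          rw [← ENNReal.rpow_mul]; congr 1; ring
      _ ≤ (N t ^ e) ^ (1 - (n * s + θ / 2)) * (interpConst R C *
            (E ^ (θ / n) * E ^ (1 - (n * s + θ / 2))) * D ^ (n * s + θ / 2)) := by
          gcongr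
          · exact hNe hden (by rw [he, div_mul_cancel₀ _ hden.ne'])
          · rw [hχ, ENNReal.rpow_add_of_nonneg _ _ hθn0.le hden.le]
            gcongr
      _ = interpConst R C * E ^ (θ / n) *
            ((N t ^ e * E) ^ (1 - (n * s + θ / 2)) * D ^ (n * s + θ / 2)) := by
          rw [ENNReal.mul_rpow_of_nonneg _ _ hden.le]
          ring
      _ ≤ _ := by
          gcongr
          exact rpow_mul_rpow_le_add _ _ (by linarith) (by linarith)

/-- Gagliardo–Nirenberg on almost every slice, for limits of test functions. -/
theorem IsSobolevLimit.ae_sliceGN {n : ℕ} {θ R : ℝ} {C : ℝ≥0}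
    (gn : IsGagliardoNirenberg n θ R C) {W : Space n × ℝ → ℝ} {P : Space n × ℝ → Space n}
    (h : IsSobolevLimit W P) {Ω : Set (Space n)} (hW : ∀ x t, x ∉ Ω → W (x, t) = 0)
    (hΩ : MeasurableSet Ω) :
    ∀ᵐ t : ℝ, SliceGN n R C Ω (fun x => ‖W (x, t)‖ₑ) (∫⁻ x, ‖P (x, t)‖ₑ ^ 2) := by
  have hB : 0 ≤ (n : ℝ) * (R - 2) / 4 := by
    have := gn.two_lt
    have : 0 ≤ R - 2 := by linarith
    positivity
  filter_upwards [h.ae_slice (sub_nonneg.2 gn.le_half) hB gn.ineq] with t ht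
  have e : ∫⁻ x in Ω, ‖W (x, t)‖ₑ ^ 2 = ∫⁻ x, ‖W (x, t)‖ₑ ^ 2 := by
    rw [← lintegral_indicator hΩ]
    congr with x
    by_cases hx : x ∈ Ω
    · simp [hx]
    · simp [hx, hW x t hx]
  rw [SliceGN, e]
  exact (lintegral_mono' Measure.restrict_le_self le_rfl).trans ht

end

/-! ### The energy class on compact subsets: mollification and cutoff -/

section

variable {n : ℕ} {Ω : Set (Space n)} {T : ℝ}

theorem isOpen_cylinder (hΩ : IsOpen Ω) : IsOpen (cylinder Ω T) := hΩ.prod isOpen_Ioo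

theorem lintegral_cylinder {f : Space n × ℝ → ℝ≥0∞}
    (hf : AEMeasurable f (volume.restrict (cylinder Ω T))) :
    ∫⁻ z in cylinder Ω T, f z = ∫⁻ t in Ioo 0 T, ∫⁻ x in Ω, f (x, t) := by
  rw [restrict_cylinder] at hf ⊢
  exact lintegral_prod_symm _ hf

section Loc

variable {F : Type*} [NormedAddCommGroup F] {w : Space n × ℝ → F} {K : Set (Space n × ℝ)}

theorem aestronglyMeasurable_indicator_of_subset
    (hw : AEStronglyMeasurable w (volume.restrict (cylinder Ω T))) (hK : MeasurableSet K)
    (hKQ : K ⊆ cylinder Ω T) : AEStronglyMeasurable (K.indicator w) volume :=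
  (aestronglyMeasurable_indicator_iff hK).2 (hw.mono_measure (Measure.restrict_mono hKQ le_rfl))

theorem lintegral_indicator_enorm_sq_eq
    (hw : AEStronglyMeasurable w (volume.restrict (cylinder Ω T))) (hΩ : IsOpen Ω)
    (hK : MeasurableSet K) (hKQ : K ⊆ cylinder Ω T) :
    ∫⁻ z, ‖K.indicator w z‖ₑ ^ 2 =
      ∫⁻ t in Ioo 0 T, eLpNorm (fun x => K.indicator w (x, t)) 2 (volume.restrict Ω) ^ 2 := by
  have hm := aestronglyMeasurable_indicator_of_subset hw hK hKQ
  have e : ∫⁻ z, ‖K.indicator w z‖ₑ ^ 2 = ∫⁻ z in cylinder Ω T, ‖K.indicator w z‖ₑ ^ 2 := by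
    rw [← lintegral_indicator (isOpen_cylinder hΩ).measurableSet]
    congr with z
    by_cases hz : z ∈ cylinder Ω T
    · simp [hz]
    · have : z ∉ K := fun h => hz (hKQ h)
      simp [hz, this]
  rw [e, lintegral_cylinder (hm.restrict.enorm.pow_const 2)]
  simp_rw [lintegral_enorm_sq_eq]

theorem memLp_of_lintegral_enorm_sq {α : Type*} [MeasurableSpace α] {μ : Measure α} {f : α → F}
    (hf : AEStronglyMeasurable f μ) (h : ∫⁻ x, ‖f x‖ₑ ^ 2 ∂μ < ∞) : MemLp f 2 μ := by
  refine ⟨hf, ?_⟩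
  rw [lintegral_enorm_sq_eq] at h
  exact lt_of_not_ge fun h' => by simp [top_le_iff.1 h'] at h

theorem MemMixedLoc.memLp_two (hw : MemMixedLoc Ω T 2 2 w) (hΩ : IsOpen Ω) (hK : IsCompact K)
    (hKQ : K ⊆ cylinder Ω T) : MemLp (K.indicator w) 2 volume := by
  refine memLp_of_lintegral_enorm_sq
    (aestronglyMeasurable_indicator_of_subset hw.1 hK.measurableSet hKQ) ?_
  rw [lintegral_indicator_enorm_sq_eq hw.1 hΩ hK.measurableSet hKQ]
  have h := hw.2 K hK hKQ
  have e := lintegral_enorm_sq_eq (μ := volume.restrict (Ioo 0 T)) (F := ℝ) fun t =>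
    (eLpNorm (fun x => K.indicator w (x, t)) 2 (volume.restrict Ω)).toReal
  have h2 := eLpNorm_nnreal_pow_eq_lintegral (μ := volume.restrict (Ioo 0 T)) (p := 2)
    (f := fun t => eLpNorm (fun x => K.indicator w (x, t)) 2 (volume.restrict Ω)) (by norm_num)
  simp only [NNReal.coe_ofNat, ENNReal.rpow_two, enorm_eq_self] at h2
  rw [← h2]
  exact ENNReal.pow_lt_top h

theorem MemMixedLoc.exists_slice_bound (hw : MemMixedLoc Ω T 2 ∞ w) (hK : IsCompact K)
    (hKQ : K ⊆ cylinder Ω T) : ∃ M : ℝ≥0∞, M < ∞ ∧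
      ∀ᵐ t ∂(volume.restrict (Ioo 0 T)), ∫⁻ x in Ω, ‖K.indicator w (x, t)‖ₑ ^ 2 ≤ M := by
  refine ⟨mixedNorm Ω T 2 ∞ (K.indicator w) ^ 2, ENNReal.pow_lt_top (hw.2 K hK hKQ), ?_⟩
  rw [mixedNorm, eLpNorm_exponent_top, eLpNormEssSup]
  filter_upwards [ENNReal.ae_le_essSup (μ := volume.restrict (Ioo 0 T)) fun t =>
    ‖eLpNorm (fun x => K.indicator w (x, t)) 2 (volume.restrict Ω)‖ₑ] with t ht
  rw [lintegral_enorm_sq_eq (fun x => K.indicator w (x, t))]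
  exact pow_le_pow_left' ht 2

theorem MemMixedLoc.memLp_two_of_top (hw : MemMixedLoc Ω T 2 ∞ w) (hΩ : IsOpen Ω)
    (hK : IsCompact K) (hKQ : K ⊆ cylinder Ω T) : MemLp (K.indicator w) 2 volume := by
  refine memLp_of_lintegral_enorm_sq
    (aestronglyMeasurable_indicator_of_subset hw.1 hK.measurableSet hKQ) ?_
  rw [lintegral_indicator_enorm_sq_eq hw.1 hΩ hK.measurableSet hKQ]
  obtain ⟨M, hM, h⟩ := hw.exists_slice_bound hK hKQ
  simp_rw [lintegral_enorm_sq_eq] at h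
  refine (lintegral_mono_ae h).trans_lt ?_
  rw [lintegral_const]
  exact ENNReal.mul_lt_top hM (by simp)

end Loc

instance isAddHaarMeasure_volume_spaceTime :
    (volume : Measure (Space n × ℝ)).IsAddHaarMeasure :=
  inferInstanceAs ((volume : Measure (Space n)).prod (volume : Measure ℝ)).IsAddHaarMeasure

/-- A mollifying sequence. -/
noncomputable def bumpSeq (n k : ℕ) (r : ℝ) (hr : 0 < r) : ContDiffBump (0 : Space n × ℝ) where
  rIn := r / (k + 2) / 2
  rOut := r / (k + 2)
  rIn_pos := by positivity
  rIn_lt_rOut := half_lt_self (by positivity)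

theorem bumpSeq_rOut_lt (k : ℕ) {r : ℝ} (hr : 0 < r) : (bumpSeq n k r hr).rOut < r := by
  have hk : (0 : ℝ) ≤ k := k.cast_nonneg
  exact div_lt_self hr (by linarith)

theorem tendsto_bumpSeq_rOut {r : ℝ} (hr : 0 < r) :
    Tendsto (fun k => (bumpSeq n k r hr).rOut) atTop (𝓝 0) :=
  tendsto_const_nhds.div_atTop
    (tendsto_atTop_add_const_right _ _ tendsto_natCast_atTop_atTop)

theorem ae_tendsto_mollify_bumpSeq {r : ℝ} (hr : 0 < r) {F : Type*} [NormedAddCommGroup F]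
    [NormedSpace ℝ F] [CompleteSpace F] {f : Space n × ℝ → F} (hf : LocallyIntegrable f volume) :
    ∀ᵐ z, Tendsto (fun k => mollify (bumpSeq n k r hr) volume f z) atTop (𝓝 (f z)) :=
  ContDiffBump.ae_convolution_tendsto_right_of_locallyIntegrable (K := 2) (tendsto_bumpSeq_rOut hr)
    (Eventually.of_forall fun k => by simp only [bumpSeq]; linarith) hf

/-- On points whose neighborhoods lie in the set `K`, the spatial gradient of the mollification of
`u` is the mollification of the generalized gradient. -/
theorem spaceGrad_mollify {u : Space n × ℝ → ℝ} {ux : Space n × ℝ → Space n}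
    (hΩ : IsOpen Ω) (hu : IsGenGrad Ω T u ux) {K : Set (Space n × ℝ)}
    (hKQ : K ⊆ cylinder Ω T) (hU : MemLp (K.indicator u) 2 volume)
    (hP : MemLp (K.indicator ux) 2 volume) (φ : ContDiffBump (0 : Space n × ℝ))
    {z : Space n × ℝ} (hz : Metric.closedBall z φ.rOut ⊆ K) :
    spaceGrad (mollify φ volume (K.indicator u)) z =
      mollify φ volume (K.indicator ux) z := by
  have hUl : LocallyIntegrable (K.indicator u) volume := hU.locallyIntegrable (by norm_num)
  have hPl : LocallyIntegrable (K.indicator ux) volume := hP.locallyIntegrable (by norm_num)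
  have hQ := (isOpen_cylinder (T := T) hΩ).measurableSet
  set ρ : Space n × ℝ → ℝ := φ.normed volume with hρ
  have hρ1 : ContDiff ℝ 1 ρ := φ.contDiff_normed (n := 1)
  -- The mollifier reflected about `z` is itself an admissible test function for the generalized
  -- gradient, because the closed ball about `z` lies in `K`.
  set ψ : Space n × ℝ → ℝ := fun y => ρ (z - y) with hψ
  have hψ1 : ContDiff ℝ 1 ψ := hρ1.comp (contDiff_const.sub contDiff_id)
  have hψd : ∀ y v, fderiv ℝ ψ y v = - fderiv ℝ ρ (z - y) v := by
    intro y v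
    have h1 := (hρ1.differentiable one_ne_zero (z - y)).hasFDerivAt.comp y
      ((hasFDerivAt_id (𝕜 := ℝ) y).const_sub z)
    have h2 : fderiv ℝ ψ y = _ := h1.fderiv
    rw [h2]; simp
  have hψs : tsupport ψ ⊆ Metric.closedBall z φ.rOut := by
    refine closure_minimal (fun y hy => ?_) Metric.isClosed_closedBall
    have : z - y ∈ Function.support ρ := hy
    rw [hρ, φ.support_normed_eq, mem_ball_zero_iff] at this
    rw [Metric.mem_closedBall, dist_comm, dist_eq_norm]
    exact this.le
  have hψK : tsupport ψ ⊆ K := hψs.trans hz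
  have hψc : HasCompactSupport ψ :=
    (isCompact_closedBall z φ.rOut).of_isClosed_subset (isClosed_tsupport ψ) hψs
  have hgrad := hu ψ ⟨hψ1, hψc, hψK.trans hKQ⟩
  have e1 : ∫ y in cylinder Ω T, u y • spaceGrad ψ y =
      ∫ y, K.indicator u y • spaceGrad ψ y := by
    refine Eq.trans ?_ (setIntegral_eq_integral_of_forall_compl_eq_zero (s := cylinder Ω T)
      (f := fun y => K.indicator u y • spaceGrad ψ y) ?_)
    · refine setIntegral_congr_fun hQ fun y _ => ?_
      by_cases hy : y ∈ K
      · simp [hy]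
      · have : spaceGrad ψ y = 0 := by
          by_contra h
          exact hy (hψK (support_spaceGrad_subset hψ1 h))
        simp [this]
    · intro y hy
      have : y ∉ K := fun h => hy (hKQ h)
      simp [this]
  have e2 : ∫ y in cylinder Ω T, ψ y • ux y = ∫ y, ψ y • K.indicator ux y := by
    refine Eq.trans ?_ (setIntegral_eq_integral_of_forall_compl_eq_zero (s := cylinder Ω T)
      (f := fun y => ψ y • K.indicator ux y) ?_)
    · refine setIntegral_congr_fun hQ fun y _ => ?_
      by_cases hy : y ∈ K
      · simp [hy]
      · have : ψ y = 0 := by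
          by_contra h
          exact hy (hψK (subset_tsupport ψ h))
        simp [this]
    · intro y hy
      have : y ∉ K := fun h => hy (hKQ h)
      simp [this]
  rw [e1, e2] at hgrad
  have hI : Integrable (fun y => K.indicator u y • spaceGrad ψ y) volume := by
    obtain ⟨C, hC⟩ := (hasCompactSupport_spaceGrad hψ1 hψc).exists_bound_of_continuous
      (continuous_spaceGrad hψ1)
    have h2 : Integrable (fun y => spaceGrad ψ y) volume :=
      (continuous_spaceGrad hψ1).integrable_of_hasCompactSupport
        (hasCompactSupport_spaceGrad hψ1 hψc)
    have h3 : MemLp (fun y => spaceGrad ψ y) 2 volume :=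
      (continuous_spaceGrad hψ1).memLp_of_hasCompactSupport
        (hasCompactSupport_spaceGrad hψ1 hψc)
    exact memLp_one_iff_integrable.1 (h3.smul (r := 1) hU)
  refine ext_inner_right ℝ fun v => ?_
  rw [inner_spaceGrad ((contDiff_mollify φ hUl).differentiable one_ne_zero),
    fderiv_mollify_apply φ hUl]
  have h1 : ∫ y, (fderiv ℝ ρ (z - y) (v, 0)) • K.indicator u y =
      - inner ℝ v (∫ y, K.indicator u y • spaceGrad ψ y) := by
    rw [← integral_inner hI, ← integral_neg]
    congr with y
    rw [inner_smul_right, real_inner_comm,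
      inner_spaceGrad (hψ1.differentiable one_ne_zero), hψd, smul_eq_mul]
    ring
  rw [h1, hgrad, inner_neg_right, neg_neg, mollify_apply_swap, real_inner_comm]

/-- Cut off, functions of the energy class are limits of test functions. -/
theorem InEnergyClass.isSobolevLimit_cutoff {u : Space n × ℝ → ℝ} {ux : Space n × ℝ → Space n}
    (hΩ : IsOpen Ω) (hu : InEnergyClass Ω T u ux) {ζ : Space n × ℝ → ℝ}
    (hζ : IsTestFunction Ω T ζ) :
    IsSobolevLimit (fun z => ζ z * u z) (fun z => ζ z • ux z + u z • spaceGrad ζ z) := by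
  obtain ⟨hζ1, hζc, hζQ⟩ := hζ
  -- The compact collar `K` around the support of `ζ` contains every ball used when mollifying at
  -- scales below `r`, so `u` and `ux` may be replaced by their restrictions to `K`, which lie in
  -- `L²`.
  obtain ⟨r, hr, hrQ⟩ := IsCompact.exists_cthickening_subset_open hζc
    (isOpen_cylinder (T := T) hΩ) hζQ
  set K := Metric.cthickening r (tsupport ζ) with hK
  have hKc : IsCompact K := IsCompact.cthickening hζc
  have hU : MemLp (K.indicator u) 2 volume := hu.1.memLp_two_of_top hΩ hKc hrQ
  have hP : MemLp (K.indicator ux) 2 volume := hu.2.1.memLp_two hΩ hKc hrQ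
  have hUl : LocallyIntegrable (K.indicator u) volume := hU.locallyIntegrable (by norm_num)
  have hζK : tsupport ζ ⊆ K := Metric.self_subset_cthickening _
  have eW : (fun z => ζ z * u z) = fun z => ζ z • K.indicator u z := by
    ext1 z
    by_cases hz : z ∈ K
    · simp [hz]
    · have : ζ z = 0 := by
        by_contra h; exact hz (hζK (subset_tsupport ζ h))
      simp [this]
  have eP : (fun z => ζ z • ux z + u z • spaceGrad ζ z) =
      fun z => ζ z • K.indicator ux z + K.indicator u z • spaceGrad ζ z := by
    ext1 z
    by_cases hz : z ∈ K
    · simp [hz]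
    · have h1 : ζ z = 0 := by
        by_contra h; exact hz (hζK (subset_tsupport ζ h))
      have h2 : spaceGrad ζ z = 0 := by
        by_contra h; exact hz (hζK (support_spaceGrad_subset hζ1 h))
      simp [h1, h2]
  rw [eW, eP]
  obtain ⟨C, hC⟩ := hζc.exists_bound_of_continuous hζ1.continuous
  obtain ⟨C', hC'⟩ := (hasCompactSupport_spaceGrad hζ1 hζc).exists_bound_of_continuous
    (continuous_spaceGrad hζ1)
  have hζm := hζ1.continuous.aestronglyMeasurable (μ := volume)
  have hζgm := (continuous_spaceGrad hζ1).aestronglyMeasurable (μ := volume)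
  set m := fun k => bumpSeq n k r hr
  have hVd : ∀ k, ContDiff ℝ 1 (mollify (m k) volume (K.indicator u)) := fun k =>
    contDiff_mollify (m k) hUl
  have hmU := tendsto_eLpNorm_mollify (μ := volume) (by norm_num) (by norm_num) hU
    (tendsto_bumpSeq_rOut (n := n) hr)
  have hmP := tendsto_eLpNorm_mollify (μ := volume) (by norm_num) (by norm_num) hP
    (tendsto_bumpSeq_rOut (n := n) hr)
  have hPm : ∀ k, AEStronglyMeasurable (mollify (m k) volume (K.indicator ux)) volume := fun k =>
    (contDiff_mollify (m k) (hP.locallyIntegrable (by norm_num))).continuous.aestronglyMeasurable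
  have hA : ∀ {F : Type} [NormedAddCommGroup F] [NormedSpace ℝ F] {f : Space n × ℝ → F},
      MemLp f 2 volume → MemLp (fun z => ζ z • f z) 2 volume := by
    intro F _ _ f hf
    refine MemLp.of_le_mul (c := C) hf (hζm.smul hf.1) (ae_of_all _ fun z => ?_)
    rw [norm_smul]; gcongr; exact hC z
  have hB : MemLp (fun z => K.indicator u z • spaceGrad ζ z) 2 volume := by
    refine MemLp.of_le_mul (c := C') hU (hU.1.smul hζgm) (ae_of_all _ fun z => ?_)
    rw [norm_smul, mul_comm]; gcongr; exact hC' z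
  refine IsSobolevLimit.of_tendsto
    (V := fun k z => ζ z * mollify (m k) volume (K.indicator u) z)
    (G := fun k => spaceGrad fun z => ζ z * mollify (m k) volume (K.indicator u) z)
    (fun k => .of_contDiff (hζ1.mul (hVd k)) hζc.mul_right) (hA hU) ((hA hP).add hB) ?_ ?_
  · exact tendsto_eLpNorm_smul (μ := volume) (p := 2) (by norm_num) (by norm_num)
      (g := fun _ => ζ) (g₀ := ζ) (C := C) (fun _ => hζm) (fun _ => hC)
      (ae_of_all _ fun z => tendsto_const_nhds)
      (fun k => (hVd k).continuous.aestronglyMeasurable) hU hmU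
  · have h1 := tendsto_eLpNorm_smul (μ := volume) (p := 2) (by norm_num) (by norm_num)
      (g := fun _ => ζ) (g₀ := ζ) (C := C) (fun _ => hζm) (fun _ => hC)
      (ae_of_all _ fun z => tendsto_const_nhds) hPm hP hmP
    have h2 : Tendsto (fun k => ENNReal.ofReal C' *
        eLpNorm (mollify (m k) volume (K.indicator u) - K.indicator u) 2 volume) atTop (𝓝 0) := by
      simpa using ENNReal.Tendsto.const_mul hmU (Or.inr ENNReal.ofReal_ne_top)
    have h3 := h1.add h2
    rw [add_zero] at h3
    refine tendsto_of_tendsto_of_tendsto_of_le_of_le tendsto_const_nhds h3 (fun _ => zero_le)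
      fun k => ?_
    have e : ((spaceGrad fun z => ζ z * mollify (m k) volume (K.indicator u) z) -
        fun z => ζ z • K.indicator ux z + K.indicator u z • spaceGrad ζ z) =
        (fun z => ζ z • mollify (m k) volume (K.indicator ux) z - ζ z • K.indicator ux z) +
        fun z => (mollify (m k) volume (K.indicator u) z - K.indicator u z) • spaceGrad ζ z := by
      ext1 z
      simp only [Pi.sub_apply, Pi.add_apply]
      rw [spaceGrad_mul (hζ1.differentiable one_ne_zero) ((hVd k).differentiable one_ne_zero)]
      by_cases hz : z ∈ tsupport ζ
      · rw [spaceGrad_mollify hΩ hu.2.2 hrQ hU hP (m k)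
          ((Metric.closedBall_subset_cthickening hz _).trans
            (Metric.cthickening_mono (bumpSeq_rOut_lt k hr).le _)), sub_smul]
        abel
      · rw [image_eq_zero_of_notMem_tsupport hz]
        simp [sub_smul]
    rw [e]
    refine (eLpNorm_add_le ((hζm.smul (hPm k)).sub (hζm.smul hP.1))
      (((hVd k).continuous.aestronglyMeasurable.sub hU.1).smul hζgm) (by norm_num)).trans ?_
    refine add_le_add le_rfl
      (eLpNorm_le_mul_eLpNorm_of_ae_le_mul (ae_of_all _ fun z => ?_) 2)
    simp only [Pi.smul_apply', norm_smul]
    rw [mul_comm]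
    gcongr
    exact hC' z

/-- A smooth cutoff function. -/
theorem exists_cutoff (hΩ : IsOpen Ω) {K : Set (Space n × ℝ)} (hK : IsCompact K)
    (hKQ : K ⊆ cylinder Ω T) : ∃ ζ : Space n × ℝ → ℝ, IsTestFunction Ω T ζ ∧
      (∀ z, 0 ≤ ζ z ∧ ζ z ≤ 1) ∧ ∃ V, IsOpen V ∧ K ⊆ V ∧ ∀ z ∈ V, ζ z = 1 := by
  have hQ := isOpen_cylinder (T := T) hΩ
  obtain ⟨K', hK', hKK', hK'Q⟩ := exists_compact_between hK hQ hKQ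
  obtain ⟨ζ, h1, h2, h3⟩ := exists_contMDiffMap_one_nhds_of_subset_interior (n := 1)
    (modelWithCornersSelf ℝ (Space n × ℝ)) hK.isClosed hKK'
  obtain ⟨V, hKV, hV, hV1⟩ := (eventually_nhdsSet_iff_exists.1 h1)
  have hs : tsupport ζ ⊆ K' := by
    refine closure_minimal (fun z hz => ?_) hK'.isClosed
    by_contra h
    exact hz (h2 z h)
  exact ⟨ζ, ⟨ζ.contMDiff.contDiff, hK'.of_isClosed_subset (isClosed_tsupport _) hs,
    hs.trans hK'Q⟩, fun z => h3 z, V, hKV, hV, hV1⟩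

end

/-! ### Square integrability of coefficients and of their products with the solution -/

section

variable {n : ℕ} {Ω : Set (Space n)} {T : ℝ}

/-- Subcritical coefficients are square integrable. -/
theorem IsSubcritical.memLp (hn : 1 ≤ n) {θ : ℝ} (hθ : 0 < θ) (hθ' : θ < 1) {κ : ℝ≥0∞}
    (hκ : κ ≠ ∞) (hΩv : volume Ω < ∞) {β : Space n × ℝ → ℝ} (hβ : IsSubcritical n θ Ω T κ β) :
    MemLp β 2 (volume.restrict (cylinder Ω T)) := by
  obtain ⟨R, C, gn⟩ := exists_isGagliardoNirenberg n hn θ hθ hθ'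
  obtain ⟨K, -, hKκ, hK⟩ := hβ.exists_kernel hn hθ hθ' gn
  refine memLp_of_lintegral_enorm_sq hβ.meas ?_
  rw [lintegral_cylinder (hβ.meas.enorm.pow_const 2)]
  calc ∫⁻ t in Ioo 0 T, ∫⁻ x in Ω, ‖β (x, t)‖ₑ ^ 2
      ≤ ∫⁻ t in Ioo 0 T, K t * (1 + volume Ω) := by
        refine lintegral_mono_ae ?_
        filter_upwards [hK] with t ht
        exact ht.1
    _ = (∫⁻ t in Ioo 0 T, K t) * (1 + volume Ω) := lintegral_mul_const' _ _ (by finiteness)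
    _ < ∞ := ENNReal.mul_lt_top (hKκ.trans_lt hκ.lt_top) (by finiteness)

/-- Products of subcritical coefficients with functions of the energy class are locally square
integrable. -/
theorem IsSubcritical.memLp_mul (hn : 1 ≤ n) {θ : ℝ} (hθ : 0 < θ) (hθ' : θ < 1) {κ : ℝ≥0∞}
    (hκ : κ ≠ ∞) (hΩ : IsOpen Ω) {β : Space n × ℝ → ℝ}
    (hβ : IsSubcritical n θ Ω T κ β) {u : Space n × ℝ → ℝ} {ux : Space n × ℝ → Space n}
    (hu : InEnergyClass Ω T u ux) {K : Set (Space n × ℝ)} (hK : IsCompact K)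
    (hKQ : K ⊆ cylinder Ω T) : MemLp (fun z => β z * u z) 2 (volume.restrict K) := by
  obtain ⟨R, C, gn⟩ := exists_isGagliardoNirenberg n hn θ hθ hθ'
  obtain ⟨k, hkm, hkκ, hk⟩ := hβ.exists_kernel hn hθ hθ' gn
  -- On `K` the function `ζ u` coincides with `u`, and it is a limit of test functions, so the
  -- linear slice estimate with `ε = 1` applies to it. Its masses are bounded by the local `L^{2,∞}`
  -- condition, its gradient is square integrable.
  obtain ⟨ζ, hζ, hζ01, V, -, hKV, hV1⟩ := exists_cutoff hΩ hK hKQ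
  set W : Space n × ℝ → ℝ := fun z => ζ z * u z with hW
  have hS := hu.isSobolevLimit_cutoff hΩ hζ
  set P := fun z => ζ z • ux z + u z • spaceGrad ζ z
  have hζ0 : ∀ z, z ∉ tsupport ζ → ζ z = 0 := fun z hz => image_eq_zero_of_notMem_tsupport hz
  have hW0 : ∀ x t, x ∉ Ω → W (x, t) = 0 := by
    intro x t hx
    rw [hW]
    simp only
    rw [hζ0 (x, t) fun h => hx (hζ.2.2 h).1, zero_mul]
  obtain ⟨M, hM, hMt⟩ := hu.1.exists_slice_bound hζ.2.1 hζ.2.2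
  have hyM : ∀ᵐ t ∂(volume.restrict (Ioo 0 T)), ∫⁻ x in Ω, ‖W (x, t)‖ₑ ^ 2 ≤ M := by
    filter_upwards [hMt] with t ht
    refine (lintegral_mono fun x => ?_).trans ht
    gcongr
    by_cases hz : (x, t) ∈ tsupport ζ
    · rw [indicator_of_mem hz, hW]
      simp only [enorm_mul]
      calc ‖ζ (x, t)‖ₑ * ‖u (x, t)‖ₑ ≤ 1 * ‖u (x, t)‖ₑ := by
            gcongr
            rw [Real.enorm_of_nonneg (hζ01 _).1]
            simpa using (hζ01 (x, t)).2
        _ = _ := one_mul _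
    · simp [hW, hζ0 _ hz]
  have hum : AEStronglyMeasurable u (volume.restrict (cylinder Ω T)) := hu.1.1
  have hmK : volume.restrict K ≤ volume.restrict (cylinder Ω T) := Measure.restrict_mono hKQ le_rfl
  refine memLp_of_lintegral_enorm_sq ((hβ.meas.mul hum).mono_measure hmK) ?_
  have hWm : AEStronglyMeasurable W volume := hS.memLp.1
  have hWm' := hWm.restrict (s := cylinder Ω T)
  have hWs := hWm'
  rw [restrict_cylinder] at hWs
  have hDm : AEMeasurable (fun t => ∫⁻ x, ‖P (x, t)‖ₑ ^ 2) (volume.restrict (Ioo 0 T)) :=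
    ((hS.memLp_grad.1.enorm.pow_const 2).lintegral_prod_left' (μ := volume)
      (ν := volume)).mono_measure Measure.restrict_le_self
  have hDfin : ∫⁻ t in Ioo 0 T, ∫⁻ x, ‖P (x, t)‖ₑ ^ 2 < ∞ := by
    refine (setLIntegral_le_lintegral _ _).trans_lt ?_
    rw [← lintegral_prod_symm (fun z => ‖P z‖ₑ ^ 2) (hS.memLp_grad.1.enorm.pow_const 2),
      ← Measure.volume_eq_prod, lintegral_enorm_sq_eq]
    exact ENNReal.pow_lt_top hS.memLp_grad.2
  calc ∫⁻ z in K, ‖β z * u z‖ₑ ^ 2 = ∫⁻ z in K, ‖β z‖ₑ ^ 2 * ‖W z‖ₑ ^ 2 := by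
        refine setLIntegral_congr_fun hK.measurableSet fun z hz => ?_
        simp only [hW, hV1 z (hKV hz), one_mul, enorm_mul, mul_pow]
    _ ≤ ∫⁻ z in cylinder Ω T, ‖β z‖ₑ ^ 2 * ‖W z‖ₑ ^ 2 := lintegral_mono' hmK le_rfl
    _ = ∫⁻ t in Ioo 0 T, ∫⁻ x in Ω, ‖β (x, t)‖ₑ ^ 2 * ‖W (x, t)‖ₑ ^ 2 :=
        lintegral_cylinder ((hβ.meas.enorm.pow_const 2).mul (hWm'.enorm.pow_const 2))
    _ ≤ ∫⁻ t in Ioo 0 T, ((∫⁻ x, ‖P (x, t)‖ₑ ^ 2) + absorbConst θ R C 1 * k t * M) := by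
        refine lintegral_mono_ae ?_
        filter_upwards [hk, ae_restrict_of_ae (hS.ae_sliceGN gn hW0 hΩ.measurableSet), hyM,
          aestronglyMeasurable_slice hWs] with t h1 h2 h3 h4
        have := (h1.2 _ h4.enorm _ h2).1 1 zero_lt_one le_rfl
        rw [ENNReal.coe_one, one_mul] at this
        exact this.trans (by gcongr)
    _ = (∫⁻ t in Ioo 0 T, ∫⁻ x, ‖P (x, t)‖ₑ ^ 2) +
          absorbConst θ R C 1 * (∫⁻ t in Ioo 0 T, k t) * M := by
        rw [lintegral_add_left' hDm, lintegral_mul_const' _ _ hM.ne,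
          lintegral_const_mul' _ _ ENNReal.coe_ne_top]
    _ < ∞ := by
        refine ENNReal.add_lt_top.2 ⟨hDfin, ENNReal.mul_lt_top (ENNReal.mul_lt_top
          ENNReal.coe_lt_top (hkκ.trans_lt hκ.lt_top)) hM⟩

end

section

variable {n : ℕ} {Ω : Set (Space n)} {T : ℝ}

/-! ### Composition with the nonlinearities -/

/-- The Lebesgue σ-algebra in `(x,t)` is what permits substituting functions that are only almost
everywhere measurable: they are measurable for it, hence so is the composite. -/
theorem MeasurableNonlinearity.aestronglyMeasurable {F : Type*} [TopologicalSpace F]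
    [TopologicalSpace.PseudoMetrizableSpace F] [SecondCountableTopology F]
    [MeasurableSpace F] [BorelSpace F] {Φ : Space n × ℝ → ℝ → Space n → F}
    (hΦ : MeasurableNonlinearity Ω T Φ) {u : Space n × ℝ → ℝ} {ux : Space n × ℝ → Space n}
    (hu : AEStronglyMeasurable u (volume.restrict (cylinder Ω T)))
    (hux : AEStronglyMeasurable ux (volume.restrict (cylinder Ω T))) :
    AEStronglyMeasurable (fun z => Φ z (u z) (ux z)) (volume.restrict (cylinder Ω T)) := by
  set μ := volume.restrict (cylinder Ω T) with hμ
  have h1 : Measurable (fun z : NullMeasurableSpace (Space n × ℝ) μ => u z) :=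
    hu.aemeasurable.nullMeasurable
  have h2 : Measurable (fun z : NullMeasurableSpace (Space n × ℝ) μ => ux z) :=
    hux.aemeasurable.nullMeasurable
  have h3 : Measurable (fun z : NullMeasurableSpace (Space n × ℝ) μ => Φ z (u z) (ux z)) :=
    hΦ.comp (measurable_id.prodMk (h1.prodMk h2))
  have h4 : NullMeasurable (fun z => Φ z (u z) (ux z)) μ := fun s hs => h3 hs
  exact h4.aemeasurable.aestronglyMeasurable

/-! ### Mixed norms of scaled and square-rooted coefficients -/

theorem mixedNorm_const_mul_le (p q : ℝ≥0∞) (r : ℝ) (w : Space n × ℝ → ℝ) :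
    mixedNorm Ω T p q (fun z => r * w z) ≤ ‖r‖ₑ * mixedNorm Ω T p q w := by
  unfold mixedNorm
  refine eLpNorm_le_nnreal_smul_eLpNorm_of_ae_le_mul' (c := ‖r‖₊) (ae_of_all _ fun t => ?_) q
  exact eLpNorm_const_smul_le (c := r) (f := fun x => w (x, t))

/-- Square roots double both exponents, and doubling turns the second kind of exponents into the
first. So `d` and `g` are treated through `√d` and `√g`, whose squares enter the slice estimates. -/
theorem mixedNorm_sqrt_sq (p q : ℝ≥0∞) (w : Space n × ℝ → ℝ) :
    mixedNorm Ω T (p * 2) (q * 2) (fun z => √|w z|) ^ 2 = mixedNorm Ω T p q w := by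
  unfold mixedNorm
  have h2 : (0 : ℝ) < 2 := two_pos
  have key : ∀ t, eLpNorm (fun x => √|w (x, t)|) (p * 2) (volume.restrict Ω) ^ (2 : ℝ) =
      eLpNorm (fun x => w (x, t)) p (volume.restrict Ω) := by
    intro t
    have := eLpNorm_enorm_rpow (p := p) (μ := volume.restrict Ω) (fun x => √|w (x, t)|) h2
    rw [ENNReal.ofReal_ofNat] at this
    rw [← this]
    refine eLpNorm_congr_enorm_ae (ae_of_all _ fun x => ?_)
    rw [enorm_eq_self, ENNReal.rpow_two, Real.enorm_of_nonneg (Real.sqrt_nonneg _),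
      ← ENNReal.ofReal_pow (Real.sqrt_nonneg _), Real.sq_sqrt (abs_nonneg _),
      Real.enorm_eq_ofReal_abs]
  have := eLpNorm_enorm_rpow (p := q) (μ := volume.restrict (Ioo 0 T))
    (fun t => eLpNorm (fun x => √|w (x, t)|) (p * 2) (volume.restrict Ω)) h2
  rw [ENNReal.ofReal_ofNat] at this
  rw [← ENNReal.rpow_two, ← this]
  simp only [enorm_eq_self, key]

theorem SecondExponents.double {θ : ℝ} {p q : ℝ≥0∞} (h : SecondExponents n θ p q) :
    FirstExponents n θ (p * 2) (q * 2) := by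
  obtain ⟨h1, h2⟩ := h
  constructor
  · have : ENNReal.ofReal (2 / (1 - θ)) = ENNReal.ofReal (1 / (1 - θ)) * 2 := by
      rw [← ENNReal.ofReal_ofNat, ← ENNReal.ofReal_mul' (by norm_num)]
      congr 1; ring
    rw [this]
    gcongr
  · have e1 : (n : ℝ≥0∞) / (2 * (p * 2)) = n / (2 * p) / 2 := by
      rw [← mul_assoc, div_eq_mul_inv, div_eq_mul_inv, div_eq_mul_inv,
        ENNReal.mul_inv (Or.inr (by simp)) (Or.inr (by simp)), mul_assoc]
    have e2 : 1 / (q * 2) = 1 / q / 2 := by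
      rw [div_eq_mul_inv, div_eq_mul_inv, div_eq_mul_inv,
        ENNReal.mul_inv (Or.inr (by simp)) (Or.inr (by simp)), mul_assoc]
    rw [e1, e2, ← ENNReal.add_div, ENNReal.ofReal_div_of_pos two_pos, ENNReal.ofReal_ofNat]
    gcongr

theorem Coeff.norm_nonneg (w : Coeff n) (Ω : Set (Space n)) (T : ℝ) : 0 ≤ w.norm Ω T :=
  ENNReal.toReal_nonneg

theorem Coeff.IsNonnegMem.mixedNorm_eq {w : Coeff n} (hw : w.IsNonnegMem Ω T) :
    mixedNorm Ω T w.p w.q w.fn = ENNReal.ofReal (w.norm Ω T) :=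
  (ENNReal.ofReal_toReal hw.1.2.ne).symm

/-- Multiples of coefficients with the first kind of exponents are subcritical. -/
theorem Coeff.IsNonnegMem.isSubcritical_const_mul {θ : ℝ} (hθ : 0 < θ) (hθ' : θ < 1) {T₀ N₀ r : ℝ}
    (hT₀ : T ≤ T₀) {w : Coeff n} (hw : w.IsNonnegMem Ω T) (hpq : FirstExponents n θ w.p w.q)
    (hN : |r| * w.norm Ω T ≤ N₀) :
    IsSubcritical n θ Ω T (subcriticalBound θ T₀ N₀) (fun z => r * w.fn z) := by
  have h := mixedNorm_const_mul_le (Ω := Ω) (T := T) w.p w.q r w.fn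
  rw [hw.mixedNorm_eq, Real.enorm_eq_ofReal_abs, ← ENNReal.ofReal_mul (abs_nonneg _)] at h
  exact isSubcritical_of_firstExponents hθ hθ' hT₀ hpq
    ⟨hw.1.1.const_mul r, h.trans_lt ENNReal.ofReal_lt_top⟩ (h.trans (ENNReal.ofReal_le_ofReal hN))

/-- Multiples of square roots of coefficients with the second kind of exponents are
subcritical. -/
theorem Coeff.IsNonnegMem.isSubcritical_sqrt {θ : ℝ} (hθ : 0 < θ) (hθ' : θ < 1) {T₀ N₀ r : ℝ}
    (hT₀ : T ≤ T₀) {w : Coeff n} (hw : w.IsNonnegMem Ω T) (hpq : SecondExponents n θ w.p w.q)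
    (hN₀ : 0 ≤ N₀) (hN : r ^ 2 * w.norm Ω T ≤ N₀ ^ 2) :
    IsSubcritical n θ Ω T (subcriticalBound θ T₀ N₀) (fun z => r * √|w.fn z|) := by
  have h := mixedNorm_const_mul_le (Ω := Ω) (T := T) (w.p * 2) (w.q * 2) r (fun z => √|w.fn z|)
  have h2 := mixedNorm_sqrt_sq (Ω := Ω) (T := T) w.p w.q w.fn
  have h3 : mixedNorm Ω T (w.p * 2) (w.q * 2) (fun z => r * √|w.fn z|) ≤ ENNReal.ofReal N₀ := by
    rw [← ENNReal.pow_le_pow_left_iff (n := 2) (by norm_num)]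
    calc _ ≤ (‖r‖ₑ * mixedNorm Ω T (w.p * 2) (w.q * 2) (fun z => √|w.fn z|)) ^ 2 := by gcongr
      _ = ENNReal.ofReal (r ^ 2 * w.norm Ω T) := by
        rw [mul_pow, h2, hw.mixedNorm_eq, Real.enorm_eq_ofReal_abs,
          ← ENNReal.ofReal_pow (abs_nonneg _), sq_abs, ← ENNReal.ofReal_mul (sq_nonneg _)]
      _ ≤ _ := by
        rw [← ENNReal.ofReal_pow hN₀]
        exact ENNReal.ofReal_le_ofReal hN
  exact isSubcritical_of_firstExponents hθ hθ' hT₀ hpq.double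
    ⟨((Real.continuous_sqrt.comp continuous_abs).comp_aestronglyMeasurable hw.1.1).const_mul r,
      h3.trans_lt ENNReal.ofReal_lt_top⟩ h3

/-! ### Local integrability of the terms of the equation -/

/-- Each of the terms `abar ‖ux‖`, `e |u|` and `h` is locally square integrable. The growth
condition on the flux is used here only, and qualitatively, so the final constant does not involve
`abar`, `e` or `h`. -/
theorem StructureInequalities.memLp_flux (hn : 1 ≤ n) {θ : ℝ} (hθ : 0 < θ) (hθ' : θ < 1)
    (hΩ : IsOpen Ω) (hΩv : volume Ω < ∞) {S : StructureData n} (hS : S.Admissible Ω T θ)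
    {A : Space n × ℝ → ℝ → Space n → Space n} {B : Space n × ℝ → ℝ → Space n → ℝ}
    (hA : MeasurableNonlinearity Ω T A) (hAB : StructureInequalities Ω T S A B)
    {u : Space n × ℝ → ℝ} {ux : Space n × ℝ → Space n} (hu : InEnergyClass Ω T u ux)
    {K : Set (Space n × ℝ)} (hK : IsCompact K) (hKQ : K ⊆ cylinder Ω T) :
    MemLp (fun z => A z (u z) (ux z)) 2 (volume.restrict K) := by
  have hmK : volume.restrict K ≤ volume.restrict (cylinder Ω T) := Measure.restrict_mono hKQ le_rfl
  have hux : MemLp ux 2 (volume.restrict K) := by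
    have := hu.2.1.memLp_two hΩ hK hKQ
    rwa [memLp_indicator_iff_restrict hK.measurableSet] at this
  have he : IsSubcritical n θ Ω T (subcriticalBound θ T (S.e.norm Ω T)) S.e.fn := by
    simpa using hS.e_mem.isSubcritical_const_mul hθ hθ' le_rfl hS.e_exp (r := 1)
      (N₀ := S.e.norm Ω T) (by simp)
  have hh : IsSubcritical n θ Ω T (subcriticalBound θ T (S.h.norm Ω T)) S.h.fn := by
    simpa using hS.h_mem.isSubcritical_const_mul hθ hθ' le_rfl hS.h_exp (r := 1)
      (N₀ := S.h.norm Ω T) (by simp)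
  have h1 := he.memLp_mul hn hθ hθ' (subcriticalBound_ne_top hθ) hΩ hu hK hKQ
  have h2 := (hh.memLp hn hθ hθ' (subcriticalBound_ne_top hθ) hΩv).mono_measure hmK
  refine (((hux.norm.const_mul S.abar).add h1.norm).add h2).of_le
    ((hA.aestronglyMeasurable hu.1.1 hu.2.1.1).mono_measure hmK) ?_
  filter_upwards [ae_mono hmK hAB, ae_mono hmK hS.e_mem.2] with z hz hz'
  refine (hz (u z) (ux z)).2.2.trans ((le_of_eq ?_).trans (le_abs_self _))
  simp [abs_of_nonneg hz']

/-- Each term of the bound is a product of two locally square integrable functions: `c` and `‖ux‖`,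
`√d` and `√d |u|`, `√g` and `√g`. In general the source is no better than locally integrable. -/
theorem StructureInequalities.integrableOn_source (hn : 1 ≤ n) {θ : ℝ} (hθ : 0 < θ) (hθ' : θ < 1)
    (hΩ : IsOpen Ω) (hΩv : volume Ω < ∞) {S : StructureData n} (hS : S.Admissible Ω T θ)
    {A : Space n × ℝ → ℝ → Space n → Space n} {B : Space n × ℝ → ℝ → Space n → ℝ}
    (hB : MeasurableNonlinearity Ω T B) (hAB : StructureInequalities Ω T S A B)
    {u : Space n × ℝ → ℝ} {ux : Space n × ℝ → Space n} (hu : InEnergyClass Ω T u ux)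
    {K : Set (Space n × ℝ)} (hK : IsCompact K) (hKQ : K ⊆ cylinder Ω T) :
    IntegrableOn (fun z => B z (u z) (ux z)) K := by
  have hmK : volume.restrict K ≤ volume.restrict (cylinder Ω T) := Measure.restrict_mono hKQ le_rfl
  have hux : MemLp ux 2 (volume.restrict K) := by
    have := hu.2.1.memLp_two hΩ hK hKQ
    rwa [memLp_indicator_iff_restrict hK.measurableSet] at this
  have hc : IsSubcritical n θ Ω T (subcriticalBound θ T (S.c.norm Ω T)) S.c.fn := by
    simpa using hS.c_mem.isSubcritical_const_mul hθ hθ' le_rfl hS.c_exp (r := 1)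
      (N₀ := S.c.norm Ω T) (by simp)
  have hroot : ∀ {w : Coeff n}, w.IsNonnegMem Ω T → SecondExponents n θ w.p w.q →
      IsSubcritical n θ Ω T (subcriticalBound θ T √(w.norm Ω T)) (fun z => √|w.fn z|) := by
    intro w hw hpq
    simpa using hw.isSubcritical_sqrt hθ hθ' le_rfl hpq (r := 1) (N₀ := √(w.norm Ω T))
      (Real.sqrt_nonneg _) (by rw [Real.sq_sqrt (w.norm_nonneg Ω T)]; simp)
  have hd := hroot hS.d_mem hS.d_exp
  have hg := hroot hS.g_mem hS.g_exp
  have hκ : ∀ N, subcriticalBound θ T N ≠ ∞ := fun N => subcriticalBound_ne_top hθ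
  have h1 := (hc.memLp hn hθ hθ' (hκ _) hΩv).mono_measure hmK
  have h2 := (hd.memLp hn hθ hθ' (hκ _) hΩv).mono_measure hmK
  have h3 := hd.memLp_mul hn hθ hθ' (hκ _) hΩ hu hK hKQ
  have h4 := (hg.memLp hn hθ hθ' (hκ _) hΩv).mono_measure hmK
  refine Integrable.mono' (((h1.integrable_mul hux.norm).add (h2.integrable_mul h3.norm)).add
    (h4.integrable_mul h4))
    ((hB.aestronglyMeasurable hu.1.1 hu.2.1.1).mono_measure hmK) ?_
  filter_upwards [ae_mono hmK hAB, ae_mono hmK hS.d_mem.2, ae_mono hmK hS.g_mem.2] with z hz hd hg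
  refine (hz (u z) (ux z)).2.1.trans (le_of_eq ?_)
  simp only [Pi.add_apply, Pi.mul_apply, Real.norm_eq_abs, abs_mul, abs_of_nonneg hd,
    abs_of_nonneg hg, abs_of_nonneg (Real.sqrt_nonneg _), ← mul_assoc, Real.mul_self_sqrt hd,
    Real.mul_self_sqrt hg]

end

section

/-! ### Convergence of integrals of products -/

theorem tendsto_integral_inner {α F : Type*} [MeasurableSpace α] {μ : Measure α}
    [NormedAddCommGroup F] [InnerProductSpace ℝ F] {f g : ℕ → α → F} {f₀ g₀ : α → F}
    (hf : ∀ k, MemLp (f k) 2 μ) (hf₀ : MemLp f₀ 2 μ) (hg : ∀ k, MemLp (g k) 2 μ)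
    (hg₀ : MemLp g₀ 2 μ) (hft : Tendsto (fun k => eLpNorm (f k - f₀) 2 μ) atTop (𝓝 0))
    (hgt : Tendsto (fun k => eLpNorm (g k - g₀) 2 μ) atTop (𝓝 0)) :
    Tendsto (fun k => ∫ x, inner ℝ (f k x) (g k x) ∂μ) atTop (𝓝 (∫ x, inner ℝ (f₀ x) (g₀ x) ∂μ)) := by
  have h1 := (Lp.tendsto_Lp_iff_tendsto_eLpNorm'' f hf f₀ hf₀).2 hft
  have h2 := (Lp.tendsto_Lp_iff_tendsto_eLpNorm'' g hg g₀ hg₀).2 hgt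
  have key : ∀ {a b : α → F} (ha : MemLp a 2 μ) (hb : MemLp b 2 μ),
      inner ℝ (ha.toLp a) (hb.toLp b) = ∫ x, inner ℝ (a x) (b x) ∂μ := by
    intro a b ha hb
    rw [L2.inner_def]
    refine integral_congr_ae ?_
    filter_upwards [ha.coeFn_toLp, hb.coeFn_toLp] with x hx hx'
    rw [hx, hx']
  have h3 := h1.inner (𝕜 := ℝ) h2
  simpa only [key] using h3

theorem integrable_inner_of_hasCompactSupport {E F : Type*} [NormedAddCommGroup E]
    [MeasurableSpace E] [OpensMeasurableSpace E] [NormedAddCommGroup F] [InnerProductSpace ℝ F]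
    [SecondCountableTopologyEither E F] {μ : Measure E} {f g : E → F}
    (hf : Integrable f μ) (hg : Continuous g)
    (hgc : HasCompactSupport g) : Integrable (fun z => inner ℝ (g z) (f z)) μ := by
  have h := hf.norm.locallyIntegrable.integrable_smul_left_of_hasCompactSupport hg.norm hgc.norm
  exact h.mono' (hg.aestronglyMeasurable.inner hf.1) (ae_of_all _ fun z => norm_inner_le_norm _ _)

/-! ### Testing the equation with truncations of the solution -/

variable {n : ℕ} {Ω : Set (Space n)} {T : ℝ}

/-- The truncated and mollified test function in the weak formulation. -/
theorem renormalized_mollify (hΩ : IsOpen Ω) {u : Space n × ℝ → ℝ} {ux X : Space n × ℝ → Space n}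
    {Y : Space n × ℝ → ℝ} (hu : IsGenGrad Ω T u ux)
    (hweak : ∀ φ : Space n × ℝ → ℝ, IsTestFunction Ω T φ → (∀ z, 0 ≤ φ z) →
      ∫ z in cylinder Ω T, (-(u z * timeDeriv φ z) + inner ℝ (spaceGrad φ z) (X z))
        ≤ ∫ z in cylinder Ω T, φ z * Y z)
    {ξ : Space n × ℝ → ℝ} (hξ : ContDiff ℝ 1 ξ) (hξc : HasCompactSupport ξ) (hξ0 : ∀ z, 0 ≤ ξ z)
    (l : ℝ) (N : ℕ) {r : ℝ} {K : Set (Space n × ℝ)} (hK : K = Metric.cthickening r (tsupport ξ))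
    (hKQ : K ⊆ cylinder Ω T) (hU : MemLp (K.indicator u) 2 volume)
    (hP : MemLp (K.indicator ux) 2 volume) (hX : Integrable (K.indicator X) volume)
    (hY : Integrable (K.indicator Y) volume)
    (φ : ContDiffBump (0 : Space n × ℝ)) (hφ : φ.rOut ≤ r) :
    (∫ z, inner ℝ (ramp₁ l N (mollify φ volume (K.indicator u) z) • spaceGrad ξ z +
        (ξ z * ramp l N (mollify φ volume (K.indicator u) z)) •
          mollify φ volume (K.indicator ux) z) (mollify φ volume (K.indicator X) z)) ≤
      (∫ z, fderiv ℝ ξ z (0, 1) * ramp₂ l N (mollify φ volume (K.indicator u) z)) +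
        ∫ z, (ξ z * ramp₁ l N (mollify φ volume (K.indicator u) z)) *
          mollify φ volume (K.indicator Y) z := by
  have hKc : IsCompact K := hK ▸ IsCompact.cthickening hξc
  have hUl : LocallyIntegrable (K.indicator u) volume := hU.locallyIntegrable (by norm_num)
  have hU1 : Integrable (K.indicator u) volume := by
    have := hUl.integrableOn_isCompact hKc
    rw [← integrable_indicator_iff hKc.measurableSet] at this
    rwa [indicator_indicator, inter_self] at this
  set v := mollify φ volume (K.indicator u) with hv
  have hv1 : ContDiff ℝ 1 v := contDiff_mollify φ hUl
  have hvd := hv1.differentiable one_ne_zero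
  have hξd := hξ.differentiable one_ne_zero
  set ψ : Space n × ℝ → ℝ := fun z => ξ z * ramp₁ l N (v z) with hψdef
  have hH : ContDiff ℝ 1 fun z => ramp₁ l N (v z) := (contDiff_ramp₁ l N).comp hv1
  have hψ : ContDiff ℝ 1 ψ := hξ.mul hH
  have hψc : HasCompactSupport ψ := hξc.mul_right
  have hψs : tsupport ψ ⊆ tsupport ξ := tsupport_mul_subset_left
  -- `ψ` is built from the mollified `v` and is then mollified again. By the symmetry of
  -- mollification, pairing `w` with `u`, `X`, `Y` amounts to pairing `ψ` with their mollifications,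
  -- so that the smooth `v` takes the place of `u`, which has no time derivative.
  set w := mollify φ volume ψ with hw
  have hw1 : ContDiff ℝ 1 w := contDiff_mollify φ hψ.continuous.locallyIntegrable
  have hwc : HasCompactSupport w := hasCompactSupport_mollify φ hψc
  have hwd := hw1.differentiable one_ne_zero
  have hwK : tsupport w ⊆ K := by
    refine (tsupport_mollify_subset φ ψ).trans ?_
    rw [hK]
    exact (Metric.cthickening_mono hφ _).trans (Metric.cthickening_subset_of_subset _ hψs)
  have hw0 : ∀ z, 0 ≤ w z := fun z => by
    rw [hw, mollify_apply]
    exact integral_nonneg fun t => smul_nonneg (φ.nonneg_normed t)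
      (mul_nonneg (hξ0 _) (ramp₁_nonneg _ _ _))
  have hfw : ∀ z, fderiv ℝ w z = mollify φ volume (fderiv ℝ ψ) z :=
    fun z => fderiv_mollify φ hψ hψc z
  have hfψ : Continuous (fderiv ℝ ψ) := hψ.continuous_fderiv one_ne_zero
  have hfψc : HasCompactSupport (fderiv ℝ ψ) := hψc.fderiv ℝ
  have hoff : ∀ z ∉ K, w z = 0 ∧ fderiv ℝ w z = 0 ∧ spaceGrad w z = 0 := fun z hz =>
    ⟨image_eq_zero_of_notMem_tsupport fun h => hz (hwK h),
      fderiv_of_notMem_tsupport ℝ fun h => hz (hwK h),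
      by by_contra h; exact hz (hwK (support_spaceGrad_subset hw1 h))⟩
  -- the source term
  have hR : ∫ z in cylinder Ω T, w z * Y z = ∫ z, ψ z * mollify φ volume (K.indicator Y) z := by
    have e := integral_mollify_left (ContinuousLinearMap.mul ℝ ℝ) φ hψ.continuous hψc hY
    simp only [ContinuousLinearMap.mul_apply'] at e
    rw [← e, ← setIntegral_eq_integral_of_forall_compl_eq_zero (s := cylinder Ω T)
      (f := fun z => w z * K.indicator Y z)
      (fun z hz => by rw [(hoff z fun h => hz (hKQ h)).1, zero_mul])]
    refine setIntegral_congr_fun (isOpen_cylinder hΩ).measurableSet fun z _ => ?_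
    by_cases hz : z ∈ K
    · simp [hz]
    · simp [(hoff z hz).1]
  -- the left-hand side
  have hL : ∫ z in cylinder Ω T, (-(u z * timeDeriv w z) + inner ℝ (spaceGrad w z) (X z)) =
      ∫ z, (-(fderiv ℝ w z (0, 1) * K.indicator u z) +
        inner ℝ (spaceGrad w z) (K.indicator X z)) := by
    rw [← setIntegral_eq_integral_of_forall_compl_eq_zero (s := cylinder Ω T)
      (f := fun z => -(fderiv ℝ w z (0, 1) * K.indicator u z) +
        inner ℝ (spaceGrad w z) (K.indicator X z))
      (fun z hz => by
        have := hoff z fun h => hz (hKQ h)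
        rw [this.2.1, this.2.2]; simp)]
    refine setIntegral_congr_fun (isOpen_cylinder hΩ).measurableSet fun z _ => ?_
    simp only [timeDeriv_eq hwd]
    by_cases hz : z ∈ K
    · simp [hz, mul_comm]
    · simp [(hoff z hz).2.1, (hoff z hz).2.2]
  have hdw : Continuous fun z => fderiv ℝ w z (0, 1) :=
    (hw1.continuous_fderiv one_ne_zero).clm_apply continuous_const
  have hdwc : HasCompactSupport fun z => fderiv ℝ w z (0, 1) :=
    HasCompactSupport.of_support_subset_isCompact hKc fun z hz => by
      by_contra h; exact hz (by simp [(hoff z h).2.1])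
  have hsplit : ∫ z, (-(fderiv ℝ w z (0, 1) * K.indicator u z) +
        inner ℝ (spaceGrad w z) (K.indicator X z)) =
      -(∫ z, fderiv ℝ w z (0, 1) * K.indicator u z) +
        ∫ z, inner ℝ (spaceGrad w z) (K.indicator X z) := by
    have i1 : Integrable (fun z => fderiv ℝ w z (0, 1) * K.indicator u z) volume :=
      hUl.integrable_smul_left_of_hasCompactSupport hdw hdwc
    have i2 := integrable_inner_of_hasCompactSupport hX
      (continuous_spaceGrad hw1) (hasCompactSupport_spaceGrad hw1 hwc)
    rw [← integral_neg]
    exact integral_add i1.neg i2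
  -- the time term
  have hcs : ∀ {f g : Space n × ℝ → ℝ}, Continuous f → HasCompactSupport f → Continuous g →
      Integrable (fun z => f z * g z) volume := fun hf hfc hg =>
    (hf.mul hg).integrable_of_hasCompactSupport hfc.mul_right
  have hdc : ∀ {f : Space n × ℝ → ℝ}, ContDiff ℝ 1 f →
      Continuous fun z => fderiv ℝ f z (0, 1) := fun hf =>
    (hf.continuous_fderiv one_ne_zero).clm_apply continuous_const
  have hdcs : ∀ {f : Space n × ℝ → ℝ}, HasCompactSupport f →
      HasCompactSupport fun z => fderiv ℝ f z (0, 1) := fun hf =>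
    (hf.fderiv ℝ).comp_left (g := fun L : (Space n × ℝ) →L[ℝ] ℝ => L (0, 1)) (by simp)
  have hG : ContDiff ℝ 1 fun z => ramp₂ l N (v z) := by
    have : ContDiff ℝ 1 (ramp₂ l N) := by
      rw [contDiff_one_iff_deriv]
      refine ⟨fun s => (hasDerivAt_ramp₂ l N s).differentiableAt, ?_⟩
      rw [funext fun s => (hasDerivAt_ramp₂ l N s).deriv]
      exact continuous_ramp₁ l N
    exact this.comp hv1
  have hGd : ∀ z, fderiv ℝ (fun z => ramp₂ l N (v z)) z (0, 1) =
      ramp₁ l N (v z) * fderiv ℝ v z (0, 1) := by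
    intro z
    have := ((hasDerivAt_ramp₂ l N (v z)).comp_hasFDerivAt z (hvd z).hasFDerivAt).fderiv
    simp only [Function.comp_def] at this
    rw [this]; simp
  -- Since `ramp₁` is the derivative of `ramp₂`, the product `ψ ∂ₜv` equals `ξ ∂ₜ(ramp₂ v)`. One
  -- integration by parts brings the derivative onto `v`, a second one puts it on `ξ`.
  have hT : ∫ z, fderiv ℝ w z (0, 1) * K.indicator u z =
      ∫ z, fderiv ℝ ξ z (0, 1) * ramp₂ l N (v z) := by
    have e1 := integral_mollify_left ((ContinuousLinearMap.mul ℝ ℝ).comp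
      (ContinuousLinearMap.apply ℝ ℝ ((0, 1) : Space n × ℝ))) φ hfψ hfψc hU1
    simp only [ContinuousLinearMap.comp_apply, ContinuousLinearMap.mul_apply',
      ContinuousLinearMap.apply_apply, ← hfw] at e1
    rw [e1]
    have e2 := integral_mul_fderiv_eq_neg_fderiv_mul_of_integrable (μ := volume) (f := ψ) (g := v)
      (v := ((0, 1) : Space n × ℝ)) (hcs (hdc hψ) (hdcs hψc) hv1.continuous)
      (hcs hψ.continuous hψc (hdc hv1)) (hcs hψ.continuous hψc hv1.continuous)
      (fun z _ => hψ.differentiable one_ne_zero z) (fun z _ => hvd z)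
    have e3 := integral_mul_fderiv_eq_neg_fderiv_mul_of_integrable (μ := volume) (f := ξ)
      (g := fun z => ramp₂ l N (v z))
      (v := ((0, 1) : Space n × ℝ)) (hcs (hdc hξ) (hdcs hξc) hG.continuous)
      (hcs hξ.continuous hξc (hdc hG)) (hcs hξ.continuous hξc hG.continuous)
      (fun z _ => hξd z) (fun z _ => hG.differentiable one_ne_zero z)
    have e4 : ∫ z, ψ z * fderiv ℝ v z (0, 1) =
        ∫ z, ξ z * fderiv ℝ (fun z => ramp₂ l N (v z)) z (0, 1) := by
      simp only [hGd, hψdef, mul_assoc]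
    linarith
  -- the flux term
  have hS : ∫ z, inner ℝ (spaceGrad w z) (K.indicator X z) =
      ∫ z, inner ℝ (ramp₁ l N (v z) • spaceGrad ξ z + (ξ z * ramp l N (v z)) •
        mollify φ volume (K.indicator ux) z) (mollify φ volume (K.indicator X) z) := by
    have e1 := integral_mollify_left ((ContinuousLinearMap.compL ℝ (Space n) (Space n × ℝ) ℝ).flip
      (ContinuousLinearMap.inl ℝ (Space n) ℝ)) φ hfψ hfψc hX
    simp only [ContinuousLinearMap.flip_apply, ContinuousLinearMap.compL_apply,
      ContinuousLinearMap.comp_apply, ContinuousLinearMap.inl_apply, ← hfw] at e1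
    simp only [inner_spaceGrad hwd]
    rw [e1]
    refine integral_congr_ae (ae_of_all _ fun z => ?_)
    simp only
    rw [← inner_spaceGrad (hψ.differentiable one_ne_zero)]
    congr 1
    rw [hψdef, spaceGrad_mul hξd (hH.differentiable one_ne_zero), add_comm]
    congr 1
    have := spaceGrad_comp (H := ramp₁ l N)
      (fun s => (hasDerivAt_ramp₁ l N s).differentiableAt) hvd z
    simp only [Function.comp_def] at this
    rw [this, (hasDerivAt_ramp₁ l N _).deriv, smul_smul]
    -- The gradient of `v` is known to be the mollified gradient only where small balls stay inside
    -- `K`; elsewhere `ξ` annihilates the term.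
    by_cases hz : z ∈ tsupport ξ
    · rw [hv, spaceGrad_mollify hΩ hu hKQ hU hP φ]
      rw [hK]
      exact (Metric.closedBall_subset_cthickening hz _).trans (Metric.cthickening_mono hφ _)
    · simp [image_eq_zero_of_notMem_tsupport hz]
  have := hweak w ⟨hw1, hwc, hwK.trans hKQ⟩ hw0
  rw [hL, hsplit, hT, hS, hR] at this
  linarith

/-- The weak formulation for truncations: a renormalized form of the equation. -/
theorem renormalized (hΩ : IsOpen Ω) {u : Space n × ℝ → ℝ} {ux X : Space n × ℝ → Space n}
    {Y : Space n × ℝ → ℝ} (hu : InEnergyClass Ω T u ux)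
    (hX : ∀ K, IsCompact K → K ⊆ cylinder Ω T → MemLp X 2 (volume.restrict K))
    (hY : ∀ K, IsCompact K → K ⊆ cylinder Ω T → IntegrableOn Y K)
    (hweak : ∀ φ : Space n × ℝ → ℝ, IsTestFunction Ω T φ → (∀ z, 0 ≤ φ z) →
      ∫ z in cylinder Ω T, (-(u z * timeDeriv φ z) + inner ℝ (spaceGrad φ z) (X z))
        ≤ ∫ z in cylinder Ω T, φ z * Y z)
    {ξ : Space n × ℝ → ℝ} (hξ : IsTestFunction Ω T ξ) (hξ0 : ∀ z, 0 ≤ ξ z) (l : ℝ) (N : ℕ) :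
    IntegrableOn (fun z => ramp₁ l N (u z) * inner ℝ (spaceGrad ξ z) (X z) +
        ξ z * ramp l N (u z) * inner ℝ (ux z) (X z) - ξ z * ramp₁ l N (u z) * Y z)
        (cylinder Ω T) ∧
      IntegrableOn (fun z => timeDeriv ξ z * ramp₂ l N (u z)) (cylinder Ω T) ∧
      ∫ z in cylinder Ω T, (ramp₁ l N (u z) * inner ℝ (spaceGrad ξ z) (X z) +
        ξ z * ramp l N (u z) * inner ℝ (ux z) (X z) - ξ z * ramp₁ l N (u z) * Y z) ≤
      ∫ z in cylinder Ω T, timeDeriv ξ z * ramp₂ l N (u z) := by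
  obtain ⟨hξ1, hξc, hξQ⟩ := hξ
  obtain ⟨r, hr, hrQ⟩ := IsCompact.exists_cthickening_subset_open hξc
    (isOpen_cylinder (T := T) hΩ) hξQ
  set K := Metric.cthickening r (tsupport ξ) with hK
  have hKc : IsCompact K := IsCompact.cthickening hξc
  have hξK : tsupport ξ ⊆ K := Metric.self_subset_cthickening _
  have hU : MemLp (K.indicator u) 2 volume := hu.1.memLp_two_of_top hΩ hKc hrQ
  have hP : MemLp (K.indicator ux) 2 volume := hu.2.1.memLp_two hΩ hKc hrQ
  have hX2 : MemLp (K.indicator X) 2 volume :=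
    (memLp_indicator_iff_restrict hKc.measurableSet).2 (hX K hKc hrQ)
  have hvol : IsFiniteMeasure (volume.restrict K) := ⟨by simpa using hKc.measure_lt_top⟩
  have hX1 : Integrable (K.indicator X) volume :=
    (integrable_indicator_iff hKc.measurableSet).2 ((hX K hKc hrQ).integrable (by norm_num))
  have hU1 : Integrable (K.indicator u) volume :=
    (integrable_indicator_iff hKc.measurableSet).2
      (((memLp_indicator_iff_restrict hKc.measurableSet).1 hU).integrable (by norm_num))
  have hY1 : Integrable (K.indicator Y) volume :=
    (integrable_indicator_iff hKc.measurableSet).2 (hY K hKc hrQ)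
  obtain ⟨C, hC⟩ := hξc.exists_bound_of_continuous hξ1.continuous
  set m := fun k => bumpSeq n k r hr
  have hm0 : Tendsto (fun k => (m k).rOut) atTop (𝓝 0) := tendsto_bumpSeq_rOut hr
  have hmain := fun k => renormalized_mollify hΩ hu.2.2 hweak hξ1 hξc hξ0 l N hK hrQ hU hP hX1 hY1
    (m k) (bumpSeq_rOut_lt k hr).le
  set v := fun k => mollify (m k) volume (K.indicator u) with hv
  have hvc : ∀ k, Continuous (v k) := fun k =>
    (contDiff_mollify (m k) hU1.locallyIntegrable).continuous
  have hvt : ∀ᵐ z, Tendsto (fun k => v k z) atTop (𝓝 (K.indicator u z)) :=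
    ae_tendsto_mollify_bumpSeq hr hU1.locallyIntegrable
  have hL2 : ∀ {F : Type} [NormedAddCommGroup F] [NormedSpace ℝ F] {g : Space n × ℝ → ℝ}
      {f : Space n × ℝ → F} {C : ℝ}, AEStronglyMeasurable g volume → (∀ z, ‖g z‖ ≤ C) →
      MemLp f 2 volume → MemLp (fun z => g z • f z) 2 volume := by
    intro F _ _ g f C hg hgC hf
    refine MemLp.of_le_mul (c := C) hf (hg.smul hf.1) (ae_of_all _ fun z => ?_)
    rw [norm_smul]; gcongr; exact hgC z
  have hr1 : ∀ s, ‖ramp₁ l N s‖ ≤ max (N - l) 0 := fun s => by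
    rw [Real.norm_of_nonneg (ramp₁_nonneg _ _ _)]; exact ramp₁_le_const l N s
  have hr0 : ∀ s, ‖ramp l N s‖ ≤ 1 := fun s => by
    rw [Real.norm_of_nonneg (ramp_nonneg _ _ _)]; exact ramp_le_one l N s
  have hξr : ∀ z s, ‖ξ z * ramp l N s‖ ≤ C := fun z s => by
    rw [norm_mul]
    exact (mul_le_of_le_one_right (norm_nonneg _) (hr0 s)).trans (hC z)
  have hξr1 : ∀ z s, ‖ξ z * ramp₁ l N s‖ ≤ C * max (N - l) 0 := fun z s => by
    rw [norm_mul]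
    exact mul_le_mul (hC z) (hr1 s) (norm_nonneg _) ((norm_nonneg _).trans (hC z))
  have hgξ2 : MemLp (spaceGrad ξ) 2 volume := (continuous_spaceGrad hξ1).memLp_of_hasCompactSupport
    (hasCompactSupport_spaceGrad hξ1 hξc)
  have hPk : ∀ k, MemLp (mollify (m k) volume (K.indicator ux)) 2 volume := fun k =>
    (contDiff_mollify (m k) (hP.locallyIntegrable (by norm_num))).continuous.memLp_of_hasCompactSupport
      (hasCompactSupport_mollify _ (HasCompactSupport.of_support_subset_isCompact hKc
        support_indicator_subset))
  have hXk : ∀ k, MemLp (mollify (m k) volume (K.indicator X)) 2 volume := fun k =>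
    (contDiff_mollify (m k) hX1.locallyIntegrable).continuous.memLp_of_hasCompactSupport
      (hasCompactSupport_mollify _ (HasCompactSupport.of_support_subset_isCompact hKc
        support_indicator_subset))
  have hYk : ∀ k, Integrable (mollify (m k) volume (K.indicator Y)) volume := fun k =>
    (contDiff_mollify (m k)
      hY1.locallyIntegrable).continuous.integrable_of_hasCompactSupport
      (hasCompactSupport_mollify _ (HasCompactSupport.of_support_subset_isCompact hKc
        support_indicator_subset))
  have hc0 := (continuous_ramp l N)
  have hc1 := (continuous_ramp₁ l N)
  have hc2 := (continuous_ramp₂ l N)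
  have hUm := hU.1
  have hξm := hξ1.continuous.aestronglyMeasurable (μ := volume)
  -- the flux term
  have hA1 : MemLp (fun z => ramp₁ l N (K.indicator u z) • spaceGrad ξ z) 2 volume :=
    hL2 (hc1.comp_aestronglyMeasurable hUm) (fun z => hr1 _) hgξ2
  have hA2 : MemLp (fun z => (ξ z * ramp l N (K.indicator u z)) • K.indicator ux z) 2 volume :=
    hL2 (hξm.mul (hc0.comp_aestronglyMeasurable hUm)) (fun z => hξr z _) hP
  have t1 := tendsto_eLpNorm_smul (μ := volume) (p := 2) (by norm_num) (by norm_num)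
    (g := fun k z => ramp₁ l N (v k z)) (g₀ := fun z => ramp₁ l N (K.indicator u z))
    (f := fun _ => spaceGrad ξ) (fun k => (hc1.comp (hvc k)).aestronglyMeasurable)
    (fun k z => hr1 _) (hvt.mono fun z hz => (hc1.tendsto _).comp hz)
    (fun _ => hgξ2.1) hgξ2 (by simp)
  have t2 := tendsto_eLpNorm_smul (μ := volume) (p := 2) (by norm_num) (by norm_num)
    (g := fun k z => ξ z * ramp l N (v k z)) (g₀ := fun z => ξ z * ramp l N (K.indicator u z))
    (fun k => (hξ1.continuous.mul (hc0.comp (hvc k))).aestronglyMeasurable)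
    (fun k z => hξr z _) (hvt.mono fun z hz => ((hc0.tendsto _).comp hz).const_mul _)
    (fun k => (hPk k).1) hP (tendsto_eLpNorm_mollify (by norm_num) (by norm_num) hP hm0)
  have hAk1 : ∀ k, MemLp (fun z => ramp₁ l N (v k z) • spaceGrad ξ z) 2 volume := fun k =>
    hL2 (hc1.comp (hvc k)).aestronglyMeasurable (fun z => hr1 _) hgξ2
  have hAk2 : ∀ k, MemLp (fun z => (ξ z * ramp l N (v k z)) •
      mollify (m k) volume (K.indicator ux) z) 2 volume := fun k =>
    hL2 (hξ1.continuous.mul (hc0.comp (hvc k))).aestronglyMeasurable (fun z => hξr z _) (hPk k)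
  have tS := tendsto_integral_inner (fun k => (hAk1 k).add (hAk2 k)) (hA1.add hA2) hXk hX2 (by
      have h3 := t1.add t2
      rw [add_zero] at h3
      refine tendsto_of_tendsto_of_tendsto_of_le_of_le tendsto_const_nhds h3 (fun _ => zero_le)
        fun k => ?_
      refine le_trans (le_of_eq ?_) (eLpNorm_add_le ((hAk1 k).1.sub hA1.1) ((hAk2 k).1.sub hA2.1)
        (by norm_num))
      congr 1
      ext1 z
      simp only [Pi.sub_apply, Pi.add_apply]
      abel) (tendsto_eLpNorm_mollify (by norm_num) (by norm_num) hX2 hm0)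
  -- the source term
  have hB : Integrable (fun z => (ξ z * ramp₁ l N (K.indicator u z)) * K.indicator Y z) volume :=
    hY1.bdd_mul (hξm.mul (hc1.comp_aestronglyMeasurable hUm)) (ae_of_all _ fun z => hξr1 z _)
  -- The mollified source converges only in `L¹`. The other factor is uniformly bounded, thanks to
  -- `ramp₁_le_const`, and converges almost everywhere.
  have tR := tendsto_integral_of_L1' (μ := volume)
    (F := fun k z => (ξ z * ramp₁ l N (v k z)) * mollify (m k) volume (K.indicator Y) z)
    (fun z => (ξ z * ramp₁ l N (K.indicator u z)) * K.indicator Y z) hB.1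
    (Eventually.of_forall fun k => (hYk k).bdd_mul
      (hξ1.continuous.mul (hc1.comp (hvc k))).aestronglyMeasurable (ae_of_all _ fun z => hξr1 z _))
    (tendsto_eLpNorm_smul (μ := volume) (p := 1) le_rfl (by norm_num)
      (g := fun k z => ξ z * ramp₁ l N (v k z)) (g₀ := fun z => ξ z * ramp₁ l N (K.indicator u z))
      (fun k => (hξ1.continuous.mul (hc1.comp (hvc k))).aestronglyMeasurable)
      (fun k z => hξr1 z _) (hvt.mono fun z hz => ((hc1.tendsto _).comp hz).const_mul _)
      (fun k => (hYk k).1) (memLp_one_iff_integrable.2 hY1)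
      (tendsto_eLpNorm_mollify le_rfl (by norm_num) (memLp_one_iff_integrable.2 hY1) hm0))
  -- the time term
  have hdξ : Continuous fun z => fderiv ℝ ξ z (0, 1) :=
    (hξ1.continuous_fderiv one_ne_zero).clm_apply continuous_const
  have hdξc : HasCompactSupport fun z => fderiv ℝ ξ z (0, 1) :=
    (hξc.fderiv ℝ).comp_left (g := fun L : (Space n × ℝ) →L[ℝ] ℝ => L (0, 1)) (by simp)
  obtain ⟨C', hC'⟩ := hdξc.exists_bound_of_continuous hdξ
  have hC'0 : 0 ≤ C' := (norm_nonneg _).trans (hC' 0)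
  -- As `ramp₁` is bounded, `ramp₂` is Lipschitz, and convergence of the mollifications of `u` in
  -- `L¹` is enough for the time term.
  have hlip : ∀ s t, |ramp₂ l N s - ramp₂ l N t| ≤ max (N - l) 0 * |s - t| := by
    intro s t
    have := Convex.norm_image_sub_le_of_norm_hasDerivWithin_le (f := ramp₂ l N) (s := univ)
      (x := t) (y := s) (fun x _ => (hasDerivAt_ramp₂ l N x).hasDerivWithinAt) (fun x _ => hr1 x)
      convex_univ (mem_univ _) (mem_univ _)
    simpa using this
  have hT0 : Integrable (fun z => fderiv ℝ ξ z (0, 1) * ramp₂ l N (K.indicator u z)) volume := by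
    have i1 : Integrable (fun z => C' * (max (N - l) 0 * |K.indicator u z|)) volume :=
      (hU1.norm.const_mul _).const_mul _
    have i2 : Integrable (fun z => |fderiv ℝ ξ z (0, 1)| * |ramp₂ l N 0|) volume :=
      (hdξ.integrable_of_hasCompactSupport hdξc).norm.mul_const _
    refine (i1.add i2).mono' (hdξ.aestronglyMeasurable.mul (hc2.comp_aestronglyMeasurable hUm))
      (ae_of_all _ fun z => ?_)
    rw [norm_mul, Pi.add_apply, Real.norm_eq_abs, Real.norm_eq_abs]
    have h1 := hlip (K.indicator u z) 0
    rw [sub_zero] at h1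
    have h2 : |ramp₂ l N (K.indicator u z)| ≤ max (N - l) 0 * |K.indicator u z| + |ramp₂ l N 0| := by
      have := abs_sub_abs_le_abs_sub (ramp₂ l N (K.indicator u z)) (ramp₂ l N 0)
      linarith
    calc _ ≤ |fderiv ℝ ξ z (0, 1)| * (max (N - l) 0 * |K.indicator u z| + |ramp₂ l N 0|) := by gcongr
      _ = |fderiv ℝ ξ z (0, 1)| * (max (N - l) 0 * |K.indicator u z|) +
          |fderiv ℝ ξ z (0, 1)| * |ramp₂ l N 0| := mul_add _ _ _
      _ ≤ _ := by
        gcongr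
        exact hC' z
  have hTk : ∀ k, Integrable (fun z => fderiv ℝ ξ z (0, 1) * ramp₂ l N (v k z)) volume := fun k =>
    (hdξ.mul (hc2.comp (hvc k))).integrable_of_hasCompactSupport hdξc.mul_right
  have tT := tendsto_integral_of_L1' (μ := volume)
    (F := fun k z => fderiv ℝ ξ z (0, 1) * ramp₂ l N (v k z))
    (fun z => fderiv ℝ ξ z (0, 1) * ramp₂ l N (K.indicator u z)) hT0.1
    (Eventually.of_forall hTk) (by
      have h := tendsto_eLpNorm_mollify le_rfl (by norm_num) (memLp_one_iff_integrable.2 hU1) hm0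
      have h' : Tendsto (fun k => ENNReal.ofReal (C' * max (N - l) 0) *
          eLpNorm (mollify (m k) volume (K.indicator u) - K.indicator u) 1 volume) atTop (𝓝 0) := by
        simpa using ENNReal.Tendsto.const_mul h (Or.inr ENNReal.ofReal_ne_top)
      refine tendsto_of_tendsto_of_tendsto_of_le_of_le tendsto_const_nhds h' (fun _ => zero_le)
        fun k => ?_
      refine eLpNorm_le_mul_eLpNorm_of_ae_le_mul (ae_of_all _ fun z => ?_) 1
      rw [Pi.sub_apply, Pi.sub_apply, ← mul_sub, norm_mul, mul_assoc]
      exact mul_le_mul (hC' z) (hlip _ _) (norm_nonneg _) hC'0)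
  have hlim := le_of_tendsto_of_tendsto' tS (tT.add tR) hmain
  -- rewriting over the cylinder
  have hS1 : Integrable (fun z => inner ℝ (ramp₁ l N (K.indicator u z) • spaceGrad ξ z +
      (ξ z * ramp l N (K.indicator u z)) • K.indicator ux z) (K.indicator X z)) volume :=
    ((hA1.add hA2).norm.integrable_mul hX2.norm).mono' ((hA1.add hA2).1.inner hX2.1)
      (ae_of_all _ fun z => norm_inner_le_norm _ _)
  have hsub : tsupport ξ ⊆ cylinder Ω T := hξK.trans hrQ
  have hQm := (isOpen_cylinder (T := T) hΩ).measurableSet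
  have e1 : (fun z => inner ℝ (ramp₁ l N (K.indicator u z) • spaceGrad ξ z +
      (ξ z * ramp l N (K.indicator u z)) • K.indicator ux z) (K.indicator X z) -
      (ξ z * ramp₁ l N (K.indicator u z)) * K.indicator Y z) =
      (cylinder Ω T).indicator fun z => ramp₁ l N (u z) * inner ℝ (spaceGrad ξ z) (X z) +
        ξ z * ramp l N (u z) * inner ℝ (ux z) (X z) - ξ z * ramp₁ l N (u z) * Y z := by
    ext1 z
    by_cases hz : z ∈ K
    · rw [indicator_of_mem (hrQ hz)]
      simp [hz, inner_add_left, inner_smul_left]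
    · have h1 : ξ z = 0 := image_eq_zero_of_notMem_tsupport fun h => hz (hξK h)
      have h2 : spaceGrad ξ z = 0 := by
        by_contra h; exact hz (hξK (support_spaceGrad_subset hξ1 h))
      simp [hz, h1, h2, indicator]
  have e2 : (fun z => fderiv ℝ ξ z (0, 1) * ramp₂ l N (K.indicator u z)) =
      (cylinder Ω T).indicator fun z => timeDeriv ξ z * ramp₂ l N (u z) := by
    ext1 z
    simp only [timeDeriv_eq (hξ1.differentiable one_ne_zero)]
    by_cases hz : z ∈ K
    · rw [indicator_of_mem (hrQ hz)]
      simp [hz]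
    · have h1 : fderiv ℝ ξ z = 0 := fderiv_of_notMem_tsupport ℝ fun h => hz (hξK h)
      simp [h1, indicator]
  have i1 := hS1.sub hB
  refine ⟨?_, ?_, ?_⟩
  · rw [← integrable_indicator_iff hQm, ← e1]; exact i1
  · rw [← integrable_indicator_iff hQm, ← e2]; exact hT0
  · rw [← integral_indicator hQm, ← integral_indicator hQm, ← e1, ← e2, integral_sub hS1 hB]
    have : ∫ z, inner ℝ (ramp₁ l N (K.indicator u z) • spaceGrad ξ z +
      (ξ z * ramp l N (K.indicator u z)) • K.indicator ux z) (K.indicator X z) ≤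
      (∫ z, fderiv ℝ ξ z (0, 1) * ramp₂ l N (K.indicator u z)) +
      ∫ z, (ξ z * ramp₁ l N (K.indicator u z)) * K.indicator Y z := hlim
    linarith

end

/-! ### Controlled subsolutions and the energy inequality with a cutoff in time -/

section

variable {n : ℕ} {Ω : Set (Space n)} {T : ℝ}

/-- `U` is a weak subsolution of an equation whose flux `X` and source `Y` are controlled, above the
level `κ`, by a single lower order coefficient `Θ`, and `U ≤ 0` on the parabolic boundary. -/
structure IsControlledSubsolution (Ω : Set (Space n)) (T a κ : ℝ) (U : Space n × ℝ → ℝ)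
    (ux X : Space n × ℝ → Space n) (Y Θ : Space n × ℝ → ℝ) : Prop where
  energy : InEnergyClass Ω T U ux
  flux : ∀ K, IsCompact K → K ⊆ cylinder Ω T → MemLp X 2 (volume.restrict K)
  source : ∀ K, IsCompact K → K ⊆ cylinder Ω T → IntegrableOn Y K
  weak : ∀ φ : Space n × ℝ → ℝ, IsTestFunction Ω T φ → (∀ z, 0 ≤ φ z) →
      ∫ z in cylinder Ω T, (-(U z * timeDeriv φ z) + inner ℝ (spaceGrad φ z) (X z))
        ≤ ∫ z in cylinder Ω T, φ z * Y z
  lower : ∀ᵐ z ∂(volume.restrict (cylinder Ω T)), κ < U z →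
    a * ‖ux z‖ ^ 2 - Θ z * U z ^ 2 ≤ inner ℝ (ux z) (X z)
  upper : ∀ᵐ z ∂(volume.restrict (cylinder Ω T)), κ < U z →
    U z * |Y z| ≤ a / 2 * ‖ux z‖ ^ 2 + Θ z * U z ^ 2
  nonneg : ∀ z, 0 ≤ Θ z
  lower_order : ∀ K, IsCompact K → K ⊆ cylinder Ω T → IntegrableOn (fun z => Θ z * U z ^ 2) K
  boundary : LeOnParabolicBoundary Ω T U 0

/-- A test function equal to one near the points at which `U` exceeds the level `κ`. -/
structure IsLevelCutoff (Ω : Set (Space n)) (T T' κ : ℝ) (U ζ : Space n × ℝ → ℝ) : Prop where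
  test : IsTestFunction Ω T ζ
  nonneg : ∀ z, 0 ≤ ζ z
  le_one : ∀ z, ζ z ≤ 1
  eq_one : ∀ᵐ z ∂(volume.restrict (cylinder Ω T')), κ < U z →
    ζ z = 1 ∧ spaceGrad ζ z = 0 ∧ timeDeriv ζ z = 0

/-- Near the parabolic boundary `U ≤ κ`. What remains of `closure Ω × [0, T']` is compact and, since
the lateral boundary up to a time `T' < T` and the bottom have been removed, lies in the open
cylinder. The cutoff is one near this compact set. Nothing is known at the top, hence `T' < T`. -/
theorem exists_isLevelCutoff (hΩ : IsOpen Ω) (hΩb : Bornology.IsBounded Ω) {U : Space n × ℝ → ℝ}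
    (hU : LeOnParabolicBoundary Ω T U 0) {T' κ : ℝ} (hκ : 0 < κ) (hT' : T' < T) :
    ∃ ζ, IsLevelCutoff Ω T T' κ U ζ := by
  obtain ⟨O, hO, hΓ, hle⟩ := hU κ hκ
  set S := (closure Ω ×ˢ Icc 0 T') \ O with hS
  have hSc : IsCompact S :=
    ((hΩb.isCompact_closure.prod isCompact_Icc).diff hO)
  have hSQ : S ⊆ cylinder Ω T := by
    rintro ⟨x, t⟩ ⟨⟨hx, ht⟩, hO'⟩
    have hxΩ : x ∈ Ω := by
      by_contra h
      refine hO' (hΓ (Or.inl ⟨?_, ht.1, ht.2.trans_lt hT'⟩))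
      rw [hΩ.frontier_eq]
      exact ⟨hx, h⟩
    refine ⟨hxΩ, lt_of_le_of_ne ht.1 fun h => hO' (hΓ (Or.inr ⟨hxΩ, h.symm⟩)), ht.2.trans_lt hT'⟩
  obtain ⟨ζ, hζ, hζ01, V, hV, hSV, hV1⟩ := exists_cutoff hΩ hSc hSQ
  refine ⟨ζ, hζ, fun z => (hζ01 z).1, fun z => (hζ01 z).2, ?_⟩
  have hsub : cylinder Ω T' ⊆ cylinder Ω T := prod_mono_right (Ioo_subset_Ioo_right hT'.le)
  have h1 : ∀ᵐ z ∂(volume.restrict (cylinder Ω T')), z ∈ O → U z ≤ 0 + κ := by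
    rw [ae_restrict_iff' (isOpen_cylinder hΩ).measurableSet]
    rw [ae_restrict_iff' (hO.inter (isOpen_cylinder hΩ)).measurableSet] at hle
    filter_upwards [hle] with z hz hzQ hzO
    exact hz ⟨hzO, hsub hzQ⟩
  filter_upwards [h1, ae_restrict_mem (isOpen_cylinder hΩ).measurableSet] with z hz hzQ hκz
  have hzS : z ∈ S := ⟨⟨subset_closure hzQ.1, hzQ.2.1.le, hzQ.2.2.le⟩, fun h => by
    have := hz h; linarith⟩
  have hev : ζ =ᶠ[𝓝 z] fun _ => 1 :=
    Filter.mem_of_superset (hV.mem_nhds (hSV hzS)) fun y hy => hV1 y hy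
  have hd := hζ.1.differentiable one_ne_zero
  have hf : fderiv ℝ ζ z = 0 := by rw [hev.fderiv_eq]; simp
  refine ⟨hV1 z (hSV hzS), ?_, ?_⟩
  · rw [spaceGrad_eq hd, hf]; simp
  · rw [timeDeriv_eq hd, hf]; simp

section

variable {a κ T' l : ℝ} {U Y Θ ζ : Space n × ℝ → ℝ} {ux X : Space n × ℝ → Space n}

/-- A function vanishing where `U ≤ l` lives, up to a null set, where `ζ = 1`, hence in the compact
support of `ζ`. Local integrability in `Q` thus becomes integrability over the whole shorter
cylinder. -/
theorem IsLevelCutoff.integrableOn (hT' : T' ≤ T)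
    (hζ : IsLevelCutoff Ω T T' κ U ζ) (hκl : κ ≤ l) {f g : Space n × ℝ → ℝ}
    (hfm : AEStronglyMeasurable f (volume.restrict (cylinder Ω T)))
    (hg : IntegrableOn g (tsupport ζ))
    (hf0 : ∀ z, U z ≤ l → f z = 0) (hfg : ∀ z, ‖f z‖ ≤ g z) :
    IntegrableOn f (cylinder Ω T') := by
  have hsub : cylinder Ω T' ⊆ cylinder Ω T := prod_mono_right (Ioo_subset_Ioo_right hT')
  have hK : MeasurableSet (tsupport ζ) := (isClosed_tsupport ζ).measurableSet
  have hg' : IntegrableOn ((tsupport ζ).indicator g) (cylinder Ω T') :=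
    ((integrable_indicator_iff hK).2 hg).integrableOn
  refine Integrable.mono' hg' (hfm.mono_set hsub) ?_
  filter_upwards [hζ.eq_one] with z hz
  by_cases hzK : z ∈ tsupport ζ
  · rw [indicator_of_mem hzK]
    exact hfg z
  · rw [hf0 z, norm_zero, indicator_of_notMem hzK]
    by_contra h
    exact hzK (subset_tsupport ζ (by simp [(hz (hκl.trans_lt (not_le.1 h))).1]))

theorem spaceGrad_comp_snd_mul {η : ℝ → ℝ} (hη : ContDiff ℝ 1 η) (hζ : ContDiff ℝ 1 ζ)
    (z : Space n × ℝ) : spaceGrad (fun z => η z.2 * ζ z) z = η z.2 • spaceGrad ζ z := by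
  have h : spaceGrad (fun z : Space n × ℝ => η z.2) z = 0 := by
    simp [spaceGrad, gradient_fun_const]
  have hd : Differentiable ℝ fun z : Space n × ℝ => η z.2 :=
    (hη.differentiable one_ne_zero).comp differentiable_snd
  rw [spaceGrad_mul (φ := fun z => η z.2) hd (hζ.differentiable one_ne_zero), h, smul_zero,
    add_zero]

theorem timeDeriv_comp_snd_mul {η : ℝ → ℝ} (hη : ContDiff ℝ 1 η) (hζ : ContDiff ℝ 1 ζ)
    (z : Space n × ℝ) :
    timeDeriv (fun z => η z.2 * ζ z) z = deriv η z.2 * ζ z + η z.2 * timeDeriv ζ z := by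
  have h1 : DifferentiableAt ℝ (fun t => ζ (z.1, t)) z.2 :=
    (hζ.differentiable one_ne_zero (z.1, z.2)).comp z.2
      ((differentiableAt_const _).prodMk differentiableAt_id)
  simp only [timeDeriv]
  exact deriv_fun_mul (hη.differentiable one_ne_zero z.2) h1

namespace IsControlledSubsolution

theorem integrableOn_grad (hΩ : IsOpen Ω) (hT' : T' ≤ T)
    (hS : IsControlledSubsolution Ω T a κ U ux X Y Θ) (hζ : IsLevelCutoff Ω T T' κ U ζ)
    (hκl : κ ≤ l) :
    IntegrableOn ({z | l < U z}.indicator fun z => ‖ux z‖ ^ 2) (cylinder Ω T') := by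
  have hK := hζ.test.2.1
  have hux : MemLp ux 2 (volume.restrict (tsupport ζ)) :=
    (memLp_indicator_iff_restrict hK.measurableSet).1 (hS.energy.2.1.memLp_two hΩ hK hζ.test.2.2)
  refine hζ.integrableOn hT' hκl ?_ hux.norm.integrable_sq
    (fun z hz => indicator_of_notMem (show z ∉ {z | l < U z} from not_lt.2 hz) _) fun z => ?_
  · exact (hS.energy.2.1.1.norm.pow 2).indicator₀
      (nullMeasurableSet_lt aemeasurable_const hS.energy.1.1.aemeasurable)
  · exact (norm_indicator_le_norm_self _ _).trans (by simp)

theorem integrableOn_lower_order (hT' : T' ≤ T)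
    (hS : IsControlledSubsolution Ω T a κ U ux X Y Θ)
    (hΘ : AEStronglyMeasurable Θ (volume.restrict (cylinder Ω T)))
    (hζ : IsLevelCutoff Ω T T' κ U ζ) (hκl : κ ≤ l) :
    IntegrableOn ({z | l < U z}.indicator fun z => Θ z * U z ^ 2) (cylinder Ω T') := by
  refine hζ.integrableOn hT' hκl ?_ (hS.lower_order _ hζ.test.2.1 hζ.test.2.2)
    (fun z hz => indicator_of_notMem (show z ∉ {z | l < U z} from not_lt.2 hz) _) fun z => ?_
  · exact (hΘ.mul (hS.energy.1.1.pow 2)).indicator₀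
      (nullMeasurableSet_lt aemeasurable_const hS.energy.1.1.aemeasurable)
  · refine (norm_indicator_le_norm_self _ _).trans ?_
    rw [Real.norm_of_nonneg (mul_nonneg (hS.nonneg z) (sq_nonneg _))]

theorem integrableOn_sq (hΩ : IsOpen Ω) (hT' : T' ≤ T)
    (hS : IsControlledSubsolution Ω T a κ U ux X Y Θ) (hζ : IsLevelCutoff Ω T T' κ U ζ)
    (hκ : 0 < κ) (hκl : κ ≤ l) :
    IntegrableOn (fun z => max (U z - l) 0 ^ 2) (cylinder Ω T') := by
  have hK := hζ.test.2.1
  have hu : MemLp U 2 (volume.restrict (tsupport ζ)) :=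
    (memLp_indicator_iff_restrict hK.measurableSet).1
      (hS.energy.1.memLp_two_of_top hΩ hK hζ.test.2.2)
  refine hζ.integrableOn hT' hκl ?_ hu.norm.integrable_sq
    (fun z hz => by simp [hz]) fun z => ?_
  · exact ((hS.energy.1.1.sub aestronglyMeasurable_const).sup aestronglyMeasurable_const).pow 2
  · rw [Real.norm_of_nonneg (sq_nonneg _)]
    refine pow_le_pow_left₀ (le_max_right _ _) (max_le ?_ (norm_nonneg _)) 2
    have := Real.le_norm_self (U z)
    linarith

/-- The energy inequality with a smooth cutoff in time. -/
theorem energy_cutoff (hΩ : IsOpen Ω) (hT' : T' ≤ T) (hκ : 0 < κ)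
    (hS : IsControlledSubsolution Ω T a κ U ux X Y Θ)
    (hΘ : AEStronglyMeasurable Θ (volume.restrict (cylinder Ω T)))
    (hζ : IsLevelCutoff Ω T T' κ U ζ) (hκl : κ ≤ l) {η : ℝ → ℝ} (hη : ContDiff ℝ 1 η)
    (hη0 : ∀ t, 0 ≤ η t) (hη1 : ∀ t, η t ≤ 1) (hηT : ∀ t, T' ≤ t → η t = 0 ∧ deriv η t = 0)
    {C : ℝ} (hηC : ∀ t, |deriv η t| ≤ C) :
    a / 2 * ∫ z in cylinder Ω T', η z.2 * {z | l < U z}.indicator (fun z => ‖ux z‖ ^ 2) z ≤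
      1 / 2 * (∫ z in cylinder Ω T', deriv η z.2 * max (U z - l) 0 ^ 2) +
      2 * ∫ z in cylinder Ω T', η z.2 * {z | l < U z}.indicator (fun z => Θ z * U z ^ 2) z := by
  have hsub : cylinder Ω T' ⊆ cylinder Ω T := prod_mono_right (Ioo_subset_Ioo_right hT')
  have hQm := (isOpen_cylinder (T := T) hΩ).measurableSet
  have hQm' := (isOpen_cylinder (T := T') hΩ).measurableSet
  set p := {z | l < U z}.indicator (fun z => ‖ux z‖ ^ 2) with hp
  set q := {z | l < U z}.indicator (fun z => Θ z * U z ^ 2) with hq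
  have ip : IntegrableOn p (cylinder Ω T') := hS.integrableOn_grad hΩ hT' hζ hκl
  have iq : IntegrableOn q (cylinder Ω T') := hS.integrableOn_lower_order hT' hΘ hζ hκl
  have iw := hS.integrableOn_sq hΩ hT' hζ hκ hκl
  have hp0 : ∀ z, 0 ≤ p z := fun z => indicator_nonneg (fun z _ => sq_nonneg _) z
  have hUm : AEStronglyMeasurable U (volume.restrict (cylinder Ω T')) :=
    hS.energy.1.1.mono_set hsub
  have huxm : AEStronglyMeasurable ux (volume.restrict (cylinder Ω T')) :=
    hS.energy.2.1.1.mono_set hsub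
  have hηc : Continuous fun z : Space n × ℝ => η z.2 := hη.continuous.comp continuous_snd
  have hηm := hηc.aestronglyMeasurable (μ := volume.restrict (cylinder Ω T'))
  have hη'm : AEStronglyMeasurable (fun z : Space n × ℝ => deriv η z.2)
      (volume.restrict (cylinder Ω T')) :=
    ((hη.continuous_deriv le_rfl).comp continuous_snd).aestronglyMeasurable
  have hηn : ∀ z : Space n × ℝ, ‖η z.2‖ ≤ 1 := fun z => by
    rw [Real.norm_of_nonneg (hη0 _)]; exact hη1 _
  have iηp : IntegrableOn (fun z => η z.2 * p z) (cylinder Ω T') :=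
    ip.bdd_mul hηm (ae_of_all _ hηn)
  have iηq : IntegrableOn (fun z => η z.2 * q z) (cylinder Ω T') :=
    iq.bdd_mul hηm (ae_of_all _ hηn)
  -- `ξ` has compact support in `Q`, yet almost everywhere on `U > l` below the time `T'` it behaves
  -- as the function `η` of time alone, because `ζ` is one there and its derivatives vanish.
  set ξ : Space n × ℝ → ℝ := fun z => η z.2 * ζ z with hξ
  have hξt : IsTestFunction Ω T ξ :=
    ⟨(hη.comp contDiff_snd).mul hζ.test.1, hζ.test.2.1.mul_left,
      (tsupport_mul_subset_right (f := fun z : Space n × ℝ => η z.2)).trans hζ.test.2.2⟩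
  -- the inequality for the regularized truncations
  have key : ∀ N : ℕ, a * ∫ z in cylinder Ω T', η z.2 * (ramp l N (U z) * ‖ux z‖ ^ 2) ≤
      (∫ z in cylinder Ω T', deriv η z.2 * ramp₂ l N (U z)) +
        ∫ z in cylinder Ω T', η z.2 * (a / 2 * p z + 2 * q z) := by
    intro N
    obtain ⟨i1, i2, h⟩ := renormalized hΩ hS.energy hS.flux hS.source hS.weak hξt
      (fun z => mul_nonneg (hη0 _) (hζ.nonneg z)) l N
    have hz1 : ∀ z ∈ cylinder Ω T \ cylinder Ω T', η z.2 = 0 ∧ deriv η z.2 = 0 := by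
      rintro z ⟨h1, h2⟩
      exact hηT _ (not_lt.1 fun h => h2 ⟨h1.1, h1.2.1, h⟩)
    rw [setIntegral_eq_of_subset_of_forall_sdiff_eq_zero hQm hsub (fun z hz => by
        simp only [hξ]
        rw [spaceGrad_comp_snd_mul hη hζ.test.1, (hz1 z hz).1]; simp),
      setIntegral_eq_of_subset_of_forall_sdiff_eq_zero hQm hsub (fun z hz => by
        simp only [hξ]
        rw [timeDeriv_comp_snd_mul hη hζ.test.1, (hz1 z hz).1, (hz1 z hz).2]; simp)] at h
    have i1' := i1.mono_set hsub
    have e2 : ∫ z in cylinder Ω T', timeDeriv ξ z * ramp₂ l N (U z) =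
        ∫ z in cylinder Ω T', deriv η z.2 * ramp₂ l N (U z) := by
      refine integral_congr_ae ?_
      filter_upwards [hζ.eq_one] with z hz
      rcases le_or_gt (U z) l with hle | hlt
      · rw [ramp₂_of_le l N hle, mul_zero, mul_zero]
      · obtain ⟨h1, -, h3⟩ := hz (hκl.trans_lt hlt)
        rw [timeDeriv_comp_snd_mul hη hζ.test.1, h1, h3]; simp
    rw [e2] at h
    have iR : IntegrableOn (fun z => η z.2 * (a / 2 * p z + 2 * q z)) (cylinder Ω T') :=
      ((ip.const_mul _).add (iq.const_mul _)).bdd_mul hηm (ae_of_all _ hηn)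
    have iP : IntegrableOn (fun z => η z.2 * (ramp l N (U z) * ‖ux z‖ ^ 2)) (cylinder Ω T') := by
      refine Integrable.mono' ip (hηm.mul (((continuous_ramp l N).comp_aestronglyMeasurable
        hUm).mul (huxm.norm.pow 2))) (ae_of_all _ fun z => ?_)
      rw [norm_mul]
      refine (mul_le_of_le_one_left (norm_nonneg _) (hηn z)).trans ?_
      rcases le_or_gt (U z) l with hle | hlt
      · rw [ramp_of_le l N hle, zero_mul, norm_zero]; exact hp0 z
      · rw [hp, indicator_of_mem (show z ∈ {z | l < U z} from hlt), norm_mul, norm_pow, norm_norm,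
          Real.norm_of_nonneg (ramp_nonneg _ _ _)]
        exact mul_le_of_le_one_left (sq_nonneg _) (ramp_le_one _ _ _)
    have hae := integral_mono_ae (iP.const_mul a) (i1'.add iR) (by
      filter_upwards [hζ.eq_one, ae_restrict_of_ae_restrict_of_subset hsub hS.lower,
        ae_restrict_of_ae_restrict_of_subset hsub hS.upper] with z hz hl hu
      simp only [Pi.add_apply]
      rcases le_or_gt (U z) l with hle | hlt
      · rw [ramp_of_le l N hle, ramp₁_of_le l N hle, hp, hq,
          indicator_of_notMem (show z ∉ {z | l < U z} from not_lt.2 hle),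
          indicator_of_notMem (show z ∉ {z | l < U z} from not_lt.2 hle)]
        simp
      · have hκz := hκl.trans_lt hlt
        obtain ⟨h1, h2, -⟩ := hz hκz
        rw [spaceGrad_comp_snd_mul hη hζ.test.1, h2, hp, hq,
          indicator_of_mem (show z ∈ {z | l < U z} from hlt),
          indicator_of_mem (show z ∈ {z | l < U z} from hlt)]
        simp only [hξ, h1, smul_zero, inner_zero_left, mul_zero, zero_add, mul_one]
        have hl := hl hκz
        have hu := hu hκz
        have r0 := ramp_nonneg l N (U z)
        have r1 := ramp_le_one l N (U z)
        have s0 := ramp₁_nonneg l N (U z)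
        have s1 : ramp₁ l N (U z) ≤ U z := (ramp₁_le l N (U z)).trans
          (max_le (by linarith) (by linarith))
        have hΘU : 0 ≤ Θ z * U z ^ 2 := mul_nonneg (hS.nonneg z) (sq_nonneg _)
        -- Weighted with `ramp ≤ 1` and `ramp₁ ≤ U`, the two structure inequalities cost `2 Θ U ^ 2`
        -- and half of the gradient term. That half carries the indicator of `U > l` instead of
        -- `ramp`, so it is absorbed only after `N → ∞`.
        have b1 : ramp l N (U z) * (a * ‖ux z‖ ^ 2) - Θ z * U z ^ 2 ≤
            ramp l N (U z) * inner ℝ (ux z) (X z) := by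
          have := mul_le_mul_of_nonneg_left hl r0
          nlinarith
        have b2 : ramp₁ l N (U z) * Y z ≤ a / 2 * ‖ux z‖ ^ 2 + Θ z * U z ^ 2 :=
          calc ramp₁ l N (U z) * Y z ≤ ramp₁ l N (U z) * |Y z| := by
                gcongr; exact le_abs_self _
            _ ≤ U z * |Y z| := by gcongr
            _ ≤ _ := hu
        have b3 := mul_le_mul_of_nonneg_left (add_le_add b1 b2) (hη0 z.2)
        nlinarith)
    rw [integral_const_mul, integral_add' i1' iR] at hae
    linarith
  have t1 : Tendsto (fun N : ℕ => ∫ z in cylinder Ω T', η z.2 * (ramp l N (U z) * ‖ux z‖ ^ 2))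
      atTop (𝓝 (∫ z in cylinder Ω T', η z.2 * p z)) := by
    refine tendsto_integral_of_dominated_convergence p
      (fun N => hηm.mul (((continuous_ramp l N).comp_aestronglyMeasurable hUm).mul
        (huxm.norm.pow 2))) ip (fun N => ae_of_all _ fun z => ?_) (ae_of_all _ fun z => ?_)
    · rw [norm_mul]
      refine (mul_le_of_le_one_left (norm_nonneg _) (hηn z)).trans ?_
      rcases le_or_gt (U z) l with hle | hlt
      · rw [ramp_of_le l N hle, zero_mul, norm_zero]; exact hp0 z
      · rw [hp, indicator_of_mem (show z ∈ {z | l < U z} from hlt), norm_mul, norm_pow, norm_norm,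
          Real.norm_of_nonneg (ramp_nonneg _ _ _)]
        exact mul_le_of_le_one_left (sq_nonneg _) (ramp_le_one _ _ _)
    · have h := ((tendsto_ramp l (U z)).mul_const (‖ux z‖ ^ 2)).const_mul (η z.2)
      convert h using 3
      rw [hp, indicator_apply]
      simp only [mem_ofPred_eq]
      split_ifs <;> simp
  have t2 : Tendsto (fun N : ℕ => ∫ z in cylinder Ω T', deriv η z.2 * ramp₂ l N (U z))
      atTop (𝓝 (∫ z in cylinder Ω T', deriv η z.2 * (max (U z - l) 0 ^ 2 / 2))) := by
    refine tendsto_integral_of_dominated_convergence (fun z => C * max (U z - l) 0 ^ 2)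
      (fun N => hη'm.mul ((continuous_ramp₂ l N).comp_aestronglyMeasurable hUm))
      (iw.const_mul C) (fun N => ae_of_all _ fun z => ?_) (ae_of_all _ fun z => ?_)
    · rw [norm_mul, Real.norm_of_nonneg (ramp₂_nonneg _ _ _)]
      exact mul_le_mul (hηC _) (ramp₂_le _ _ _) (ramp₂_nonneg _ _ _) ((abs_nonneg _).trans (hηC 0))
    · exact (tendsto_ramp₂ l (U z)).const_mul _
  have hlim := le_of_tendsto_of_tendsto' (t1.const_mul a) (t2.add_const _) key
  have e1 : ∫ z in cylinder Ω T', deriv η z.2 * (max (U z - l) 0 ^ 2 / 2) =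
      1 / 2 * ∫ z in cylinder Ω T', deriv η z.2 * max (U z - l) 0 ^ 2 := by
    rw [← integral_const_mul]
    congr 1 with z
    ring
  have e2 : ∫ z in cylinder Ω T', η z.2 * (a / 2 * p z + 2 * q z) =
      a / 2 * (∫ z in cylinder Ω T', η z.2 * p z) + 2 * ∫ z in cylinder Ω T', η z.2 * q z := by
    rw [← integral_const_mul, ← integral_const_mul,
      ← integral_add (iηp.const_mul _) (iηq.const_mul _)]
    congr 1 with z
    ring
  rw [e1, e2] at hlim
  linarith

end IsControlledSubsolution

end

end

section

/-! ### Smooth steps -/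

/-- A smooth step of width `b.rOut`. -/
noncomputable def smoothStep (b : ContDiffBump (0 : ℝ)) (s : ℝ) : ℝ :=
  ∫ x in (-b.rOut)..s, b.normed volume x

section SmoothStep

variable (b : ContDiffBump (0 : ℝ))

theorem support_normed_eq_Ioo : Function.support (b.normed volume) = Ioo (-b.rOut) b.rOut := by
  rw [b.support_normed_eq, Real.ball_eq_Ioo]; simp

theorem hasDerivAt_smoothStep (s : ℝ) : HasDerivAt (smoothStep b) (b.normed volume s) s :=
  (b.continuous_normed (μ := volume)).integral_hasStrictDerivAt _ _ |>.hasDerivAt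

theorem contDiff_smoothStep : ContDiff ℝ 1 (smoothStep b) := by
  rw [contDiff_one_iff_deriv]
  refine ⟨fun s => (hasDerivAt_smoothStep b s).differentiableAt, ?_⟩
  rw [funext fun s => (hasDerivAt_smoothStep b s).deriv]
  exact b.continuous_normed

theorem monotone_smoothStep : Monotone (smoothStep b) :=
  monotone_of_hasDerivAt_nonneg (hasDerivAt_smoothStep b) fun s => b.nonneg_normed s

theorem smoothStep_of_le {s : ℝ} (hs : s ≤ -b.rOut) : smoothStep b s = 0 := by
  unfold smoothStep
  refine intervalIntegral.integral_zero_ae (ae_of_all _ fun x hx => ?_)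
  rw [uIoc_of_ge hs] at hx
  by_contra h
  have : x ∈ Ioo (-b.rOut) b.rOut := support_normed_eq_Ioo b ▸ h
  exact absurd hx.2 (not_le.2 this.1)

theorem smoothStep_of_ge {s : ℝ} (hs : b.rOut ≤ s) : smoothStep b s = 1 := by
  unfold smoothStep
  rw [intervalIntegral.integral_eq_integral_of_support_subset, b.integral_normed]
  rw [support_normed_eq_Ioo]
  exact Ioo_subset_Ioc_self.trans (Ioc_subset_Ioc_right hs)

theorem smoothStep_nonneg (s : ℝ) : 0 ≤ smoothStep b s := by
  rw [← smoothStep_of_le b (min_le_right s (-b.rOut))]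
  exact monotone_smoothStep b (min_le_left _ _)

theorem smoothStep_le_one (s : ℝ) : smoothStep b s ≤ 1 := by
  rw [← smoothStep_of_ge b (le_max_right s b.rOut)]
  exact monotone_smoothStep b (le_max_left _ _)

end SmoothStep

/-! ### The energy inequality at almost every time -/

variable {n : ℕ} {Ω : Set (Space n)} {T : ℝ}
variable {a κ T' l : ℝ} {U Y Θ ζ : Space n × ℝ → ℝ} {ux X : Space n × ℝ → Space n}

theorem integral_cylinder_eq {f : Space n × ℝ → ℝ} (hf : IntegrableOn f (cylinder Ω T)) :
    ∫ z in cylinder Ω T, f z = ∫ t in Ioo 0 T, ∫ x in Ω, f (x, t) := by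
  rw [IntegrableOn, restrict_cylinder] at hf
  rw [restrict_cylinder, integral_prod_symm _ hf]

namespace IsControlledSubsolution

/-- The energy inequality. -/
theorem energy_inequality (hΩ : IsOpen Ω) (hT' : T' ≤ T) (hκ : 0 < κ)
    (hS : IsControlledSubsolution Ω T a κ U ux X Y Θ)
    (hΘ : AEStronglyMeasurable Θ (volume.restrict (cylinder Ω T)))
    (hζ : IsLevelCutoff Ω T T' κ U ζ) (hκl : κ ≤ l) :
    ∀ᵐ τ ∂(volume.restrict (Ioo 0 T')),
      (∫ x in Ω, max (U (x, τ) - l) 0 ^ 2) +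
        a * ∫ z in cylinder Ω τ, {z | l < U z}.indicator (fun z => ‖ux z‖ ^ 2) z ≤
      4 * ∫ z in cylinder Ω τ, {z | l < U z}.indicator (fun z => Θ z * U z ^ 2) z := by
  set p := {z | l < U z}.indicator (fun z => ‖ux z‖ ^ 2) with hp
  set q := {z | l < U z}.indicator (fun z => Θ z * U z ^ 2) with hq
  have ip : IntegrableOn p (cylinder Ω T') := hS.integrableOn_grad hΩ hT' hζ hκl
  have iq : IntegrableOn q (cylinder Ω T') := hS.integrableOn_lower_order hT' hΘ hζ hκl
  have iw := hS.integrableOn_sq hΩ hT' hζ hκ hκl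
  set y : ℝ → ℝ := fun t => ∫ x in Ω, max (U (x, t) - l) 0 ^ 2 with hy
  have iy : IntegrableOn y (Ioo 0 T') := by
    have := iw
    rw [IntegrableOn, restrict_cylinder] at this
    exact this.integral_prod_right
  have iy' : LocallyIntegrable ((Ioo 0 T').indicator y) volume :=
    ((integrable_indicator_iff measurableSet_Ioo).2 iy).locallyIntegrable
  let b : ℕ → ContDiffBump (0 : ℝ) := fun k =>
    ⟨1 / (k + 2 : ℝ) / 2, 1 / (k + 2 : ℝ), by positivity, half_lt_self (by positivity)⟩
  have hb0 : Tendsto (fun k => (b k).rOut) atTop (𝓝 0) :=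
    tendsto_const_nhds.div_atTop (tendsto_atTop_add_const_right _ _ tendsto_natCast_atTop_atTop)
  have hconv : ∀ᵐ τ, Tendsto (fun k => mollify (b k) volume ((Ioo 0 T').indicator y) τ) atTop
      (𝓝 ((Ioo 0 T').indicator y τ)) :=
    ContDiffBump.ae_convolution_tendsto_right_of_locallyIntegrable (K := 2) hb0
      (Eventually.of_forall fun k => by simp only [b]; linarith) iy'
  filter_upwards [ae_restrict_of_ae hconv, ae_restrict_mem measurableSet_Ioo] with τ hτ hτT
  rw [indicator_of_mem hτT] at hτ
  -- These cutoffs tend to the indicator of `t < τ`. Their derivative in `t` is minus a bump around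
  -- `τ`, so the time term is minus the mollified slice mass at `τ`, which converges for almost
  -- every `τ` by Lebesgue differentiation.
  set η : ℕ → ℝ → ℝ := fun k t => smoothStep (b k) (τ - t) with hη
  have hη' : ∀ k t, deriv (η k) t = - (b k).normed volume (τ - t) := by
    intro k t
    have := (hasDerivAt_smoothStep (b k) (τ - t)).comp_const_sub τ t
    exact this.deriv
  have hηc : ∀ k, ContDiff ℝ 1 (η k) := fun k =>
    (contDiff_smoothStep (b k)).comp (contDiff_const.sub contDiff_id)
  have hmain : ∀ᶠ k in atTop, a / 2 * (∫ z in cylinder Ω T', η k z.2 * p z) +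
      1 / 2 * mollify (b k) volume ((Ioo 0 T').indicator y) τ ≤
      2 * ∫ z in cylinder Ω T', η k z.2 * q z := by
    filter_upwards [hb0.eventually_lt_const (sub_pos.2 hτT.2)] with k hk
    have hT0 : ∀ t, T' ≤ t → η k t = 0 ∧ deriv (η k) t = 0 := by
      intro t ht
      refine ⟨smoothStep_of_le _ (by linarith), ?_⟩
      rw [hη', neg_eq_zero]
      by_contra h
      have : τ - t ∈ Ioo (-(b k).rOut) (b k).rOut := support_normed_eq_Ioo (b k) ▸ h
      linarith [this.1]
    obtain ⟨C, hC⟩ := (b k).hasCompactSupport_normed (μ := volume)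
      |>.exists_bound_of_continuous (b k).continuous_normed
    have h := hS.energy_cutoff hΩ hT' hκ hΘ hζ hκl (hηc k) (fun t => smoothStep_nonneg _ _)
      (fun t => smoothStep_le_one _ _) hT0 (C := C) (fun t => by
        rw [hη', abs_neg]; exact hC _)
    have e : ∫ z in cylinder Ω T', deriv (η k) z.2 * max (U z - l) 0 ^ 2 =
        - mollify (b k) volume ((Ioo 0 T').indicator y) τ := by
      rw [integral_cylinder_eq, mollify_apply_swap, ← integral_neg,
        ← setIntegral_eq_integral_of_forall_compl_eq_zero (s := Ioo 0 T')
          (f := fun t => -((b k).normed volume (τ - t) • (Ioo 0 T').indicator y t))]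
      · refine setIntegral_congr_fun measurableSet_Ioo fun t ht => ?_
        simp only [indicator_of_mem ht, smul_eq_mul, hη', hy]
        rw [integral_const_mul, neg_mul]
      · intro t ht
        rw [indicator_of_notMem ht]; simp
      · refine iw.bdd_mul (c := C) ?_ (ae_of_all _ fun z => ?_)
        · exact (((hηc k).continuous_deriv le_rfl).comp continuous_snd).aestronglyMeasurable
        · rw [hη', norm_neg]; exact hC _
    rw [e] at h
    linarith
  have hlim : ∀ {f : Space n × ℝ → ℝ}, IntegrableOn f (cylinder Ω T') →
      Tendsto (fun k => ∫ z in cylinder Ω T', η k z.2 * f z) atTop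
        (𝓝 (∫ z in cylinder Ω τ, f z)) := by
    intro f hf
    have hsub : cylinder Ω τ ⊆ cylinder Ω T' := prod_mono_right (Ioo_subset_Ioo_right hτT.2.le)
    have hm := (isOpen_cylinder (T := τ) hΩ).measurableSet
    have e : ∫ z in cylinder Ω τ, f z = ∫ z in cylinder Ω T', (cylinder Ω τ).indicator f z := by
      rw [setIntegral_indicator hm, inter_eq_self_of_subset_right hsub]
    rw [e]
    have hne : ∀ᵐ z ∂(volume.restrict (cylinder Ω T')), z.2 ≠ τ := by
      rw [restrict_cylinder]
      have : ∀ᵐ t ∂(volume.restrict (Ioo 0 T')), t ≠ τ := ae_restrict_of_ae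
        (measure_eq_zero_iff_ae_notMem.1 (Real.volume_singleton (a := τ)))
      exact Measure.quasiMeasurePreserving_snd.ae this
    refine tendsto_integral_of_dominated_convergence (fun z => ‖f z‖) (fun k => ?_) hf.norm
      (fun k => ae_of_all _ fun z => ?_) ?_
    · exact ((hηc k).continuous.comp continuous_snd).aestronglyMeasurable.mul hf.1
    · rw [norm_mul, Real.norm_of_nonneg (smoothStep_nonneg _ _)]
      exact mul_le_of_le_one_left (norm_nonneg _) (smoothStep_le_one _ _)
    · filter_upwards [hne, ae_restrict_mem (isOpen_cylinder hΩ).measurableSet] with z hz hzQ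
      rcases lt_or_gt_of_ne hz with h | h
      · have hmem : z ∈ cylinder Ω τ := ⟨hzQ.1, hzQ.2.1, h⟩
        rw [indicator_of_mem hmem]
        refine tendsto_const_nhds.congr' ?_
        filter_upwards [hb0.eventually_lt_const (sub_pos.2 h)] with k hk
        simp only [hη]
        rw [smoothStep_of_ge _ hk.le, one_mul]
      · have hmem : z ∉ cylinder Ω τ := fun hm => absurd hm.2.2 (not_lt.2 h.le)
        rw [indicator_of_notMem hmem]
        refine tendsto_const_nhds.congr' ?_
        filter_upwards [hb0.eventually_lt_const (sub_pos.2 h)] with k hk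
        simp only [hη]
        rw [smoothStep_of_le _ (by linarith), zero_mul]
  have := le_of_tendsto_of_tendsto (((hlim ip).const_mul (a / 2)).add (hτ.const_mul (1 / 2)))
    ((hlim iq).const_mul 2) hmain
  linarith

end IsControlledSubsolution

end

/-! ### Slice integrals above a level -/

section

variable {n : ℕ} {Ω : Set (Space n)} {T : ℝ}
variable {a κ T' l : ℝ} {U Y Θ ζ : Space n × ℝ → ℝ} {ux X : Space n × ℝ → Space n}

/-- The integral of `(U - l)₊²` over a slice. -/
noncomputable def levelMass (Ω : Set (Space n)) (U : Space n × ℝ → ℝ) (l t : ℝ) : ℝ≥0∞ :=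
  ∫⁻ x in Ω, ‖max (U (x, t) - l) 0‖ₑ ^ 2

/-- The integral of the squared gradient over the part of a slice where `U > l`. -/
noncomputable def levelGrad (Ω : Set (Space n)) (U : Space n × ℝ → ℝ)
    (ux : Space n × ℝ → Space n) (l t : ℝ) : ℝ≥0∞ :=
  ∫⁻ x in Ω, ‖{z | l < U z}.indicator ux (x, t)‖ₑ ^ 2

/-- The integral of `Θ U²` over the part of a slice where `U > l`. -/
noncomputable def levelSource (Ω : Set (Space n)) (U Θ : Space n × ℝ → ℝ) (l t : ℝ) : ℝ≥0∞ :=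
  ∫⁻ x in Ω, ENNReal.ofReal ({z | l < U z}.indicator (fun z => Θ z * U z ^ 2) (x, t))

theorem antitone_levelMass (t : ℝ) : Antitone fun l => levelMass Ω U l t := by
  intro l l' h
  refine lintegral_mono fun x => ?_
  simp only [Real.enorm_of_nonneg (le_max_right _ _)]
  gcongr

theorem antitone_levelGrad (t : ℝ) : Antitone fun l => levelGrad Ω U ux l t := by
  intro l l' h
  refine lintegral_mono fun x => ?_
  simp only [enorm_indicator_eq_indicator_enorm]
  gcongr

theorem lintegral_cylinder_ofReal {f : Space n × ℝ → ℝ} (hf : IntegrableOn f (cylinder Ω T))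
    (hf0 : ∀ z, 0 ≤ f z) : ENNReal.ofReal (∫ z in cylinder Ω T, f z) =
      ∫⁻ t in Ioo 0 T, ∫⁻ x in Ω, ENNReal.ofReal (f (x, t)) := by
  rw [ofReal_integral_eq_lintegral_ofReal hf (ae_of_all _ hf0),
    lintegral_cylinder hf.1.aemeasurable.ennreal_ofReal]

theorem ofReal_indicator_norm_sq (z : Space n × ℝ) :
    ENNReal.ofReal ({z | l < U z}.indicator (fun z => ‖ux z‖ ^ 2) z) =
      ‖{z | l < U z}.indicator ux z‖ₑ ^ 2 := by
  by_cases h : z ∈ {z | l < U z}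
  · rw [indicator_of_mem h, indicator_of_mem h, ENNReal.ofReal_pow (norm_nonneg _), ofReal_norm]
  · rw [indicator_of_notMem h, indicator_of_notMem h]; simp

namespace IsControlledSubsolution

theorem aestronglyMeasurable_max (hS : IsControlledSubsolution Ω T a κ U ux X Y Θ) :
    AEStronglyMeasurable (fun z => max (U z - l) 0) (volume.restrict (cylinder Ω T)) :=
  (hS.energy.1.1.sub aestronglyMeasurable_const).sup aestronglyMeasurable_const

theorem aestronglyMeasurable_indicator (hS : IsControlledSubsolution Ω T a κ U ux X Y Θ) :
    AEStronglyMeasurable ({z | l < U z}.indicator ux) (volume.restrict (cylinder Ω T)) :=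
  hS.energy.2.1.1.indicator₀ (nullMeasurableSet_lt aemeasurable_const hS.energy.1.1.aemeasurable)

theorem aemeasurable_levelGrad (hS : IsControlledSubsolution Ω T a κ U ux X Y Θ) (l : ℝ) :
    AEMeasurable (levelGrad Ω U ux l) (volume.restrict (Ioo 0 T)) := by
  have := (hS.aestronglyMeasurable_indicator (l := l)).enorm.pow_const 2
  rw [restrict_cylinder] at this
  exact this.lintegral_prod_left'

theorem lintegral_levelGrad (hΩ : IsOpen Ω) (hT' : T' ≤ T)
    (hS : IsControlledSubsolution Ω T a κ U ux X Y Θ) (hζ : IsLevelCutoff Ω T T' κ U ζ)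
    (hκl : κ ≤ l) {τ : ℝ} (hτ : τ ≤ T') :
    ∫⁻ t in Ioo 0 τ, levelGrad Ω U ux l t =
      ENNReal.ofReal (∫ z in cylinder Ω τ, {z | l < U z}.indicator (fun z => ‖ux z‖ ^ 2) z) := by
  rw [lintegral_cylinder_ofReal ((hS.integrableOn_grad hΩ hT' hζ hκl).mono_set
    (prod_mono_right (Ioo_subset_Ioo_right hτ))) fun z => indicator_nonneg
    (fun z _ => sq_nonneg _) z]
  simp only [ofReal_indicator_norm_sq]
  rfl

/-- The energy inequality for the slice integrals. -/
theorem energy_lintegral (hΩ : IsOpen Ω) (hT' : T' ≤ T) (hκ : 0 < κ) (ha : 0 < a)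
    (hS : IsControlledSubsolution Ω T a κ U ux X Y Θ)
    (hΘ : AEStronglyMeasurable Θ (volume.restrict (cylinder Ω T)))
    (hζ : IsLevelCutoff Ω T T' κ U ζ) (hκl : κ ≤ l) :
    ∀ᵐ τ ∂(volume.restrict (Ioo 0 T')),
      levelMass Ω U l τ + ENNReal.ofReal a * ∫⁻ t in Ioo 0 τ, levelGrad Ω U ux l t ≤
        4 * ∫⁻ t in Ioo 0 τ, levelSource Ω U Θ l t := by
  have iw := hS.integrableOn_sq hΩ hT' hζ hκ hκl
  have iw' : ∀ᵐ τ ∂(volume.restrict (Ioo 0 T')),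
      Integrable (fun x => max (U (x, τ) - l) 0 ^ 2) (volume.restrict Ω) := by
    rw [IntegrableOn, restrict_cylinder] at iw
    exact iw.prod_left_ae
  filter_upwards [hS.energy_inequality hΩ hT' hκ hΘ hζ hκl, iw',
    ae_restrict_mem measurableSet_Ioo] with τ h hi hτ
  have hsub : cylinder Ω τ ⊆ cylinder Ω T' := prod_mono_right (Ioo_subset_Ioo_right hτ.2.le)
  have hq0 : ∀ z, 0 ≤ {z | l < U z}.indicator (fun z => Θ z * U z ^ 2) z := fun z =>
    indicator_nonneg (fun z _ => mul_nonneg (hS.nonneg z) (sq_nonneg _)) z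
  have e1 : levelMass Ω U l τ = ENNReal.ofReal (∫ x in Ω, max (U (x, τ) - l) 0 ^ 2) := by
    rw [ofReal_integral_eq_lintegral_ofReal hi (ae_of_all _ fun x => sq_nonneg _)]
    refine lintegral_congr fun x => ?_
    rw [Real.enorm_of_nonneg (le_max_right _ _), ENNReal.ofReal_pow (le_max_right _ _)]
  have e3 := lintegral_cylinder_ofReal
    ((hS.integrableOn_lower_order hT' hΘ hζ hκl).mono_set hsub) hq0
  rw [e1, hS.lintegral_levelGrad hΩ hT' hζ hκl hτ.2.le, ← ENNReal.ofReal_mul ha.le,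
    ← ENNReal.ofReal_add (integral_nonneg fun x => sq_nonneg _) (mul_nonneg ha.le
      (integral_nonneg fun z => indicator_nonneg (fun z _ => sq_nonneg _) z))]
  refine (ENNReal.ofReal_le_ofReal h).trans ?_
  rw [ENNReal.ofReal_mul (by norm_num), e3, ENNReal.ofReal_ofNat]
  rfl

theorem lintegral_levelGrad_lt_top (hΩ : IsOpen Ω) (hT' : T' ≤ T)
    (hS : IsControlledSubsolution Ω T a κ U ux X Y Θ) (hζ : IsLevelCutoff Ω T T' κ U ζ)
    (hκl : κ ≤ l) : ∫⁻ t in Ioo 0 T', levelGrad Ω U ux l t < ∞ := by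
  rw [hS.lintegral_levelGrad hΩ hT' hζ hκl le_rfl]
  exact ENNReal.ofReal_lt_top

/-- On almost every slice, `(U - l)₊` agrees with the truncation of `ζ U`. -/
theorem ae_truncate_eq (hκ : 0 < κ) (hζ : IsLevelCutoff Ω T T' κ U ζ)
    (hκl : κ ≤ l) : ∀ᵐ t ∂(volume.restrict (Ioo 0 T')), ∀ᵐ x ∂(volume.restrict Ω),
      max (ζ (x, t) * U (x, t) - l) 0 = max (U (x, t) - l) 0 ∧
      {z | l < ζ z * U z}.indicator (fun z => ζ z • ux z + U z • spaceGrad ζ z) (x, t) =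
        {z | l < U z}.indicator ux (x, t) := by
  have h := hζ.eq_one
  rw [restrict_cylinder] at h
  filter_upwards [ae_slice_of_ae_prod h] with t ht
  filter_upwards [ht] with x hx
  rcases le_or_gt (U (x, t)) l with hle | hlt
  · have h1 : ζ (x, t) * U (x, t) ≤ l := by
      rcases le_or_gt (U (x, t)) 0 with h0 | h0
      · exact (mul_nonpos_of_nonneg_of_nonpos (hζ.nonneg _) h0).trans (hκ.le.trans hκl)
      · exact (mul_le_of_le_one_left h0.le (hζ.le_one _)).trans hle
    rw [max_eq_right (by linarith), max_eq_right (by linarith),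
      indicator_of_notMem (show (x, t) ∉ {z | l < ζ z * U z} from not_lt.2 h1),
      indicator_of_notMem (show (x, t) ∉ {z | l < U z} from not_lt.2 hle)]
    exact ⟨rfl, rfl⟩
  · obtain ⟨h1, h2, -⟩ := hx (hκl.trans_lt hlt)
    rw [indicator_of_mem (show (x, t) ∈ {z | l < U z} from hlt),
      indicator_of_mem (show (x, t) ∈ {z | l < ζ z * U z} by
        simpa only [mem_ofPred_eq, h1, one_mul] using hlt), h1, h2]
    simp

/-- `U` itself is not a limit of test functions, but the truncation of `ζ U` is. On almost every
slice before `T'` it agrees with `(U - l)₊`, gradients included. -/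
theorem ae_sliceGN {θ R : ℝ} {C : ℝ≥0} (gn : IsGagliardoNirenberg n θ R C) (hΩ : IsOpen Ω)
    (hκ : 0 < κ) (hS : IsControlledSubsolution Ω T a κ U ux X Y Θ)
    (hζ : IsLevelCutoff Ω T T' κ U ζ) (hκl : κ ≤ l) :
    ∀ᵐ t ∂(volume.restrict (Ioo 0 T')),
      SliceGN n R C Ω (fun x => ‖max (U (x, t) - l) 0‖ₑ) (levelGrad Ω U ux l t) := by
  have hW := (hS.energy.isSobolevLimit_cutoff hΩ hζ.test).truncate (hκ.trans_le hκl)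
  have h0 : ∀ x t, x ∉ Ω → ζ (x, t) = 0 := fun x t hx =>
    image_eq_zero_of_notMem_tsupport fun h => hx (hζ.test.2.2 h).1
  have hl : 0 < l := hκ.trans_le hκl
  have hgn := ae_restrict_of_ae (s := Ioo 0 T') (hW.ae_sliceGN gn (fun x t hx => by
    simp [h0 x t hx, hl.le]) hΩ.measurableSet)
  filter_upwards [hgn, ae_truncate_eq (ux := ux) hκ hζ hκl] with t h1 h2
  have e1 : ∀ {p : ℝ}, ∫⁻ x in Ω, ‖max (ζ (x, t) * U (x, t) - l) 0‖ₑ ^ p =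
      ∫⁻ x in Ω, ‖max (U (x, t) - l) 0‖ₑ ^ p := by
    intro p
    refine lintegral_congr_ae ?_
    filter_upwards [h2] with x hx
    rw [hx.1]
  have e2 : ∫⁻ x, ‖{z | l < ζ z * U z}.indicator
      (fun z => ζ z • ux z + U z • spaceGrad ζ z) (x, t)‖ₑ ^ 2 = levelGrad Ω U ux l t := by
    have e3 : ∀ F : Space n → ℝ≥0∞, (∀ x ∉ Ω, F x = 0) → ∫⁻ x, F x = ∫⁻ x in Ω, F x := by
      intro F hF
      rw [← lintegral_indicator hΩ.measurableSet]
      refine lintegral_congr fun x => ?_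
      by_cases hx : x ∈ Ω
      · rw [indicator_of_mem hx]
      · rw [indicator_of_notMem hx, hF x hx]
    rw [levelGrad, e3 _ fun x hx => ?_]
    · refine lintegral_congr_ae ?_
      filter_upwards [h2] with x hx
      rw [hx.2]
    · rw [indicator_of_notMem (by simp [h0 x t hx, hl.le])]
      simp
  rw [e2] at h1
  unfold SliceGN at h1 ⊢
  have e1' := e1 (p := 2)
  simp only [ENNReal.rpow_two] at e1'
  rwa [e1, e1'] at h1

/-- A purely qualitative bound: it supplies the finiteness needed for absorption in Gronwall's
inequality, and its value does not enter the final constant. -/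
theorem exists_levelMass_le (hT' : T' ≤ T) (hκ : 0 < κ)
    (hS : IsControlledSubsolution Ω T a κ U ux X Y Θ) (hζ : IsLevelCutoff Ω T T' κ U ζ) :
    ∃ M : ℝ≥0∞, M < ∞ ∧ ∀ᵐ t ∂(volume.restrict (Ioo 0 T')), levelMass Ω U κ t ≤ M := by
  obtain ⟨M, hM, h⟩ := hS.energy.1.exists_slice_bound hζ.test.2.1 hζ.test.2.2
  refine ⟨M, hM, ?_⟩
  filter_upwards [ae_restrict_of_ae_restrict_of_subset (Ioo_subset_Ioo_right hT') h,
    ae_truncate_eq (ux := ux) hκ hζ le_rfl] with t ht h2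
  refine le_trans (lintegral_mono_ae ?_) ht
  filter_upwards [h2] with x hx
  rw [← hx.1]
  gcongr
  by_cases hz : (x, t) ∈ tsupport ζ
  · rw [indicator_of_mem hz, enorm_le_iff_norm_le, Real.norm_of_nonneg (le_max_right _ _)]
    refine max_le ?_ (norm_nonneg _)
    have : ζ (x, t) * U (x, t) ≤ ‖U (x, t)‖ := (le_abs_self _).trans (by
      rw [abs_mul, abs_of_nonneg (hζ.nonneg _)]
      exact mul_le_of_le_one_left (abs_nonneg _) (hζ.le_one _))
    linarith
  · rw [image_eq_zero_of_notMem_tsupport hz]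
    simp [hκ.le]

end IsControlledSubsolution

end

/-! ### Finite families of subcritical coefficients -/

section

variable {n : ℕ} {Ω : Set (Space n)} {T : ℝ}

/-- The kernel estimates for finitely many subcritical coefficients. -/
theorem exists_sum_kernel (hn : 1 ≤ n) {θ R : ℝ} {C : ℝ≥0} (hθ : 0 < θ) (hθ' : θ < 1)
    (gn : IsGagliardoNirenberg n θ R C) {ι : Type*} [Fintype ι] {κ : ι → ℝ≥0∞}
    {β : ι → Space n × ℝ → ℝ} (hβ : ∀ i, IsSubcritical n θ Ω T (κ i) (β i)) :
    ∃ K : ℝ → ℝ≥0∞, AEMeasurable K (volume.restrict (Ioo 0 T)) ∧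
      ∫⁻ t in Ioo 0 T, K t ≤ ∑ i, κ i ∧ ∀ᵐ t ∂(volume.restrict (Ioo 0 T)),
        (∫⁻ x in Ω, ∑ i, ‖β i (x, t)‖ₑ ^ 2 ≤ K t * (1 + volume Ω)) ∧
        ∀ h : Space n → ℝ≥0∞, AEMeasurable h (volume.restrict Ω) → ∀ D, SliceGN n R C Ω h D →
          (∀ ε : ℝ≥0, 0 < ε → ε ≤ 1 → ∫⁻ x in Ω, (∑ i, ‖β i (x, t)‖ₑ ^ 2) * h x ^ 2 ≤
            Fintype.card ι * (ε * D) + absorbConst θ R C ε * K t * ∫⁻ x in Ω, h x ^ 2) ∧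
          (∀ E, ∫⁻ x in Ω, h x ^ 2 ≤ E →
            ∫⁻ x in Ω, (∑ i, ‖β i (x, t)‖ₑ ^ 2) * (h x ^ (1 + θ / n)) ^ 2 ≤
              interpConst R C * E ^ (θ / n) * (K t * E + Fintype.card ι * D)) := by
  choose K hKm hK1 hK2 using fun i => (hβ i).exists_kernel hn hθ hθ' gn
  refine ⟨fun t => ∑ i, K i t, Finset.aemeasurable_fun_sum _ fun i _ => hKm i, ?_, ?_⟩
  · rw [lintegral_finsetSum' _ fun i _ => hKm i]
    exact Finset.sum_le_sum fun i _ => hK1 i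
  have hm : ∀ i, ∀ᵐ t ∂(volume.restrict (Ioo 0 T)),
      AEMeasurable (fun x => ‖β i (x, t)‖ₑ ^ 2) (volume.restrict Ω) := by
    intro i
    have := (hβ i).meas
    rw [restrict_cylinder] at this
    filter_upwards [aestronglyMeasurable_slice this] with t ht
    exact ht.enorm.pow_const 2
  filter_upwards [ae_all_iff.2 hK2, ae_all_iff.2 hm] with t ht hmt
  refine ⟨?_, fun h hh D hD => ⟨fun ε hε hε1 => ?_, fun E hE => ?_⟩⟩
  · rw [lintegral_finsetSum' _ fun i _ => hmt i, Finset.sum_mul]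
    exact Finset.sum_le_sum fun i _ => (ht i).1
  · simp only [Finset.sum_mul]
    rw [lintegral_finsetSum' _ fun i _ => show AEMeasurable
      (fun x => ‖β i (x, t)‖ₑ ^ 2 * h x ^ 2) _ from (hmt i).mul (hh.pow_const 2)]
    refine (Finset.sum_le_sum fun i _ => ((ht i).2 h hh D hD).1 ε hε hε1).trans (le_of_eq ?_)
    rw [Finset.sum_add_distrib, Finset.sum_const, Finset.card_univ, nsmul_eq_mul,
      Finset.mul_sum, Finset.sum_mul]
  · simp only [Finset.sum_mul]
    rw [lintegral_finsetSum' _ fun i _ => show AEMeasurable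
      (fun x => ‖β i (x, t)‖ₑ ^ 2 * (h x ^ (1 + θ / n)) ^ 2) _ from
        (hmt i).mul ((hh.pow_const _).pow_const 2)]
    refine (Finset.sum_le_sum fun i _ => ((ht i).2 h hh D hD).2 E hE).trans (le_of_eq ?_)
    rw [← Finset.mul_sum, Finset.sum_add_distrib, Finset.sum_const, Finset.card_univ,
      nsmul_eq_mul]

section

variable {ι : Type*} [Fintype ι] {β : ι → Space n × ℝ → ℝ} {U : Space n × ℝ → ℝ} {c : ℝ}

theorem ofReal_sum_sq_mul (hc : 0 ≤ c) (z : Space n × ℝ) {r : ℝ} :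
    ENNReal.ofReal (c * (∑ i, β i z ^ 2) * r) =
      ENNReal.ofReal c * ((∑ i, ‖β i z‖ₑ ^ 2) * ENNReal.ofReal r) := by
  rw [ENNReal.ofReal_mul (mul_nonneg hc (Finset.sum_nonneg fun i _ => sq_nonneg _)),
    ENNReal.ofReal_mul hc, ENNReal.ofReal_sum_of_nonneg fun i _ => sq_nonneg _, mul_assoc]
  congr 2
  refine Finset.sum_congr rfl fun i _ => ?_
  rw [Real.enorm_eq_ofReal_abs, ← ENNReal.ofReal_pow (abs_nonneg _), sq_abs]

/-- From `U ^ 2 ≤ 2 (U - κ) ^ 2 + 2 κ ^ 2`. The second term is the only inhomogeneity left in the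
problem, and makes the initial bound proportional to `κ ^ 2`. -/
theorem levelSource_le (hc : 0 ≤ c) {κ t : ℝ}
    (hκ : 0 ≤ κ) (hβ : ∀ i, AEMeasurable (fun x => ‖β i (x, t)‖ₑ ^ 2) (volume.restrict Ω))
    (hU : AEMeasurable (fun x => ‖max (U (x, t) - κ) 0‖ₑ) (volume.restrict Ω)) :
    levelSource Ω U (fun z => c * ∑ i, β i z ^ 2) κ t ≤ ENNReal.ofReal c *
      (2 * (∫⁻ x in Ω, (∑ i, ‖β i (x, t)‖ₑ ^ 2) * ‖max (U (x, t) - κ) 0‖ₑ ^ 2) +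
        2 * ENNReal.ofReal κ ^ 2 * ∫⁻ x in Ω, ∑ i, ‖β i (x, t)‖ₑ ^ 2) := by
  have hb : AEMeasurable (fun x => ∑ i, ‖β i (x, t)‖ₑ ^ 2) (volume.restrict Ω) :=
    Finset.aemeasurable_fun_sum _ fun i _ => hβ i
  have hbU : AEMeasurable (fun x => (∑ i, ‖β i (x, t)‖ₑ ^ 2) * ‖max (U (x, t) - κ) 0‖ₑ ^ 2)
      (volume.restrict Ω) := hb.mul (hU.pow_const 2)
  rw [← lintegral_const_mul'' _ hbU, ← lintegral_const_mul'' _ hb,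
    ← lintegral_add_left' (hbU.const_mul _),
    ← lintegral_const_mul' _ _ ENNReal.ofReal_ne_top]
  refine lintegral_mono fun x => ?_
  by_cases hx : (x, t) ∈ {z | κ < U z}
  · have hx' : κ < U (x, t) := hx
    rw [indicator_of_mem hx, ofReal_sum_sq_mul hc]
    gcongr
    have : ENNReal.ofReal (U (x, t) ^ 2) ≤
        2 * ‖max (U (x, t) - κ) 0‖ₑ ^ 2 + 2 * ENNReal.ofReal κ ^ 2 := by
      rw [max_eq_left (by linarith), Real.enorm_of_nonneg (by linarith),
        ← ENNReal.ofReal_pow (by linarith), ← ENNReal.ofReal_pow hκ, ← ENNReal.ofReal_ofNat 2,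
        ← ENNReal.ofReal_mul (by norm_num), ← ENNReal.ofReal_mul (by norm_num),
        ← ENNReal.ofReal_add (by positivity) (by positivity)]
      refine ENNReal.ofReal_le_ofReal ?_
      nlinarith [sq_nonneg (U (x, t) - 2 * κ)]
    calc _ ≤ (∑ i, ‖β i (x, t)‖ₑ ^ 2) *
          (2 * ‖max (U (x, t) - κ) 0‖ₑ ^ 2 + 2 * ENNReal.ofReal κ ^ 2) := by gcongr
      _ = _ := by ring
  · rw [indicator_of_notMem hx]; simp

/-- Where `U > l + δ`, the height `h = U - l` exceeds `δ`, so `U ≤ (1 + l / δ) h` and `1 ≤ (h / δ) ^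
(2 σ)`. Raising the level thus trades the power two of `U` for the power `2 (1 + σ)` of `h`, on
which the superlinear estimate acts. -/
theorem levelSource_add_le (hc : 0 ≤ c) {l δ σ t : ℝ} (hl : 0 ≤ l) (hδ : 0 < δ) (hσ : 0 ≤ σ) :
    levelSource Ω U (fun z => c * ∑ i, β i z ^ 2) (l + δ) t ≤
      ENNReal.ofReal (c * ((1 + l / δ) ^ 2 * δ ^ (-(2 * σ)))) *
        ∫⁻ x in Ω, (∑ i, ‖β i (x, t)‖ₑ ^ 2) * (‖max (U (x, t) - l) 0‖ₑ ^ (1 + σ)) ^ 2 := by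
  rw [← lintegral_const_mul' _ _ ENNReal.ofReal_ne_top]
  refine lintegral_mono fun x => ?_
  by_cases hx : (x, t) ∈ {z | l + δ < U z}
  · have hx' : l + δ < U (x, t) := hx
    have hh : δ ≤ U (x, t) - l := by linarith
    have hh0 : 0 < U (x, t) - l := hδ.trans_le hh
    rw [indicator_of_mem hx, ofReal_sum_sq_mul hc, ENNReal.ofReal_mul hc, mul_assoc]
    refine mul_le_mul_right ?_ _
    rw [mul_left_comm]
    refine mul_le_mul_right ?_ _
    rw [max_eq_left hh0.le, Real.enorm_of_nonneg hh0.le, ENNReal.ofReal_rpow_of_pos hh0,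
      ← ENNReal.ofReal_pow (by positivity), ← ENNReal.ofReal_mul (by positivity)]
    refine ENNReal.ofReal_le_ofReal ?_
    set h := U (x, t) - l with hdef
    have e1 : U (x, t) ≤ (1 + l / δ) * h := by
      have : l ≤ l / δ * h := by
        rw [div_mul_eq_mul_div, le_div_iff₀ hδ]
        gcongr
      rw [add_mul, one_mul]; linarith
    have e2 : (h ^ (1 + σ)) ^ 2 = h ^ 2 * h ^ (2 * σ) := by
      rw [← Real.rpow_natCast, ← Real.rpow_mul hh0.le, ← Real.rpow_natCast h 2,
        ← Real.rpow_add hh0]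
      congr 1; push_cast; ring
    have e3 : 1 ≤ δ ^ (-(2 * σ)) * h ^ (2 * σ) := by
      rw [Real.rpow_neg hδ.le, inv_mul_eq_div, one_le_div (by positivity)]
      gcongr
    have hU0 : 0 ≤ U (x, t) := by linarith
    calc U (x, t) ^ 2 ≤ ((1 + l / δ) * h) ^ 2 := by gcongr
      _ = (1 + l / δ) ^ 2 * h ^ 2 * 1 := by ring
      _ ≤ (1 + l / δ) ^ 2 * h ^ 2 * (δ ^ (-(2 * σ)) * h ^ (2 * σ)) := by gcongr
      _ = _ := by rw [e2]; ring
  · rw [indicator_of_notMem hx]; simp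

end

end

section

/-! ### Integral inequalities in time -/

theorem lintegral_Ioo_add {f : ℝ → ℝ≥0∞} {r s t : ℝ} (hs : r ≤ s) (hst : s ≤ t) :
    ∫⁻ x in Ioo r t, f x = (∫⁻ x in Ioo r s, f x) + ∫⁻ x in Ioo s t, f x := by
  rw [setLIntegral_congr (Ioo_ae_eq_Ioc (a := r) (b := t)),
    setLIntegral_congr (Ioo_ae_eq_Ioc (a := r) (b := s)),
    setLIntegral_congr (Ioo_ae_eq_Ioc (a := s) (b := t)), ← Ioc_union_Ioc_eq_Ioc hs hst,
    lintegral_union measurableSet_Ioc (Ioc_disjoint_Ioc_of_le le_rfl)]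

/-- The intermediate value theorem for the primitive of `K`, which is continuous because `K` is
integrable. -/
theorem exists_lintegral_Ioo_eq {K : ℝ → ℝ≥0∞} {t : ℝ} (ht : 0 ≤ t)
    (hKm : AEMeasurable K (volume.restrict (Ioo 0 t))) (hK : ∫⁻ x in Ioo 0 t, K x ≠ ∞)
    {m : ℝ≥0∞} (hm : m ≤ ∫⁻ x in Ioo 0 t, K x) :
    ∃ s ∈ Icc 0 t, ∫⁻ x in Ioo 0 s, K x = m := by
  set g : ℝ → ℝ := fun s => ∫ x in (0)..s, (K x).toReal with hg
  have hKi : IntegrableOn (fun x => (K x).toReal) (Ioo 0 t) :=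
    integrable_toReal_of_lintegral_ne_top hKm hK
  have hgc : ContinuousOn g (Icc 0 t) := by
    have := intervalIntegral.continuousOn_primitive_interval (μ := volume) (a := 0) (b := t)
      (f := fun x => (K x).toReal) (by rwa [uIcc_of_le ht, integrableOn_Icc_iff_integrableOn_Ioo])
    rwa [uIcc_of_le ht] at this
  have hG : ∀ s ∈ Icc 0 t, ∫⁻ x in Ioo 0 s, K x = ENNReal.ofReal (g s) := by
    intro s hs
    have hsub : Ioo 0 s ⊆ Ioo 0 t := Ioo_subset_Ioo_right hs.2
    rw [hg]
    simp only
    rw [intervalIntegral.integral_of_le hs.1, integral_Ioc_eq_integral_Ioo,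
      ofReal_integral_eq_lintegral_ofReal (hKi.mono_set hsub)
        (ae_of_all _ fun x => ENNReal.toReal_nonneg)]
    refine lintegral_congr_ae ?_
    filter_upwards [ae_restrict_of_ae_restrict_of_subset hsub (ae_lt_top' hKm hK)] with x hx
    rw [ENNReal.ofReal_toReal hx.ne]
  have hmf : m ≠ ∞ := ne_top_of_le_ne_top hK hm
  have hivt := intermediate_value_Icc ht hgc
  have hmem : m.toReal ∈ Icc (g 0) (g t) := by
    refine ⟨by simp [hg], ?_⟩
    rw [hG t ⟨ht, le_rfl⟩] at hm
    refine ENNReal.toReal_le_of_le_ofReal ?_ hm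
    exact intervalIntegral.integral_nonneg ht fun x _ => ENNReal.toReal_nonneg
  obtain ⟨s, hs, hsm⟩ := hivt hmem
  exact ⟨s, hs, by rw [hG s hs, hsm, ENNReal.ofReal_toReal hmf]⟩

/-- Absorption of half of `A` into the left side, which requires `A` to be finite. -/
theorem add_le_two_mul_of_le_add_half {A B c : ℝ≥0∞} (hc : c ≠ ∞) (hA : A ≠ ∞)
    (h : A ≤ B + 1 / 2 * (c + A)) : c + A ≤ 2 * (c + B) := by
  rcases eq_or_ne B ∞ with hB | hB
  · simp [hB]
  lift A to ℝ≥0 using hA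
  lift B to ℝ≥0 using hB
  lift c to ℝ≥0 using hc
  have h2 : A ≤ B + 1 / 2 * (c + A) := by
    have : (1 / 2 : ℝ≥0∞) = ((1 / 2 : ℝ≥0) : ℝ≥0∞) := by simp
    rw [this] at h
    exact_mod_cast h
  have h3 : c + A ≤ 2 * (c + B) := by
    rw [← NNReal.coe_le_coe] at h2 ⊢
    push_cast at h2 ⊢
    linarith
  exact_mod_cast h3

/-- A Gronwall inequality with an integrable kernel. -/
theorem lintegral_gronwall {K z : ℝ → ℝ≥0∞} {c : ℝ≥0∞} {t₁ : ℝ}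
    (hKm : AEMeasurable K (volume.restrict (Ioo 0 t₁)))
    (hfin : ∫⁻ x in Ioo 0 t₁, K x * z x ≠ ∞)
    (hz : ∀ᵐ τ ∂(volume.restrict (Ioo 0 t₁)), z τ ≤ c + ∫⁻ x in Ioo 0 τ, K x * z x)
    (N : ℕ) (hN : ∫⁻ x in Ioo 0 t₁, K x ≤ N / 2) :
    c + ∫⁻ x in Ioo 0 t₁, K x * z x ≤ 2 ^ N * c := by
  rcases lt_or_ge t₁ 0 with h0 | h0
  · rw [Ioo_eq_empty (not_lt.2 h0.le), Measure.restrict_empty, lintegral_zero_measure, add_zero]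
    exact le_mul_of_one_le_left' (one_le_pow₀ one_le_two)
  -- Induction on the number of pieces of kernel mass one half. On the last piece `z` is at most `c`
  -- plus the whole integral `A`, so the piece contributes at most half of `c + A`; absorbing this
  -- costs a factor two.
  suffices H : ∀ N : ℕ, ∀ t ∈ Icc 0 t₁, ∫⁻ x in Ioo 0 t, K x ≤ N / 2 →
      c + ∫⁻ x in Ioo 0 t, K x * z x ≤ 2 ^ N * c from H N t₁ ⟨h0, le_rfl⟩ hN
  intro N
  induction N with
  | zero =>
    intro t ht hG
    have hsub : Ioo 0 t ⊆ Ioo 0 t₁ := Ioo_subset_Ioo_right ht.2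
    have h1 : ∫⁻ x in Ioo 0 t, K x = 0 := by simpa using hG
    rw [lintegral_eq_zero_iff' (hKm.mono_set hsub)] at h1
    have h2 : ∫⁻ x in Ioo 0 t, K x * z x = 0 := by
      rw [← lintegral_zero (μ := volume.restrict (Ioo 0 t))]
      refine lintegral_congr_ae ?_
      filter_upwards [h1] with x hx
      rw [hx]; simp
    rw [h2]; simp
  | succ N ih =>
    intro t ht hG
    have hsub : Ioo 0 t ⊆ Ioo 0 t₁ := Ioo_subset_Ioo_right ht.2
    have hGt : ∫⁻ x in Ioo 0 t, K x ≠ ∞ := ne_top_of_le_ne_top (by finiteness) hG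
    obtain ⟨s, hs, hsG⟩ := exists_lintegral_Ioo_eq ht.1 (hKm.mono_set hsub) hGt
      (min_le_right ((N : ℝ≥0∞) / 2) (∫⁻ x in Ioo 0 t, K x))
    have hS := ih s ⟨hs.1, hs.2.trans ht.2⟩ (hsG.le.trans (min_le_left _ _))
    have hK2 : ∫⁻ x in Ioo s t, K x ≤ 1 / 2 := by
      have h1 := lintegral_Ioo_add (f := K) hs.1 hs.2
      rw [hsG] at h1
      rcases le_total ((N : ℝ≥0∞) / 2) (∫⁻ x in Ioo 0 t, K x) with h | h
      · rw [min_eq_left h] at h1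
        rw [h1] at hG
        refine (ENNReal.add_le_add_iff_left (a := (N : ℝ≥0∞) / 2) (by finiteness)).1 (hG.trans ?_)
        rw [← ENNReal.add_div]; push_cast; exact le_rfl
      · rw [min_eq_right h] at h1
        have : (∫⁻ x in Ioo 0 t, K x) + ∫⁻ x in Ioo s t, K x ≤ (∫⁻ x in Ioo 0 t, K x) + 0 := by
          rw [add_zero]; exact h1.ge
        exact ((ENNReal.add_le_add_iff_left hGt).1 this).trans zero_le
    rcases eq_or_ne c ∞ with hc | hc
    · rw [hc, ENNReal.mul_top (by simp)]; exact le_top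
    set A := ∫⁻ x in Ioo 0 t, K x * z x with hA
    set B := ∫⁻ x in Ioo 0 s, K x * z x with hB
    have hAf : A ≠ ∞ := ne_top_of_le_ne_top hfin (lintegral_mono_set hsub)
    have hAB : A ≤ B + 1 / 2 * (c + A) := by
      refine (lintegral_Ioo_add (f := fun x => K x * z x) hs.1 hs.2).le.trans ?_
      refine add_le_add_right ?_ _
      calc ∫⁻ x in Ioo s t, K x * z x ≤ ∫⁻ x in Ioo s t, K x * (c + A) := by
            refine setLIntegral_mono_ae' measurableSet_Ioo ?_
            rw [ae_restrict_iff' measurableSet_Ioo] at hz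
            filter_upwards [hz] with x hx hxs
            gcongr
            refine (hx ⟨hs.1.trans_lt hxs.1, hxs.2.trans_le ht.2⟩).trans ?_
            gcongr
            exact lintegral_mono_set (Ioo_subset_Ioo_right hxs.2.le)
        _ = (∫⁻ x in Ioo s t, K x) * (c + A) := lintegral_mul_const' _ _ (by finiteness)
        _ ≤ _ := by gcongr
    calc c + A ≤ 2 * (c + B) := add_le_two_mul_of_le_add_half hc hAf hAB
      _ ≤ 2 * (2 ^ N * c) := by gcongr
      _ = 2 ^ (N + 1) * c := by ring

/-- The integrals increase to the one over the full interval as `τ` increases to `t₁`, and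
admissible times lie arbitrarily close to `t₁`. This recovers the whole gradient integral from
energy inequalities at almost every time. -/
theorem lintegral_Ioo_le_of_ae {f : ℝ → ℝ≥0∞} {t₁ : ℝ} {b : ℝ≥0∞}
    (h : ∀ᵐ τ ∂(volume.restrict (Ioo 0 t₁)), ∫⁻ x in Ioo 0 τ, f x ≤ b) :
    ∫⁻ x in Ioo 0 t₁, f x ≤ b := by
  rcases le_or_gt t₁ 0 with h0 | h0
  · rw [Ioo_eq_empty (not_lt.2 h0)]; simp
  obtain ⟨u, hu, hut, hulim⟩ := exists_seq_strictMono_tendsto t₁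
  have hU : Ioo 0 t₁ = ⋃ k, Ioo 0 (u k) := by
    ext x
    simp only [mem_iUnion, mem_Ioo]
    refine ⟨fun hx => ?_, fun ⟨k, hk⟩ => ⟨hk.1, hk.2.trans (hut k)⟩⟩
    obtain ⟨k, hk⟩ := (hulim.eventually_const_lt hx.2).exists
    exact ⟨k, hx.1, hk⟩
  rw [hU, setLIntegral_iUnion_of_directed _ (Monotone.directed_le fun i j hij =>
    Ioo_subset_Ioo_right (hu.monotone hij))]
  refine iSup_le fun k => ?_
  have hlt : max (u k) 0 < t₁ := max_lt (hut k) h0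
  have hsub : Ioo (max (u k) 0) t₁ ⊆ Ioo 0 t₁ := Ioo_subset_Ioo_left (le_max_right _ _)
  have h' := ae_restrict_of_ae_restrict_of_subset hsub h
  have hne : (ae (volume.restrict (Ioo (max (u k) 0) t₁))).NeBot := by
    rw [ae_neBot, Measure.restrict_eq_zero.ne, Real.volume_Ioo, ne_eq, ENNReal.ofReal_eq_zero]
    linarith
  obtain ⟨τ, hτ, hτm⟩ := (h'.and (ae_restrict_mem measurableSet_Ioo)).exists
  exact (lintegral_mono_set (Ioo_subset_Ioo_right ((le_max_left _ _).trans hτm.1.le))).trans hτ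

/-! ### The iteration -/

/-- The factor by which the level has to be raised. -/
noncomputable def levelFactor (σ C A : ℝ) : ℝ :=
  max 1 ((256 * C * A ^ σ * 16 ^ (1 / σ)) ^ (1 / (2 * σ)))

/-- De Giorgi's iteration. -/
theorem deGiorgi {P : ℝ → ℝ → Prop} {σ C A κ : ℝ} (hσ : 0 < σ) (hσ1 : σ ≤ 1) (hC : 0 < C)
    (hA : 0 < A) (hκ : 0 < κ) (h0 : ∀ l, κ ≤ l → P l (A * κ ^ 2))
    (hstep : ∀ l δ e, κ ≤ l → 0 < δ → 0 ≤ e → P l e →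
      P (l + δ) (C * ((1 + l / δ) ^ 2 * δ ^ (-(2 * σ))) * e ^ (1 + σ)))
    (hmono : ∀ l l' e e', l ≤ l' → e ≤ e' → P l e → P l' e') {ε : ℝ} (hε : 0 < ε) :
    P (2 * levelFactor σ C A * κ) ε := by
  set Λ := levelFactor σ C A with hΛ
  have hΛ1 : 1 ≤ Λ := le_max_left _ _
  -- At stage `j` the factors `(1 + l / δ) ^ 2` and `δ ^ (-(2 * σ))` each cost `4 ^ j`. The choice
  -- `ρ ^ σ = 1 / 16` lets the extra power of the previous bound cancel both; `levelFactor` is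
  -- chosen so that the remaining constant is at most `ρ`.
  set ρ : ℝ := (16 ^ (1 / σ))⁻¹ with hρ
  have h16 : (1 : ℝ) < 16 ^ (1 / σ) := Real.one_lt_rpow (by norm_num) (by positivity)
  have hρ0 : 0 < ρ := by positivity
  have hρ1 : ρ < 1 := inv_lt_one_of_one_lt₀ h16
  have hρσ : ρ ^ σ = 1 / 16 := by
    rw [hρ, Real.inv_rpow (by positivity), ← Real.rpow_mul (by norm_num), one_div_mul_cancel hσ.ne']
    norm_num
  set L := Λ * κ with hL
  have hΛ0 : 0 < Λ := by linarith
  have hL0 : 0 < L := by positivity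
  have hκL : κ ≤ L := le_mul_of_one_le_left hκ.le hΛ1
  have hkey : 256 * C * A ^ σ * Λ ^ (-(2 * σ)) ≤ ρ := by
    have h1 : 256 * C * A ^ σ * 16 ^ (1 / σ) ≤ Λ ^ (2 * σ) := by
      calc 256 * C * A ^ σ * 16 ^ (1 / σ)
          = ((256 * C * A ^ σ * 16 ^ (1 / σ)) ^ (1 / (2 * σ))) ^ (2 * σ) := by
            rw [← Real.rpow_mul (by positivity), one_div_mul_cancel (by positivity), Real.rpow_one]
        _ ≤ Λ ^ (2 * σ) := by
            gcongr
            exact le_max_right _ _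
    rw [Real.rpow_neg hΛ0.le, hρ, ← div_eq_mul_inv, div_le_iff₀ (by positivity),
      inv_mul_eq_div, le_div_iff₀ (by positivity)]
    exact h1
  -- The levels climb from `L` to `2 * L` with increments halved at each stage, while the bounds
  -- decay geometrically. The number 256 in `hkey` is the product of the constants 64 and 4 found
  -- below.
  have hrec : ∀ j : ℕ, P (L * (2 - (1 / 2) ^ j)) (A * κ ^ 2 * ρ ^ j) := by
    intro j
    induction j with
    | zero => simpa using h0 _ (by simpa [show (2 : ℝ) - 1 = 1 by norm_num] using hκL)
    | succ j ih =>
      have hhalf : (0 : ℝ) < (1 / 2) ^ j := by positivity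
      have hhalf1 : ((1 : ℝ) / 2) ^ j ≤ 1 := pow_le_one₀ (by norm_num) (by norm_num)
      set l := L * (2 - (1 / 2) ^ j) with hl
      set δ := L * (1 / 2) ^ (j + 1) with hδ
      have hδ0 : 0 < δ := by positivity
      have hκl : κ ≤ l := hκL.trans (by rw [hl]; nlinarith)
      have h := hstep l δ _ hκl hδ0 (by positivity) ih
      have hlδ : l + δ = L * (2 - (1 / 2) ^ (j + 1)) := by rw [hl, hδ, pow_succ]; ring
      rw [hlδ] at h
      refine hmono _ _ _ _ le_rfl ?_ h
      have b1 : (1 + l / δ) ^ 2 ≤ 64 * 4 ^ j := by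
        have h1 : l / δ ≤ 2 * 2 ^ (j + 1) := by
          rw [div_le_iff₀ hδ0, hl, hδ]
          have h5 : (2 : ℝ) ^ (j + 1) * (1 / 2) ^ (j + 1) = 1 := by rw [← mul_pow]; norm_num
          have : (2 : ℝ) * 2 ^ (j + 1) * (L * (1 / 2) ^ (j + 1)) = 2 * L := by
            linear_combination (2 * L) * h5
          rw [this]
          nlinarith
        have h2 : (1 : ℝ) ≤ 2 ^ j := one_le_pow₀ (by norm_num)
        have h3 : 0 ≤ l / δ := by have := hκ.le.trans hκl; positivity
        calc (1 + l / δ) ^ 2 ≤ (8 * 2 ^ j) ^ 2 := by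
              gcongr
              rw [pow_succ] at h1
              linarith
          _ = 64 * 4 ^ j := by rw [mul_pow, ← pow_mul, mul_comm j 2, pow_mul]; norm_num
      have b2 : δ ^ (-(2 * σ)) ≤ L ^ (-(2 * σ)) * (4 * 4 ^ j) := by
        rw [hδ, Real.mul_rpow hL0.le (by positivity)]
        gcongr
        rw [one_div, inv_pow, Real.inv_rpow (by positivity), ← Real.rpow_neg (by positivity), neg_neg]
        calc ((2 : ℝ) ^ (j + 1)) ^ (2 * σ) ≤ (2 ^ (j + 1)) ^ (2 : ℝ) := by
              gcongr
              · exact one_le_pow₀ (by norm_num)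
              · linarith
          _ = 4 * 4 ^ j := by
              rw [Real.rpow_two, ← pow_mul, mul_comm, pow_mul, pow_succ]; norm_num; ring
      have b3 : (A * κ ^ 2 * ρ ^ j) ^ (1 + σ) =
          A * κ ^ 2 * ρ ^ j * (A ^ σ * κ ^ (2 * σ) * (1 / 16) ^ j) := by
        rw [Real.rpow_add (by positivity), Real.rpow_one,
          Real.mul_rpow (by positivity) (by positivity), Real.mul_rpow (by positivity) (by positivity),
          Real.rpow_mul hκ.le, Real.rpow_two, ← hρσ, ← Real.rpow_natCast (ρ ^ σ),
          ← Real.rpow_mul hρ0.le, mul_comm σ, Real.rpow_mul hρ0.le, Real.rpow_natCast]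
      have b4 : L ^ (-(2 * σ)) * κ ^ (2 * σ) = Λ ^ (-(2 * σ)) := by
        rw [hL, Real.mul_rpow hΛ0.le hκ.le, mul_assoc, ← Real.rpow_add hκ]
        simp
      calc C * ((1 + l / δ) ^ 2 * δ ^ (-(2 * σ))) * (A * κ ^ 2 * ρ ^ j) ^ (1 + σ)
          ≤ C * ((64 * 4 ^ j) * (L ^ (-(2 * σ)) * (4 * 4 ^ j))) *
              (A * κ ^ 2 * ρ ^ j * (A ^ σ * κ ^ (2 * σ) * (1 / 16) ^ j)) := by
            rw [b3]; gcongr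
        _ = (256 * C * A ^ σ * (L ^ (-(2 * σ)) * κ ^ (2 * σ))) * (A * κ ^ 2 * ρ ^ j) *
              (4 ^ j * 4 ^ j * (1 / 16) ^ j) := by ring
        _ = (256 * C * A ^ σ * Λ ^ (-(2 * σ))) * (A * κ ^ 2 * ρ ^ j) := by
            rw [b4, ← mul_pow, ← mul_pow]; norm_num
        _ ≤ ρ * (A * κ ^ 2 * ρ ^ j) := by gcongr
        _ = A * κ ^ 2 * ρ ^ (j + 1) := by ring
  have hlim : Tendsto (fun j : ℕ => A * κ ^ 2 * ρ ^ j) atTop (𝓝 0) := by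
    simpa using (tendsto_pow_atTop_nhds_zero_of_lt_one hρ0.le hρ1).const_mul (A * κ ^ 2)
  obtain ⟨j, hj⟩ := (hlim.eventually_lt_const hε).exists
  refine hmono _ _ _ _ ?_ hj.le (hrec j)
  have : (0 : ℝ) ≤ (1 / 2) ^ j := by positivity
  rw [mul_assoc]
  nlinarith

end

/-! ### Bounds above a level: initial estimate, improvement, conclusion -/

section

theorem ENNReal_le_ofReal_div {X : ℝ≥0∞} {p q : ℝ} (hp : 0 < p)
    (h : ENNReal.ofReal p * X ≤ ENNReal.ofReal q) : X ≤ ENNReal.ofReal (q / p) := by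
  rw [ENNReal.ofReal_div_of_pos hp, ENNReal.le_div_iff_mul_le (Or.inl (by simpa using hp))
    (Or.inl ENNReal.ofReal_ne_top), mul_comm]
  exact h

variable {n : ℕ} {Ω : Set (Space n)} {T : ℝ}

/-- The bounds on slice integrals propagated by the iteration. -/
def LevelBound (Ω : Set (Space n)) (T' : ℝ) (U : Space n × ℝ → ℝ) (ux : Space n × ℝ → Space n)
    (l e : ℝ) : Prop :=
  (∀ᵐ τ ∂(volume.restrict (Ioo 0 T')), levelMass Ω U l τ ≤ ENNReal.ofReal e) ∧
    ∫⁻ t in Ioo 0 T', levelGrad Ω U ux l t ≤ ENNReal.ofReal e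

theorem LevelBound.mono {T' : ℝ} {U : Space n × ℝ → ℝ} {ux : Space n × ℝ → Space n}
    {l l' e e' : ℝ} (hl : l ≤ l') (he : e ≤ e') (h : LevelBound Ω T' U ux l e) :
    LevelBound Ω T' U ux l' e' := by
  refine ⟨?_, ?_⟩
  · filter_upwards [h.1] with τ hτ
    exact ((antitone_levelMass τ hl).trans hτ).trans (ENNReal.ofReal_le_ofReal he)
  · exact ((lintegral_mono fun t => antitone_levelGrad t hl).trans h.2).trans
      (ENNReal.ofReal_le_ofReal he)

theorem LevelBound.of_energy {T' a l q : ℝ} {U : Space n × ℝ → ℝ} {ux : Space n × ℝ → Space n}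
    (ha : 0 < a) (hq : 0 ≤ q) (h : ∀ᵐ τ ∂(volume.restrict (Ioo 0 T')),
      levelMass Ω U l τ + ENNReal.ofReal a * ∫⁻ t in Ioo 0 τ, levelGrad Ω U ux l t ≤
        ENNReal.ofReal q) : LevelBound Ω T' U ux l (q * max 1 (1 / a)) := by
  refine ⟨?_, lintegral_Ioo_le_of_ae ?_⟩
  · filter_upwards [h] with τ hτ
    refine (le_self_add.trans hτ).trans (ENNReal.ofReal_le_ofReal ?_)
    exact le_mul_of_one_le_right hq (le_max_left _ _)
  · filter_upwards [h] with τ hτ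
    refine (ENNReal_le_ofReal_div ha (le_add_self.trans hτ)).trans (ENNReal.ofReal_le_ofReal ?_)
    rw [div_eq_mul_one_div]
    gcongr
    exact le_max_right _ _

section

variable {ι : Type*} [Fintype ι] {β : ι → Space n × ℝ → ℝ} {κβ : ι → ℝ≥0∞} {U Y ζ : Space n × ℝ → ℝ}
  {ux X : Space n × ℝ → Space n} {a c κ T' θ R : ℝ} {C : ℝ≥0}

theorem aestronglyMeasurable_sum_sq (hβ : ∀ i, IsSubcritical n θ Ω T (κβ i) (β i)) (c : ℝ) :
    AEStronglyMeasurable (fun z => c * ∑ i, β i z ^ 2) (volume.restrict (cylinder Ω T)) :=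
  (Finset.aestronglyMeasurable_fun_sum _ fun i _ => (hβ i).meas.pow 2).const_mul c

namespace IsControlledSubsolution

/-- The initial bound. -/
theorem levelBound_initial (hn : 1 ≤ n) (hθ : 0 < θ) (hθ' : θ < 1)
    (gn : IsGagliardoNirenberg n θ R C) (hΩ : IsOpen Ω) (hT' : T' ≤ T) (hκ : 0 < κ) (ha : 0 < a)
    (hc : 0 ≤ c) (hβ : ∀ i, IsSubcritical n θ Ω T (κβ i) (β i))
    (hS : IsControlledSubsolution Ω T a κ U ux X Y fun z => c * ∑ i, β i z ^ 2)
    (hζ : IsLevelCutoff Ω T T' κ U ζ) {k V : ℝ≥0∞} (hV : V ≠ ∞)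
    (hβk : ∑ i, κβ i ≤ k) (hΩV : volume Ω ≤ V) {ε : ℝ≥0} (hε : 0 < ε) (hε1 : ε ≤ 1)
    (hεa : 8 * c * (Fintype.card ι * ε) ≤ a / 2) {N : ℕ}
    (hN : 8 * ENNReal.ofReal c * (absorbConst θ R C ε + (1 + V)) * k ≤ N / 2) :
    LevelBound Ω T' U ux κ (2 ^ N * κ ^ 2 * max 1 (1 / (a / 2))) := by
  obtain ⟨K, hKm, hKk, hK⟩ := exists_sum_kernel hn hθ hθ' gn hβ
  have hsub : Ioo 0 T' ⊆ Ioo 0 T := Ioo_subset_Ioo_right hT'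
  have hΘ := aestronglyMeasurable_sum_sq hβ c
  set K2 : ℝ → ℝ≥0∞ :=
    fun t => 8 * ENNReal.ofReal c * (absorbConst θ R C ε + (1 + V)) * K t with hK2
  have hK2m : AEMeasurable K2 (volume.restrict (Ioo 0 T')) := (hKm.mono_set hsub).const_mul _
  have hc2 : 8 * ENNReal.ofReal c * (absorbConst θ R C ε + (1 + V)) ≠ ∞ := by finiteness
  have hK2N : ∫⁻ t in Ioo 0 T', K2 t ≤ N / 2 := by
    rw [lintegral_const_mul' _ _ hc2]
    refine le_trans ?_ hN
    gcongr
    exact (lintegral_mono_set hsub).trans (hKk.trans hβk)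
  set q : ℝ≥0∞ := ENNReal.ofReal (κ ^ 2) with hq
  have hβs : ∀ i, ∀ᵐ t ∂(volume.restrict (Ioo 0 T)),
      AEMeasurable (fun x => ‖β i (x, t)‖ₑ ^ 2) (volume.restrict Ω) := by
    intro i
    have := (hβ i).meas
    rw [restrict_cylinder] at this
    filter_upwards [aestronglyMeasurable_slice this] with t ht
    exact ht.enorm.pow_const 2
  have hUs : ∀ᵐ t ∂(volume.restrict (Ioo 0 T)),
      AEMeasurable (fun x => ‖max (U (x, t) - κ) 0‖ₑ) (volume.restrict Ω) := by
    have := hS.aestronglyMeasurable_max (l := κ)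
    rw [restrict_cylinder] at this
    filter_upwards [aestronglyMeasurable_slice this] with t ht
    exact ht.enorm
  -- The factor 8 is the four of the energy inequality times the two of `levelSource_le`, and `hεa`
  -- makes the gradient term at most half of that on the left of the energy inequality. Adding `q`
  -- to the mass lets both share the kernel `K2`.
  have hsrc : ∀ᵐ t ∂(volume.restrict (Ioo 0 T')),
      4 * levelSource Ω U (fun z => c * ∑ i, β i z ^ 2) κ t ≤
        ENNReal.ofReal (a / 2) * levelGrad Ω U ux κ t + K2 t * (levelMass Ω U κ t + q) := by
    filter_upwards [ae_restrict_of_ae_restrict_of_subset hsub hK,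
      ae_restrict_of_ae_restrict_of_subset hsub (ae_all_iff.2 hβs),
      ae_restrict_of_ae_restrict_of_subset hsub hUs,
      hS.ae_sliceGN gn hΩ hκ hζ le_rfl] with t h1 h2 h3 h4
    have h5 := levelSource_le hc hκ.le h2 h3
    have h6 := (h1.2 _ h3 _ h4).1 ε hε hε1
    have h7 : ENNReal.ofReal κ ^ 2 = q := by rw [hq, ENNReal.ofReal_pow hκ.le]
    rw [h7] at h5
    have h8 : 8 * ENNReal.ofReal c * (Fintype.card ι * ε) ≤ ENNReal.ofReal (a / 2) := by
      refine le_trans (le_of_eq ?_) (ENNReal.ofReal_le_ofReal hεa)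
      rw [ENNReal.ofReal_mul (by positivity), ENNReal.ofReal_mul (by norm_num),
        ENNReal.ofReal_mul (by positivity)]
      simp
    calc 4 * levelSource Ω U (fun z => c * ∑ i, β i z ^ 2) κ t
        ≤ 4 * (ENNReal.ofReal c * (2 * (Fintype.card ι * (ε * levelGrad Ω U ux κ t) +
            absorbConst θ R C ε * K t * levelMass Ω U κ t) + 2 * q * (K t * (1 + V)))) := by
          refine mul_le_mul_right (h5.trans ?_) _
          gcongr
          · exact h6
          · exact h1.1.trans (by gcongr)
      _ = 8 * ENNReal.ofReal c * (Fintype.card ι * ε) * levelGrad Ω U ux κ t +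
          8 * ENNReal.ofReal c * (absorbConst θ R C ε * levelMass Ω U κ t + (1 + V) * q) * K t := by
          ring
      _ ≤ ENNReal.ofReal (a / 2) * levelGrad Ω U ux κ t +
          8 * ENNReal.ofReal c * (absorbConst θ R C ε * (levelMass Ω U κ t + q) +
            (1 + V) * (levelMass Ω U κ t + q)) * K t := by
          gcongr
          · exact le_self_add
          · exact le_add_self
      _ = _ := by rw [hK2]; ring
  have hDfin := hS.lintegral_levelGrad_lt_top hΩ hT' hζ le_rfl
  have hDm := (hS.aemeasurable_levelGrad κ).mono_set hsub
  obtain ⟨M, hM, hMb⟩ := hS.exists_levelMass_le hT' hκ hζ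
  have hen : ∀ᵐ τ ∂(volume.restrict (Ioo 0 T')), levelMass Ω U κ τ +
      ENNReal.ofReal (a / 2) * ∫⁻ t in Ioo 0 τ, levelGrad Ω U ux κ t ≤
      ∫⁻ t in Ioo 0 τ, K2 t * (levelMass Ω U κ t + q) := by
    filter_upwards [hS.energy_lintegral hΩ hT' hκ ha hΘ hζ le_rfl,
      ae_restrict_mem measurableSet_Ioo] with τ h hτ
    have hsub' : Ioo 0 τ ⊆ Ioo 0 T' := Ioo_subset_Ioo_right hτ.2.le
    -- Half of the gradient term is cancelled from both sides, which is legitimate in `ℝ≥0∞` because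
    -- it is finite.
    set G := ENNReal.ofReal (a / 2) * ∫⁻ t in Ioo 0 τ, levelGrad Ω U ux κ t with hG
    have hGf : G ≠ ∞ := ENNReal.mul_ne_top ENNReal.ofReal_ne_top
      (ne_top_of_le_ne_top hDfin.ne (lintegral_mono_set hsub'))
    have h1 : 4 * ∫⁻ t in Ioo 0 τ, levelSource Ω U (fun z => c * ∑ i, β i z ^ 2) κ t ≤
        G + ∫⁻ t in Ioo 0 τ, K2 t * (levelMass Ω U κ t + q) := by
      rw [← lintegral_const_mul' _ _ (by norm_num), hG, ← lintegral_const_mul' _ _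
        ENNReal.ofReal_ne_top, ← lintegral_add_left' ((hDm.mono_set hsub').const_mul _)]
      exact lintegral_mono_ae (ae_restrict_of_ae_restrict_of_subset hsub' hsrc)
    have h2 : ENNReal.ofReal a * ∫⁻ t in Ioo 0 τ, levelGrad Ω U ux κ t = G + G := by
      rw [hG, ← add_mul, ← ENNReal.ofReal_add (by positivity) (by positivity), add_halves]
    rw [h2] at h
    refine (ENNReal.add_le_add_iff_left hGf).1 ?_
    calc G + (levelMass Ω U κ τ + G) = levelMass Ω U κ τ + (G + G) := by ring
      _ ≤ _ := h.trans h1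
  -- Gronwall's inequality for the mass plus `q`. The qualitative bound `M` serves only to verify
  -- that the integral is finite.
  have hgr : q + ∫⁻ t in Ioo 0 T', K2 t * (levelMass Ω U κ t + q) ≤ 2 ^ N * q := by
    refine lintegral_gronwall hK2m ?_ ?_ N hK2N
    · refine ne_top_of_le_ne_top (b := (∫⁻ t in Ioo 0 T', K2 t) * (M + q)) ?_ ?_
      · exact ENNReal.mul_ne_top (ne_top_of_le_ne_top (by finiteness) hK2N) (by finiteness)
      · rw [← lintegral_mul_const' _ _ (by finiteness)]
        refine lintegral_mono_ae ?_
        filter_upwards [hMb] with t ht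
        gcongr
    · filter_upwards [hen] with τ hτ
      rw [add_comm]
      gcongr
      exact le_self_add.trans hτ
  refine LevelBound.of_energy (half_pos ha) (by positivity) ?_
  filter_upwards [hen, ae_restrict_mem measurableSet_Ioo] with τ h hτ
  refine h.trans ((lintegral_mono_set (Ioo_subset_Ioo_right hτ.2.le)).trans
    (le_add_self.trans (hgr.trans (le_of_eq ?_))))
  rw [ENNReal.ofReal_mul (by positivity), ENNReal.ofReal_pow (by norm_num : (0 : ℝ) ≤ 2),
    ENNReal.ofReal_ofNat]

/-- The improvement of the bound from one level to the next. -/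
theorem levelBound_step (hn : 1 ≤ n) (hθ : 0 < θ) (hθ' : θ < 1)
    (gn : IsGagliardoNirenberg n θ R C) (hΩ : IsOpen Ω) (hT' : T' ≤ T) (hκ : 0 < κ) (ha : 0 < a)
    (hc : 0 ≤ c) (hβ : ∀ i, IsSubcritical n θ Ω T (κβ i) (β i))
    (hS : IsControlledSubsolution Ω T a κ U ux X Y fun z => c * ∑ i, β i z ^ 2)
    (hζ : IsLevelCutoff Ω T T' κ U ζ) {k : ℝ} (hk : 0 ≤ k)
    (hβk : ∑ i, κβ i ≤ ENNReal.ofReal k) {l δ e : ℝ} (hl : κ ≤ l) (hδ : 0 < δ) (he : 0 ≤ e)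
    (h : LevelBound Ω T' U ux l e) :
    LevelBound Ω T' U ux (l + δ) (4 * c * interpConst R C * (k + Fintype.card ι) * max 1 (1 / a) *
      ((1 + l / δ) ^ 2 * δ ^ (-(2 * (θ / n)))) * e ^ (1 + θ / n)) := by
  obtain ⟨K, hKm, hKk, hK⟩ := exists_sum_kernel hn hθ hθ' gn hβ
  have hsub : Ioo 0 T' ⊆ Ioo 0 T := Ioo_subset_Ioo_right hT'
  have hΘ := aestronglyMeasurable_sum_sq hβ c
  have hl0 : 0 < l := hκ.trans_le hl
  have hσ : 0 ≤ θ / n := by positivity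
  set F : ℝ := (1 + l / δ) ^ 2 * δ ^ (-(2 * (θ / n))) with hF
  have hF0 : 0 ≤ F := by positivity
  have hUs : ∀ᵐ t ∂(volume.restrict (Ioo 0 T)),
      AEMeasurable (fun x => ‖max (U (x, t) - l) 0‖ₑ) (volume.restrict Ω) := by
    have := hS.aestronglyMeasurable_max (l := l)
    rw [restrict_cylinder] at this
    filter_upwards [aestronglyMeasurable_slice this] with t ht
    exact ht.enorm
  -- The superlinear estimate is applied to `(U - l)₊` with `e` as the bound for its mass;
  -- integrated in time, kernel and gradient each contribute a further factor `e`.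
  have hsrc : ∀ᵐ t ∂(volume.restrict (Ioo 0 T')),
      levelSource Ω U (fun z => c * ∑ i, β i z ^ 2) (l + δ) t ≤
        ENNReal.ofReal (c * F) * (interpConst R C * ENNReal.ofReal e ^ (θ / n)) *
          (K t * ENNReal.ofReal e + Fintype.card ι * levelGrad Ω U ux l t) := by
    filter_upwards [ae_restrict_of_ae_restrict_of_subset hsub hK,
      ae_restrict_of_ae_restrict_of_subset hsub hUs,
      hS.ae_sliceGN gn hΩ hκ hζ hl, h.1] with t h1 h3 h4 h5
    rw [mul_assoc]
    refine (levelSource_add_le hc hl0.le hδ hσ).trans ?_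
    gcongr
    exact (h1.2 _ h3 _ h4).2 _ h5
  have hKe : AEMeasurable (fun t => K t * ENNReal.ofReal e) (volume.restrict (Ioo 0 T')) :=
    (hKm.mono_set hsub).mul_const _
  have htot : 4 * ∫⁻ t in Ioo 0 T', levelSource Ω U (fun z => c * ∑ i, β i z ^ 2) (l + δ) t ≤
      ENNReal.ofReal (4 * c * interpConst R C * (k + Fintype.card ι) * F * e ^ (1 + θ / n)) := by
    calc 4 * ∫⁻ t in Ioo 0 T', levelSource Ω U (fun z => c * ∑ i, β i z ^ 2) (l + δ) t
        ≤ 4 * ∫⁻ t in Ioo 0 T', ENNReal.ofReal (c * F) *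
          (interpConst R C * ENNReal.ofReal e ^ (θ / n)) *
          (K t * ENNReal.ofReal e + Fintype.card ι * levelGrad Ω U ux l t) := by
          gcongr 4 * ?_
          exact lintegral_mono_ae hsrc
      _ = 4 * (ENNReal.ofReal (c * F) * (interpConst R C * ENNReal.ofReal e ^ (θ / n)) *
          ((∫⁻ t in Ioo 0 T', K t) * ENNReal.ofReal e +
            Fintype.card ι * ∫⁻ t in Ioo 0 T', levelGrad Ω U ux l t)) := by
          rw [lintegral_const_mul' _ _ (by finiteness), lintegral_add_left' hKe,
            lintegral_mul_const' _ _ ENNReal.ofReal_ne_top, lintegral_const_mul' _ _ (by simp)]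
      _ ≤ 4 * (ENNReal.ofReal (c * F) * (interpConst R C * ENNReal.ofReal e ^ (θ / n)) *
          (ENNReal.ofReal k * ENNReal.ofReal e + Fintype.card ι * ENNReal.ofReal e)) := by
          gcongr
          · exact (lintegral_mono_set hsub).trans (hKk.trans hβk)
          · exact h.2
      _ = _ := by
          rw [ENNReal.ofReal_rpow_of_nonneg he hσ, ← ENNReal.ofReal_coe_nnreal,
            ← ENNReal.ofReal_natCast, ← ENNReal.ofReal_mul hk,
            ← ENNReal.ofReal_mul (Nat.cast_nonneg (Fintype.card ι)), ← ENNReal.ofReal_add (by positivity) (by positivity),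
            ← ENNReal.ofReal_mul (by positivity), ← ENNReal.ofReal_mul (by positivity),
            ← ENNReal.ofReal_mul (by positivity), ← ENNReal.ofReal_ofNat 4,
            ← ENNReal.ofReal_mul (by norm_num), Real.rpow_add_of_nonneg he zero_le_one hσ,
            Real.rpow_one]
          congr 1
          ring
  have := LevelBound.of_energy (ux := ux) (l := l + δ)
    (q := 4 * c * interpConst R C * (k + Fintype.card ι) * F * e ^ (1 + θ / n)) ha (by positivity) (by
    filter_upwards [hS.energy_lintegral hΩ hT' hκ ha hΘ hζ (by linarith : κ ≤ l + δ),
      ae_restrict_mem measurableSet_Ioo] with τ h hτ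
    refine (h.trans ?_).trans htot
    gcongr 4 * ?_
    exact lintegral_mono_set (Ioo_subset_Ioo_right hτ.2.le))
  refine this.mono le_rfl (le_of_eq ?_)
  ring

end IsControlledSubsolution

end

/-- The maximum principle for controlled subsolutions. -/
theorem exists_level_bound (hn : 1 ≤ n) {θ : ℝ} (hθ : 0 < θ) (hθ' : θ < 1) {a c : ℝ} (ha : 0 < a)
    (hc : 0 < c) (m : ℕ) {k : ℝ} (hk : 0 ≤ k) {V : ℝ≥0∞} (hV : V ≠ ∞) :
    ∃ Λ : ℝ, 0 < Λ ∧ ∀ (Ω : Set (Space n)) (T κ : ℝ) (β : Fin m → Space n × ℝ → ℝ)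
      (κβ : Fin m → ℝ≥0∞) (U Y : Space n × ℝ → ℝ) (ux X : Space n × ℝ → Space n),
      IsOpen Ω → Bornology.IsBounded Ω → volume Ω ≤ V → 0 < κ →
      (∀ i, IsSubcritical n θ Ω T (κβ i) (β i)) → ∑ i, κβ i ≤ ENNReal.ofReal k →
      IsControlledSubsolution Ω T a κ U ux X Y (fun z => c * ∑ i, β i z ^ 2) →
      ∀ᵐ z ∂(volume.restrict (cylinder Ω T)), U z ≤ Λ * κ := by
  obtain ⟨R, C, gn⟩ := exists_isGagliardoNirenberg n hn θ hθ hθ'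
  have hn0 : (1 : ℝ) ≤ n := by exact_mod_cast hn
  -- Small enough for the `m` gradient terms together to be absorbed; `m + 1` in the denominator
  -- avoids a division by zero.
  set ε : ℝ≥0 := min 1 (a / (16 * c * (m + 1))).toNNReal with hε
  have hε0 : 0 < ε := lt_min zero_lt_one (Real.toNNReal_pos.2 (by positivity))
  have hεa : 8 * c * (m * ε) ≤ a / 2 := by
    have h1 : (ε : ℝ) ≤ a / (16 * c * (m + 1)) := by
      refine (NNReal.coe_le_coe.2 (min_le_right _ _)).trans (le_of_eq ?_)
      exact Real.coe_toNNReal _ (by positivity)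
    calc 8 * c * (m * ε) ≤ 8 * c * ((m + 1) * (a / (16 * c * (m + 1)))) := by
          gcongr
          linarith
      _ = a / 2 := by field_simp; norm_num
  -- `N` counts the pieces of mass one half into which the Gronwall kernel can be divided, so it
  -- depends only on the data.
  obtain ⟨N, hN⟩ := ENNReal.exists_nat_gt (r := 2 * (8 * ENNReal.ofReal c *
    (absorbConst θ R C ε + (1 + V)) * ENNReal.ofReal k)) (by finiteness)
  have hN' : 8 * ENNReal.ofReal c * (absorbConst θ R C ε + (1 + V)) * ENNReal.ofReal k ≤
      N / 2 := by
    rw [ENNReal.le_div_iff_mul_le (by simp) (by simp), mul_comm]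
    exact hN.le
  set A : ℝ := 2 ^ N * max 1 (1 / (a / 2)) with hA
  -- The summand one only keeps the constant positive, also when `k` and `m` vanish.
  set C' : ℝ := (4 * c * interpConst R C * (k + m) + 1) * max 1 (1 / a) with hC'
  have hA0 : 0 < A := by positivity
  have hC'0 : 0 < C' := by positivity
  refine ⟨2 * levelFactor (θ / n) C' A, mul_pos two_pos
    (zero_lt_one.trans_le (le_max_left _ _)), ?_⟩
  intro Ω T κ β κβ U Y ux X hΩ hΩb hΩV hκ hβ hβk hS
  set L := 2 * levelFactor (θ / n) C' A * κ with hL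
  -- Cutoffs exist only below a time `T' < T`. The level `L` does not depend on `T'`, so the
  -- cylinder is exhausted at the end.
  have key : ∀ T', T' < T → ∀ᵐ z ∂(volume.restrict (cylinder Ω T')), U z ≤ L := by
    intro T' hT'
    obtain ⟨ζ, hζ⟩ := exists_isLevelCutoff hΩ hΩb hS.boundary hκ hT'
    have hsub : cylinder Ω T' ⊆ cylinder Ω T := prod_mono_right (Ioo_subset_Ioo_right hT'.le)
    have h0 := hS.levelBound_initial hn hθ hθ' gn hΩ hT'.le hκ ha hc.le hβ hζ
      hV hβk hΩV hε0 (min_le_left _ _) (by simpa using hεa) hN'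
    have hP : ∀ ε : ℝ, 0 < ε → LevelBound Ω T' U ux L ε := fun ε hε =>
      deGiorgi (P := LevelBound Ω T' U ux) (by positivity)
        ((div_le_one (by linarith)).2 (by linarith)) hC'0 hA0 hκ
        (fun l hl => h0.mono hl (le_of_eq (by rw [hA]; ring)))
        (fun l δ e hl hδ he h => (hS.levelBound_step hn hθ hθ' gn hΩ hT'.le hκ ha hc.le hβ hζ hk
          hβk hl hδ he h).mono le_rfl (by
            have hl0 : 0 < l := hκ.trans_le hl
            rw [hC', Fintype.card_fin]
            gcongr
            linarith))
        (fun l l' e e' hl he h => h.mono hl he) hε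
    -- At the level `L` the mass is below every positive number, hence zero on almost every slice.
    have hy : ∀ᵐ t ∂(volume.restrict (Ioo 0 T')), levelMass Ω U L t = 0 := by
      have h1 : ∀ᵐ t ∂(volume.restrict (Ioo 0 T')), ∀ j : ℕ,
          levelMass Ω U L t ≤ ENNReal.ofReal (1 / ((j : ℝ) + 1)) :=
        ae_all_iff.2 fun j => (hP _ (by positivity)).1
      filter_upwards [h1] with t ht
      have h2 : Tendsto (fun j : ℕ => ENNReal.ofReal (1 / ((j : ℝ) + 1))) atTop (𝓝 0) := by
        simpa using ENNReal.tendsto_ofReal tendsto_one_div_add_atTop_nhds_zero_nat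
      exact le_antisymm (ge_of_tendsto' h2 ht) zero_le
    have hm : AEMeasurable (fun z => ‖max (U z - L) 0‖ₑ ^ 2) (volume.restrict (cylinder Ω T')) :=
      ((hS.aestronglyMeasurable_max (l := L)).mono_set hsub).enorm.pow_const 2
    have hz : ∫⁻ z in cylinder Ω T', ‖max (U z - L) 0‖ₑ ^ 2 = 0 := by
      rw [lintegral_cylinder hm]
      exact (lintegral_congr_ae hy).trans lintegral_zero
    rw [lintegral_eq_zero_iff' hm] at hz
    filter_upwards [hz] with z hz
    have h3 : max (U z - L) 0 = 0 := by simpa using hz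
    have := le_max_left (U z - L) 0
    linarith
  obtain ⟨u, hu, hut, hulim⟩ := exists_seq_strictMono_tendsto T
  have hU : cylinder Ω T = ⋃ j, cylinder Ω (u j) := by
    ext z
    simp only [mem_iUnion, cylinder, mem_prod, mem_Ioo]
    refine ⟨fun hx => ?_, fun ⟨k, hk⟩ => ⟨hk.1, hk.2.1, hk.2.2.trans (hut k)⟩⟩
    obtain ⟨k, hk⟩ := (hulim.eventually_const_lt hx.2.2).exists
    exact ⟨k, hx.1, hx.2.1, hk⟩
  rw [hU, ae_restrict_iUnion_iff]
  exact fun j => key _ (hut j)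

end

section

variable {n : ℕ} {Ω : Set (Space n)} {T : ℝ}

/-! ### Subtraction of constants -/

/-- The integrability of `f` is not needed: if `f` is not integrable then neither is the sum, and
both integrals take the default value zero. So constants can be subtracted in the weak formulation
without integrability of its terms. -/
theorem integral_add_eq_left {α F : Type*} [MeasurableSpace α] {μ : Measure α}
    [NormedAddCommGroup F] [NormedSpace ℝ F] {f g : α → F} (hg : Integrable g μ)
    (hg0 : ∫ x, g x ∂μ = 0) : ∫ x, (f x + g x) ∂μ = ∫ x, f x ∂μ := by
  by_cases hf : Integrable f μ
  · rw [integral_add hf hg, hg0, add_zero]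
  · rw [integral_undef hf]
    exact integral_undef fun h => hf ((integrable_add_iff_integrable_left hg).1 h)

theorem integrable_fderiv_apply {φ : Space n × ℝ → ℝ} (hφ : ContDiff ℝ 1 φ)
    (hc : HasCompactSupport φ) (v : Space n × ℝ) : Integrable fun z => fderiv ℝ φ z v :=
  ((hφ.continuous_fderiv one_ne_zero).clm_apply continuous_const).integrable_of_hasCompactSupport
    (hc.fderiv_apply ℝ v)

theorem integral_fderiv_apply_eq_zero {φ : Space n × ℝ → ℝ} (hφ : ContDiff ℝ 1 φ)
    (hc : HasCompactSupport φ) (v : Space n × ℝ) : ∫ z, fderiv ℝ φ z v = 0 := by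
  have h := integral_mul_fderiv_eq_neg_fderiv_mul_of_integrable (μ := volume) (𝕜 := ℝ)
    (f := φ) (g := fun _ => 1) (v := v) (by simpa using integrable_fderiv_apply hφ hc v)
    (by simp) (by simpa using hφ.continuous.integrable_of_hasCompactSupport hc)
    (fun x _ => hφ.differentiable one_ne_zero x) (fun _ _ => differentiableAt_const _)
  simpa using h

theorem IsTestFunction.integrable_timeDeriv {φ : Space n × ℝ → ℝ} (hφ : IsTestFunction Ω T φ) :
    Integrable (timeDeriv φ) := by
  rw [funext fun z => timeDeriv_eq (hφ.1.differentiable one_ne_zero) z]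
  exact integrable_fderiv_apply hφ.1 hφ.2.1 _

theorem IsTestFunction.integral_timeDeriv {φ : Space n × ℝ → ℝ} (hφ : IsTestFunction Ω T φ) :
    ∫ z in cylinder Ω T, timeDeriv φ z = 0 := by
  have hd := hφ.1.differentiable one_ne_zero
  rw [setIntegral_eq_integral_of_forall_compl_eq_zero (f := timeDeriv φ)]
  · rw [funext fun z => timeDeriv_eq hd z]
    exact integral_fderiv_apply_eq_zero hφ.1 hφ.2.1 _
  · intro z hz
    rw [timeDeriv_eq hd, fderiv_of_notMem_tsupport ℝ fun h => hz (hφ.2.2 h)]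
    rfl

theorem IsTestFunction.integrable_spaceGrad {φ : Space n × ℝ → ℝ} (hφ : IsTestFunction Ω T φ) :
    Integrable (spaceGrad φ) :=
  (continuous_spaceGrad hφ.1).integrable_of_hasCompactSupport
    (hasCompactSupport_spaceGrad hφ.1 hφ.2.1)

theorem IsTestFunction.integral_spaceGrad {φ : Space n × ℝ → ℝ} (hφ : IsTestFunction Ω T φ) :
    ∫ z in cylinder Ω T, spaceGrad φ z = 0 := by
  rw [setIntegral_eq_integral_of_forall_compl_eq_zero (f := spaceGrad φ)]
  · refine ext_inner_left ℝ fun v => ?_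
    rw [← integral_inner hφ.integrable_spaceGrad, inner_zero_right]
    simp_rw [real_inner_comm _ v, inner_spaceGrad (hφ.1.differentiable one_ne_zero)]
    exact integral_fderiv_apply_eq_zero hφ.1 hφ.2.1 _
  · intro z hz
    by_contra h
    exact hz (hφ.2.2 (support_spaceGrad_subset hφ.1 h))

theorem MemMixedLoc.sub_const (hΩv : volume Ω < ∞) {u : Space n × ℝ → ℝ}
    (hu : MemMixedLoc Ω T 2 ∞ u) (M : ℝ) : MemMixedLoc Ω T 2 ∞ fun z => u z - M := by
  refine ⟨hu.1.sub aestronglyMeasurable_const, fun K hK hKQ => ?_⟩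
  obtain ⟨L, hL, h⟩ := hu.exists_slice_bound hK hKQ
  set L' := 2 * (L + ‖M‖ₑ ^ 2 * volume Ω) with hL'
  have hL'f : L' < ∞ := by finiteness
  refine lt_of_le_of_lt (b := L' ^ (2 : ℝ)⁻¹) ?_ (by finiteness)
  rw [mixedNorm, eLpNorm_exponent_top, eLpNormEssSup]
  refine essSup_le_of_ae_le _ ?_
  filter_upwards [h] with t ht
  rw [enorm_eq_self, ENNReal.le_rpow_inv_iff two_pos, ENNReal.rpow_two, ← lintegral_enorm_sq_eq]
  calc ∫⁻ x in Ω, ‖K.indicator (fun z => u z - M) (x, t)‖ₑ ^ 2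
      ≤ ∫⁻ x in Ω, 2 * (‖K.indicator u (x, t)‖ₑ ^ 2 + ‖M‖ₑ ^ 2) := by
        refine lintegral_mono fun x => ?_
        by_cases hx : (x, t) ∈ K
        · simp only [indicator_of_mem hx]
          have h2 := ENNReal.rpow_add_le_mul_rpow_add_rpow ‖u (x, t)‖ₑ ‖M‖ₑ one_le_two
          norm_num at h2
          exact (pow_le_pow_left' enorm_sub_le 2).trans h2
        · simp [indicator_of_notMem hx]
    _ = 2 * ((∫⁻ x in Ω, ‖K.indicator u (x, t)‖ₑ ^ 2) + ‖M‖ₑ ^ 2 * volume Ω) := by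
        rw [lintegral_const_mul' _ _ (by simp), lintegral_add_right _ measurable_const,
          setLIntegral_const]
    _ ≤ L' := by rw [hL']; gcongr

theorem IsGenGrad.sub_const {u : Space n × ℝ → ℝ} {ux : Space n × ℝ → Space n}
    (hu : IsGenGrad Ω T u ux) (M : ℝ) : IsGenGrad Ω T (fun z => u z - M) ux := by
  intro φ hφ
  rw [← hu φ hφ, ← integral_add_eq_left (f := fun z => u z • spaceGrad φ z)
    (g := fun z => -M • spaceGrad φ z) (hφ.integrable_spaceGrad.smul (-M)).restrict
    (by rw [integral_smul, hφ.integral_spaceGrad, smul_zero])]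
  simp only [← add_smul, sub_eq_add_neg]

theorem InEnergyClass.sub_const (hΩv : volume Ω < ∞) {u : Space n × ℝ → ℝ}
    {ux : Space n × ℝ → Space n} (hu : InEnergyClass Ω T u ux) (M : ℝ) :
    InEnergyClass Ω T (fun z => u z - M) ux :=
  ⟨hu.1.sub_const hΩv M, hu.2.1, hu.2.2.sub_const M⟩

/-! ### Coefficients for the equation above a level -/

/-- The coefficients controlling the lower order terms of the equation for `u - M` above the
level `κ`. -/
noncomputable def levelCoeff (S : StructureData n) (κ M : ℝ) : Fin 7 → Space n × ℝ → ℝ :=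
  ![fun z => 1 * S.b.fn z, fun z => |M| / κ * S.b.fn z, fun z => 1 / κ * S.f.fn z,
    fun z => 1 * S.c.fn z, fun z => 1 * √|S.d.fn z|, fun z => √(|M| / κ) * √|S.d.fn z|,
    fun z => √(1 / κ) * √|S.g.fn z|]

/-- Bounds for the coefficients `levelCoeff`. -/
noncomputable def levelCoeffBound (θ T Nb Nc Nd : ℝ) : Fin 7 → ℝ≥0∞ :=
  ![subcriticalBound θ T Nb, subcriticalBound θ T 1, subcriticalBound θ T 1,
    subcriticalBound θ T Nc, subcriticalBound θ T √Nd, subcriticalBound θ T 1,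
    subcriticalBound θ T 1]

theorem levelCoeffBound_ne_top {θ T Nb Nc Nd : ℝ} (hθ : 0 < θ) (i : Fin 7) :
    levelCoeffBound θ T Nb Nc Nd i ≠ ∞ := by
  fin_cases i <;> exact subcriticalBound_ne_top hθ

/-- The quantity `k` is made for this purpose: `κ ≥ k` forces the norms of `b |M| / κ`, `f / κ`, `d
|M| / κ` and `g / κ` to be at most one. The bounds therefore involve neither `M` nor the norms of
`f` and `g`. -/
theorem isSubcritical_levelCoeff {θ : ℝ} (hθ : 0 < θ) (hθ' : θ < 1) {T₀ Nb Nc Nd κ M : ℝ}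
    (hT₀ : T ≤ T₀) {S : StructureData n} (hS : S.Admissible Ω T θ) (hκ : 0 < κ)
    (hb : S.b.norm Ω T ≤ Nb) (hc : S.c.norm Ω T ≤ Nc) (hd : S.d.norm Ω T ≤ Nd)
    (hk : S.k Ω T M ≤ κ) (i : Fin 7) :
    IsSubcritical n θ Ω T (levelCoeffBound θ T₀ Nb Nc Nd i) (levelCoeff S κ M i) := by
  have hbn := S.b.norm_nonneg Ω T
  have hdn := S.d.norm_nonneg Ω T
  have hfn := S.f.norm_nonneg Ω T
  have hgn := S.g.norm_nonneg Ω T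
  have hbM := mul_nonneg hbn (abs_nonneg M)
  have hdM := mul_nonneg hdn (abs_nonneg M)
  rw [StructureData.k, add_mul] at hk
  have hdiv : ∀ {r N : ℝ}, r * N ≤ κ → r / κ * N ≤ 1 := fun {r N} h => by
    rw [div_mul_eq_mul_div, div_le_one hκ]; exact h
  have habs : ∀ {r : ℝ}, 0 ≤ r → |r / κ| = r / κ := fun h => abs_of_nonneg (by positivity)
  fin_cases i
  · exact hS.b_mem.isSubcritical_const_mul hθ hθ' hT₀ hS.b_exp (by simpa using hb)
  · refine hS.b_mem.isSubcritical_const_mul hθ hθ' hT₀ hS.b_exp ?_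
    rw [habs (abs_nonneg M)]
    exact hdiv (by linarith)
  · refine hS.f_mem.isSubcritical_const_mul hθ hθ' hT₀ hS.f_exp ?_
    rw [habs zero_le_one]
    exact hdiv (by linarith)
  · exact hS.c_mem.isSubcritical_const_mul hθ hθ' hT₀ hS.c_exp (by simpa using hc)
  · refine hS.d_mem.isSubcritical_sqrt hθ hθ' hT₀ hS.d_exp (Real.sqrt_nonneg _) ?_
    rw [Real.sq_sqrt (hdn.trans hd)]
    simpa using hd
  · refine hS.d_mem.isSubcritical_sqrt hθ hθ' hT₀ hS.d_exp zero_le_one ?_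
    rw [Real.sq_sqrt (by positivity), one_pow]
    exact hdiv (by linarith)
  · refine hS.g_mem.isSubcritical_sqrt hθ hθ' hT₀ hS.g_exp zero_le_one ?_
    rw [Real.sq_sqrt (by positivity), one_pow]
    exact hdiv (by linarith)

theorem sum_levelCoeff_sq (S : StructureData n) {κ : ℝ} (hκ : 0 < κ) (M : ℝ) {z : Space n × ℝ}
    (hd : 0 ≤ S.d.fn z) (hg : 0 ≤ S.g.fn z) :
    ∑ i, levelCoeff S κ M i z ^ 2 = S.b.fn z ^ 2 + (|M| / κ * S.b.fn z) ^ 2 +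
      (1 / κ * S.f.fn z) ^ 2 + S.c.fn z ^ 2 + S.d.fn z + |M| / κ * S.d.fn z +
        1 / κ * S.g.fn z := by
  simp only [levelCoeff, Fin.sum_univ_seven, Matrix.cons_val, mul_pow, one_mul]
  rw [Real.sq_sqrt (abs_nonneg _), Real.sq_sqrt (abs_nonneg _), Real.sq_sqrt (by positivity),
    Real.sq_sqrt (by positivity), abs_of_nonneg hd, abs_of_nonneg hg]

/-- Above the level, `U / κ ≥ 1` absorbs `f ^ 2` and, after `u ^ 2 ≤ 2 U ^ 2 + 2 M ^ 2`, also `b ^ 2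
M ^ 2` into multiples of `U ^ 2`. This is the origin of the summand two in the constant. -/
theorem level_lower {a a₀ κ M b f c d g u P I : ℝ} (ha : a₀ ≤ a) (ha₀ : 0 < a₀) (hκ : 0 < κ)
    (hd : 0 ≤ d) (hg : 0 ≤ g) (hu : κ < u - M)
    (h : a * P ^ 2 - b ^ 2 * u ^ 2 - f ^ 2 ≤ I) :
    a₀ * P ^ 2 - (2 + 1 / (2 * a₀)) * (b ^ 2 + (|M| / κ * b) ^ 2 + (1 / κ * f) ^ 2 + c ^ 2 + d +
      |M| / κ * d + 1 / κ * g) * (u - M) ^ 2 ≤ I := by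
  set U := u - M with hU
  have hU1 : 1 ≤ U / κ := (one_le_div hκ).2 hu.le
  have h1 : u ^ 2 ≤ 2 * U ^ 2 + 2 * |M| ^ 2 := by
    rw [sq_abs]; nlinarith [sq_nonneg (U - M)]
  have hq : 1 ≤ (U / κ) ^ 2 := one_le_pow₀ hU1
  have h2 : b ^ 2 * |M| ^ 2 ≤ (|M| / κ * b) ^ 2 * U ^ 2 := by
    have : (|M| / κ * b) ^ 2 * U ^ 2 = b ^ 2 * |M| ^ 2 * (U / κ) ^ 2 := by field_simp
    rw [this]
    exact le_mul_of_one_le_right (by positivity) hq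
  have h3 : f ^ 2 ≤ (1 / κ * f) ^ 2 * U ^ 2 := by
    have : (1 / κ * f) ^ 2 * U ^ 2 = f ^ 2 * (U / κ) ^ 2 := by field_simp
    rw [this]
    exact le_mul_of_one_le_right (by positivity) hq
  have h4 : b ^ 2 * u ^ 2 ≤ b ^ 2 * (2 * U ^ 2 + 2 * |M| ^ 2) := by gcongr
  have h5 : a₀ * P ^ 2 ≤ a * P ^ 2 := by gcongr
  set B := b ^ 2 + (|M| / κ * b) ^ 2 + (1 / κ * f) ^ 2 with hB
  have h6 : 2 * B * U ^ 2 ≤ (2 + 1 / (2 * a₀)) * (B + c ^ 2 + d + |M| / κ * d + 1 / κ * g) *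
      U ^ 2 := by
    have e1 : (2 : ℝ) ≤ 2 + 1 / (2 * a₀) := le_add_of_nonneg_right (by positivity)
    have e2 : B ≤ B + c ^ 2 + d + |M| / κ * d + 1 / κ * g := by
      have : 0 ≤ c ^ 2 + d + |M| / κ * d + 1 / κ * g := by positivity
      linarith
    gcongr
  have h7 : 2 * B * U ^ 2 = 2 * (b ^ 2 * U ^ 2) + 2 * ((|M| / κ * b) ^ 2 * U ^ 2) +
      2 * ((1 / κ * f) ^ 2 * U ^ 2) := by rw [hB]; ring
  have h8 : 0 ≤ f ^ 2 := sq_nonneg f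
  linarith

/-- Young's inequality applied to `c P U` leaves `a₀ / 2 * P ^ 2` and produces the summand `1 / (2 *
a₀)`; the terms with `|M|` and `g` gain a factor `U / κ ≥ 1`. -/
theorem level_upper {a₀ κ M b f c d g u P Y : ℝ} (ha₀ : 0 < a₀) (hκ : 0 < κ) (hd : 0 ≤ d)
    (hg : 0 ≤ g) (hu : κ < u - M) (h : |Y| ≤ c * P + d * |u| + g) :
    (u - M) * |Y| ≤ a₀ / 2 * P ^ 2 + (2 + 1 / (2 * a₀)) * (b ^ 2 + (|M| / κ * b) ^ 2 +
      (1 / κ * f) ^ 2 + c ^ 2 + d + |M| / κ * d + 1 / κ * g) * (u - M) ^ 2 := by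
  set U := u - M with hU
  have hU0 : 0 < U := hκ.trans hu
  have hU1 : 1 ≤ U / κ := (one_le_div hκ).2 hu.le
  have h1 : |u| ≤ U + |M| := by
    have : u = U + M := by rw [hU]; ring
    rw [this]
    exact (abs_add_le _ _).trans (by rw [abs_of_pos hU0])
  have h2 : U * (d * |M|) ≤ |M| / κ * d * U ^ 2 := by
    have : |M| / κ * d * U ^ 2 = U * (d * |M|) * (U / κ) := by field_simp
    rw [this]
    exact le_mul_of_one_le_right (by positivity) hU1
  have h3 : U * g ≤ 1 / κ * g * U ^ 2 := by
    have : 1 / κ * g * U ^ 2 = U * g * (U / κ) := by field_simp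
    rw [this]
    exact le_mul_of_one_le_right (by positivity) hU1
  have h4 : U * (c * P) ≤ a₀ / 2 * P ^ 2 + 1 / (2 * a₀) * (c ^ 2 * U ^ 2) := by
    have e : a₀ / 2 * P ^ 2 + 1 / (2 * a₀) * (c ^ 2 * U ^ 2) - U * (c * P) =
        1 / (2 * a₀) * (a₀ * P - c * U) ^ 2 := by field_simp; ring
    have : 0 ≤ 1 / (2 * a₀) * (a₀ * P - c * U) ^ 2 := by positivity
    linarith
  have h5 : U * |Y| ≤ U * (c * P + d * (U + |M|) + g) := by
    refine mul_le_mul_of_nonneg_left (h.trans ?_) hU0.le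
    gcongr
  set D := d + |M| / κ * d + 1 / κ * g with hD
  set B := b ^ 2 + (|M| / κ * b) ^ 2 + (1 / κ * f) ^ 2 with hB
  have hD0 : 0 ≤ D := by positivity
  have hB0 : 0 ≤ B := by positivity
  have h6 : 1 / (2 * a₀) * (c ^ 2 * U ^ 2) + D * U ^ 2 ≤
      (2 + 1 / (2 * a₀)) * (B + c ^ 2 + D) * U ^ 2 := by
    have e : (2 + 1 / (2 * a₀)) * (B + c ^ 2 + D) * U ^ 2 -
      (1 / (2 * a₀) * (c ^ 2 * U ^ 2) + D * U ^ 2) =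
        ((2 + 1 / (2 * a₀)) * B + 2 * c ^ 2 + (1 + 1 / (2 * a₀)) * D) * U ^ 2 := by ring
    have : 0 ≤ ((2 + 1 / (2 * a₀)) * B + 2 * c ^ 2 + (1 + 1 / (2 * a₀)) * D) * U ^ 2 := by
      positivity
    linarith
  have h7 : D * U ^ 2 = U * (d * U) + |M| / κ * d * U ^ 2 + 1 / κ * g * U ^ 2 := by rw [hD]; ring
  have h8 : B + c ^ 2 + d + |M| / κ * d + 1 / κ * g = B + c ^ 2 + D := by rw [hD]; ring
  rw [h8]
  linarith

/-- Weak subsolutions, shifted by their boundary values, are controlled subsolutions. -/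
theorem isControlledSubsolution_sub_const (hn : 1 ≤ n) {θ : ℝ} (hθ : 0 < θ) (hθ' : θ < 1)
    (hΩ : IsOpen Ω) (hΩv : volume Ω < ∞) {S : StructureData n} (hS : S.Admissible Ω T θ)
    {A : Space n × ℝ → ℝ → Space n → Space n} {B : Space n × ℝ → ℝ → Space n → ℝ}
    (hA : MeasurableNonlinearity Ω T A) (hB : MeasurableNonlinearity Ω T B)
    (hAB : StructureInequalities Ω T S A B) {a₀ κ M : ℝ} (ha₀ : 0 < a₀) (ha : a₀ ≤ S.a)
    (hκ : 0 < κ) (hk : S.k Ω T M ≤ κ)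
    {u : Space n × ℝ → ℝ} {ux : Space n × ℝ → Space n} (hu : InEnergyClass Ω T u ux)
    (hw : ∀ φ : Space n × ℝ → ℝ, IsTestFunction Ω T φ → (∀ z, 0 ≤ φ z) →
      ∫ z in cylinder Ω T, (-(u z * timeDeriv φ z) + inner ℝ (spaceGrad φ z) (A z (u z) (ux z)))
        ≤ ∫ z in cylinder Ω T, φ z * B z (u z) (ux z))
    (hM : LeOnParabolicBoundary Ω T u M) :
    IsControlledSubsolution Ω T a₀ κ (fun z => u z - M) ux (fun z => A z (u z) (ux z))
      (fun z => B z (u z) (ux z))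
      (fun z => (2 + 1 / (2 * a₀)) * ∑ i, levelCoeff S κ M i z ^ 2) where
  energy := hu.sub_const hΩv M
  flux _ hK hKQ := hAB.memLp_flux hn hθ hθ' hΩ hΩv hS hA hu hK hKQ
  source _ hK hKQ := hAB.integrableOn_source hn hθ hθ' hΩ hΩv hS hB hu hK hKQ
  -- Replacing `u` by `u - M` in the time term adds `M` times the integral of `φ_t`, which is zero
  -- for compact support. Flux and source are still evaluated at the original `u`.
  weak φ hφ hφ0 := by
    refine le_trans (le_of_eq ?_) (hw φ hφ hφ0)
    rw [← integral_add_eq_left (f := fun z => -(u z * timeDeriv φ z) +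
      inner ℝ (spaceGrad φ z) (A z (u z) (ux z))) (g := fun z => M * timeDeriv φ z)
      (hφ.integrable_timeDeriv.const_mul M).restrict
      (by rw [integral_const_mul, hφ.integral_timeDeriv, mul_zero])]
    congr 1 with z
    ring
  lower := by
    filter_upwards [hAB, hS.d_mem.2, hS.g_mem.2] with z h hd hg hκz
    rw [sum_levelCoeff_sq S hκ M hd hg]
    exact level_lower ha ha₀ hκ hd hg hκz (h (u z) (ux z)).1
  upper := by
    filter_upwards [hAB, hS.d_mem.2, hS.g_mem.2] with z h hd hg hκz
    rw [sum_levelCoeff_sq S hκ M hd hg]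
    exact level_upper ha₀ hκ hd hg hκz (h (u z) (ux z)).2.1
  nonneg z := by positivity
  lower_order K hK hKQ := by
    have h : ∀ i, IntegrableOn (fun z => (levelCoeff S κ M i z * (u z - M)) ^ 2) K := fun i =>
      ((isSubcritical_levelCoeff hθ hθ' le_rfl hS hκ le_rfl le_rfl le_rfl hk i).memLp_mul hn hθ hθ'
        (levelCoeffBound_ne_top hθ i) hΩ (hu.sub_const hΩv M) hK hKQ).integrable_sq
    refine ((integrable_finsetSum Finset.univ fun i _ => h i).const_mul
      (2 + 1 / (2 * a₀))).congr (ae_of_all _ fun z => ?_)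
    simp only [mul_pow, ← Finset.sum_mul, mul_assoc]
  boundary ε hε := by
    obtain ⟨O, hO, hΓ, h⟩ := hM ε hε
    refine ⟨O, hO, hΓ, ?_⟩
    filter_upwards [h] with z hz
    linarith

/-! ### The maximum principle -/

/-- The maximum principle for weak subsolutions. -/
theorem exists_weakSubsolution_le (hn : 1 ≤ n) {θ : ℝ} (hθ : 0 < θ) (hθ' : θ < 1) {a₀ : ℝ}
    (ha₀ : 0 < a₀) (Nb Nc Nd T₀ V₀ : ℝ) :
    ∃ C : ℝ, 0 < C ∧ ∀ (T : ℝ) (Ω : Set (Space n)), T ≤ T₀ → IsOpen Ω → Bornology.IsBounded Ω →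
      volume Ω ≤ ENNReal.ofReal V₀ →
      ∀ (A : Space n × ℝ → ℝ → Space n → Space n) (B : Space n × ℝ → ℝ → Space n → ℝ)
        (S : StructureData n),
        MeasurableNonlinearity Ω T A → MeasurableNonlinearity Ω T B → S.Admissible Ω T θ →
        StructureInequalities Ω T S A B → a₀ ≤ S.a → S.b.norm Ω T ≤ Nb → S.c.norm Ω T ≤ Nc →
        S.d.norm Ω T ≤ Nd → ∀ (u : Space n × ℝ → ℝ) (M : ℝ), IsWeakSubsolution Ω T A B u →
        LeOnParabolicBoundary Ω T u M →
        ∀ᵐ z ∂(volume.restrict (cylinder Ω T)), u z ≤ M + C * S.k Ω T M := by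
  set k := ∑ i, levelCoeffBound θ T₀ Nb Nc Nd i with hk
  have hkf : k ≠ ∞ := ENNReal.sum_ne_top.2 fun i _ => levelCoeffBound_ne_top hθ i
  obtain ⟨C, hC, h⟩ := exists_level_bound hn hθ hθ' ha₀ (by positivity : 0 < 2 + 1 / (2 * a₀)) 7
    (ENNReal.toReal_nonneg (a := k)) (ENNReal.ofReal_ne_top (r := V₀))
  refine ⟨C, hC, ?_⟩
  intro T Ω hT hΩ hΩb hΩV A B S hA hB hS hAB ha hb hc hd u M ⟨ux, hu, hw⟩ hM
  have hk0 : 0 ≤ S.k Ω T M := add_nonneg (mul_nonneg (add_nonneg (S.b.norm_nonneg Ω T)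
    (S.d.norm_nonneg Ω T)) (abs_nonneg M)) (add_nonneg (S.f.norm_nonneg Ω T) (S.g.norm_nonneg Ω T))
  -- The level must be positive, whereas `k` may vanish; it is therefore approached from above by `k
  -- + 1 / (j + 1)`.
  have key : ∀ j : ℕ, ∀ᵐ z ∂(volume.restrict (cylinder Ω T)),
      u z - M ≤ C * (S.k Ω T M + 1 / ((j : ℝ) + 1)) := by
    intro j
    have hj : (0 : ℝ) < 1 / ((j : ℝ) + 1) := by positivity
    refine h Ω T _ _ (levelCoeffBound θ T₀ Nb Nc Nd) _ _ ux _ hΩ hΩb hΩV (by positivity)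
      (isSubcritical_levelCoeff hθ hθ' hT hS (by positivity) hb hc hd
        (le_add_of_nonneg_right hj.le)) (ENNReal.ofReal_toReal hkf).ge
      (isControlledSubsolution_sub_const hn hθ hθ' hΩ (hΩV.trans_lt ENNReal.ofReal_lt_top) hS hA hB
        hAB ha₀ ha (by positivity) (le_add_of_nonneg_right hj.le) hu hw hM)
  filter_upwards [ae_all_iff.2 key] with z hz
  have hlim : Tendsto (fun j : ℕ => C * (S.k Ω T M + 1 / ((j : ℝ) + 1))) atTop
      (𝓝 (C * (S.k Ω T M + 0))) :=
    (tendsto_const_nhds.add tendsto_one_div_add_atTop_nhds_zero_nat).const_mul C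
  have := ge_of_tendsto' hlim hz
  rw [add_zero] at this
  linarith

theorem IsWeakSolution.isWeakSubsolution {A : Space n × ℝ → ℝ → Space n → Space n}
    {B : Space n × ℝ → ℝ → Space n → ℝ} {u : Space n × ℝ → ℝ} (h : IsWeakSolution Ω T A B u) :
    IsWeakSubsolution Ω T A B u :=
  let ⟨ux, hu, hw⟩ := h
  ⟨ux, hu, fun φ hφ _ => (hw φ hφ).le⟩

theorem IsWeakSolution.isWeakSupersolution {A : Space n × ℝ → ℝ → Space n → Space n}
    {B : Space n × ℝ → ℝ → Space n → ℝ} {u : Space n × ℝ → ℝ} (h : IsWeakSolution Ω T A B u) :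
    IsWeakSupersolution Ω T A B u :=
  let ⟨ux, hu, hw⟩ := h
  ⟨ux, hu, fun φ hφ _ => (hw φ hφ).ge⟩

/-! ### Reflection -/

theorem MeasurableNonlinearity.reflect {F : Type*} [MeasurableSpace F] [Neg F] [MeasurableNeg F]
    {Φ : Space n × ℝ → ℝ → Space n → F} (h : MeasurableNonlinearity Ω T Φ) :
    MeasurableNonlinearity Ω T fun z u p => -Φ z (-u) (-p) :=
  (h.comp (measurable_fst.prodMk (measurable_snd.fst.neg.prodMk measurable_snd.snd.neg))).neg

theorem StructureInequalities.reflect {S : StructureData n}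
    {A : Space n × ℝ → ℝ → Space n → Space n} {B : Space n × ℝ → ℝ → Space n → ℝ}
    (h : StructureInequalities Ω T S A B) :
    StructureInequalities Ω T S (fun z u p => -A z (-u) (-p)) fun z u p => -B z (-u) (-p) := by
  filter_upwards [h] with z hz u p
  simpa using hz (-u) (-p)

theorem MemMixedLoc.neg {F : Type*} [NormedAddCommGroup F] {p q : ℝ≥0∞} {w : Space n × ℝ → F}
    (h : MemMixedLoc Ω T p q w) : MemMixedLoc Ω T p q fun z => -w z := by
  refine ⟨h.1.neg, fun K hK hKQ => lt_of_eq_of_lt ?_ (h.2 K hK hKQ)⟩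
  have e : ∀ t, eLpNorm (fun x => K.indicator (fun z => -w z) (x, t)) p (volume.restrict Ω) =
      eLpNorm (fun x => K.indicator w (x, t)) p (volume.restrict Ω) := fun t => by
    refine eLpNorm_congr_norm_ae (ae_of_all _ fun x => ?_)
    rw [norm_indicator_eq_indicator_norm, norm_indicator_eq_indicator_norm]
    simp only [norm_neg]
  simp only [mixedNorm, e]

theorem InEnergyClass.neg {u : Space n × ℝ → ℝ} {ux : Space n × ℝ → Space n}
    (h : InEnergyClass Ω T u ux) : InEnergyClass Ω T (fun z => -u z) fun z => -ux z := by
  refine ⟨h.1.neg, h.2.1.neg, fun φ hφ => ?_⟩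
  simp only [neg_smul, smul_neg, integral_neg, h.2.2 φ hφ]

theorem IsWeakSupersolution.reflect {A : Space n × ℝ → ℝ → Space n → Space n}
    {B : Space n × ℝ → ℝ → Space n → ℝ} {u : Space n × ℝ → ℝ}
    (h : IsWeakSupersolution Ω T A B u) :
    IsWeakSubsolution Ω T (fun z u p => -A z (-u) (-p)) (fun z u p => -B z (-u) (-p))
      fun z => -u z := by
  obtain ⟨ux, hu, hw⟩ := h
  refine ⟨_, hu.neg, fun φ hφ hφ0 => ?_⟩
  have := neg_le_neg (hw φ hφ hφ0)
  rw [← integral_neg, ← integral_neg] at this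
  simpa [add_comm] using this

theorem GeOnParabolicBoundary.reflect {u : Space n × ℝ → ℝ} {M : ℝ}
    (h : GeOnParabolicBoundary Ω T u M) : LeOnParabolicBoundary Ω T (fun z => -u z) (-M) := by
  intro ε hε
  obtain ⟨O, hO, hΓ, h⟩ := h ε hε
  refine ⟨O, hO, hΓ, ?_⟩
  filter_upwards [h] with z hz
  linarith

end

end ParabolicMax

theorem mainTheorem3 (n : ℕ) (hn : 1 ≤ n) (θ : ℝ) (hθ : 0 < θ) (hθ' : θ < 1)
    (a₀ : ℝ) (ha₀ : 0 < a₀) (Nb Nc Nd T₀ V₀ : ℝ) :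
    ∃ C : ℝ, 0 < C ∧
      ∀ (T : ℝ) (Ω : Set (ParabolicMax.Space n)),
        0 < T → T ≤ T₀ →
        IsOpen Ω → IsConnected Ω → Bornology.IsBounded Ω → volume Ω ≤ ENNReal.ofReal V₀ →
      ∀ (A : ParabolicMax.Space n × ℝ → ℝ → ParabolicMax.Space n → ParabolicMax.Space n)
        (B : ParabolicMax.Space n × ℝ → ℝ → ParabolicMax.Space n → ℝ)
        (S : ParabolicMax.StructureData n),
        ParabolicMax.MeasurableNonlinearity Ω T A →
        ParabolicMax.MeasurableNonlinearity Ω T B →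
        S.Admissible Ω T θ →
        ParabolicMax.StructureInequalities Ω T S A B →
        a₀ ≤ S.a → S.b.norm Ω T ≤ Nb → S.c.norm Ω T ≤ Nc → S.d.norm Ω T ≤ Nd →
      ∀ (u : ParabolicMax.Space n × ℝ → ℝ) (M : ℝ),
        ((ParabolicMax.IsWeakSolution Ω T A B u ∨ ParabolicMax.IsWeakSubsolution Ω T A B u) →
          ParabolicMax.LeOnParabolicBoundary Ω T u M →
          ∀ᵐ z ∂(volume.restrict (ParabolicMax.cylinder Ω T)), u z ≤ M + C * S.k Ω T M) ∧
        ((ParabolicMax.IsWeakSolution Ω T A B u ∨ ParabolicMax.IsWeakSupersolution Ω T A B u) →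
          ParabolicMax.GeOnParabolicBoundary Ω T u M →
          ∀ᵐ z ∂(volume.restrict (ParabolicMax.cylinder Ω T)), M - C * S.k Ω T M ≤ u z) := by
  obtain ⟨C, hC, h⟩ := ParabolicMax.exists_weakSubsolution_le hn hθ hθ' ha₀ Nb Nc Nd T₀ V₀
  refine ⟨C, hC, ?_⟩
  intro T Ω _ hT hΩ _ hΩb hΩV A B S hA hB hS hAB ha hb hc hd u M
  constructor
  · intro hu hM
    exact h T Ω hT hΩ hΩb hΩV A B S hA hB hS hAB ha hb hc hd u M
      (hu.elim (fun h => h.isWeakSubsolution) id) hM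
  -- The function `-u` is a subsolution of the reflected equation, which satisfies the same
  -- structure inequalities with the same coefficients. As `k` depends only on `|M|`, the upper
  -- bound for `-u` with boundary value `-M` is the assertion.
  · intro hu hM
    have := h T Ω hT hΩ hΩb hΩV _ _ S hA.reflect hB.reflect hS hAB.reflect ha hb hc hd _ (-M)
      (hu.elim (fun h => h.isWeakSupersolution) id).reflect hM.reflect
    rw [ParabolicMax.StructureData.k, abs_neg] at this
    filter_upwards [this] with z hz
    rw [ParabolicMax.StructureData.k]
    linarith
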